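/- Theorem 2.5. All spaces are real. A sequence in a Banach space is basic (respectively unconditional) if it is a Schauder basis (respectively an unconditional Schauder basis) of its closed linear span. A block subsequence of $(x_n)$ is a sequence of nonzero vectors $z_n=\sum_{k\in s_n}a_kx_k$ with finite sets $s_1<s_2<\cdots$; it is positive if all $a_k\ge 0$. For nonnegative functions of finitely supported scalar sequences, $f\lesssim g$ means $f\le Cg$ for some constant $C>0$ (equivalently $g\gtrsim f$), and $f\approx g$ means $f\lesssim g$ and $g\lesssim f$. A bounded operator $T:E\to X$ from a Banach lattice $E$ to a Banach space $X$ is DSS if there is no sequence of nonzero pairwise disjoint vectors of $E$ on whose closed linear span $T$ is an isomorphism onto its image, and LSS if $T$ is an isomorphism onto its image on no infinite-dimensional closed sublattice of $E$. Let $X$ be a Banach space. The following are equivalent: (a) There are a Banach lattice $E$ and an LSS operator $T:E\to X$ which is not DSS. (b) There are two basic sequences $(x_n)$ and $(y_n)$ in $X$ such that (b.1) no positive block subsequence of $(x_1,y_1,x_2,y_2,\dots)$ is unconditional; (b.2) $(x_n-y_n)$ is unconditional; (b.3) $\left\|\sum_n a_n(x_n-y_n)\right\|\approx\max\left\{\left\|\sum_n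 a_nx_n\right\|,\left\|\sum_n a_ny_n\right\|\right\}$. (c) There is a basic sequence $(x_n)$ in $X$ such that (c.1) $\left\|\sum_n |a_n|x_n\right\|\gtrsim\left\|\sum_n a_nx_n\right\|$; (c.2) no positive block subsequence of $(x_n)$ is unconditional; (c.3) there is a block subsequence $z_n=\sum_{k\in s_n}a_kx_k$ of $(x_n)$ such that $$\Big\|\sum_n b_nz_n\Big\|\approx\Big\|\sum_n|b_n|\Big(\sum_{k\in s_n}|a_k|x_k\Big)\Big\|\approx\max\Big\{\Big\|\sum_n b_nz_n^+\Big\|,\Big\|\sum_n b_nz_n^-\Big\|\Big\},$$ where $z_n^+=\sum_{k\in s_n,\,a_k>0}a_kx_k$ and $z_n^-=\sum_{k\in s_n,\,a_k<0}a_kx_k$. (d) There are a Banach lattice $E$ and two LSS operators $T_1,T_2:E\to X$ such that $T_1+T_2$ is not LSS. Moreover, for a basic sequence $(x_n)$ in $X$ satisfying (c.1), condition (c.2) is equivalent to: for every positive block subsequence $(y_n)$ of $(x_n)$ and every $\varepsilon>0$ there is a finitely supported scalar sequence $(b_n)$ with $\left\|\sum_n|b_n|y_n\right\|=1$ and $\left\|\sum_n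 b_ny_n\right\|<\varepsilon$. -/

import Mathlib

universe u v

/-! ### Banach lattices, and operators on them -/

/-- A (real) Banach lattice: a complete normed vector lattice whose norm is solid, that is,
`|x| ≤ |y|` implies `‖x‖ ≤ ‖y‖`. -/
class IsBanachLattice (E : Type*) [NormedAddCommGroup E] [NormedSpace ℝ E] [Lattice E] : Prop
    extends HasSolidNorm E, IsOrderedAddMonoid E, IsOrderedModule ℝ E, CompleteSpace E

/-- The closed linear span `[xₙ]` of a sequence. -/
def closedSpan {X : Type*} [NormedAddCommGroup X] [NormedSpace ℝ X] (x : ℕ → X) :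
    Submodule ℝ X :=
  (Submodule.span ℝ (Set.range x)).topologicalClosure

/-- The restriction of the bounded operator `T` to the subspace `S` is an isomorphism onto its
image. -/
def IsIsoOn {E X : Type*} [NormedAddCommGroup E] [NormedSpace ℝ E]
    [NormedAddCommGroup X] [NormedSpace ℝ X] (T : E →L[ℝ] X) (S : Submodule ℝ E) : Prop :=
  ∃ c : ℝ, 0 < c ∧ ∀ v ∈ S, c * ‖v‖ ≤ ‖T v‖

/-- Disjointly strictly singular: `T` is an isomorphism on the closed span of no sequence of
nonzero pairwise disjoint vectors. -/
def IsDSS {E X : Type*} [NormedAddCommGroup E] [NormedSpace ℝ E] [Lattice E]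
    [NormedAddCommGroup X] [NormedSpace ℝ X] (T : E →L[ℝ] X) : Prop :=
  ∀ x : ℕ → E, (∀ n, x n ≠ 0) → (∀ m n, m ≠ n → |x m| ⊓ |x n| = 0) →
    ¬ IsIsoOn T (closedSpan x)

/-- Lattice strictly singular: `T` is an isomorphism on no infinite-dimensional closed
(vector) sublattice. -/
def IsLSS {E X : Type*} [NormedAddCommGroup E] [NormedSpace ℝ E] [Lattice E]
    [NormedAddCommGroup X] [NormedSpace ℝ X] (T : E →L[ℝ] X) : Prop :=
  ∀ S : Submodule ℝ E, SupClosed (S : Set E) → InfClosed (S : Set E) →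
    IsClosed (S : Set E) → ¬ FiniteDimensional ℝ S → ¬ IsIsoOn T S

/-! ### Basic sequences and block subsequences -/

/-- `x` is a basic sequence: a Schauder basis of its closed linear span. -/
def IsBasicSeq {X : Type*} [NormedAddCommGroup X] [NormedSpace ℝ X] (x : ℕ → X) : Prop :=
  ∃ b : SchauderBasis ℝ (closedSpan x), ∀ n, (b n : X) = x n

/-- `x` is an unconditional (basic) sequence: an unconditional Schauder basis of its closed
linear span. -/
def IsUnconditionalSeq {X : Type*} [NormedAddCommGroup X] [NormedSpace ℝ X] (x : ℕ → X) : Prop :=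
  ∃ b : UnconditionalSchauderBasis ℕ ℝ (closedSpan x), ∀ n, (b n : X) = x n

/-- `z` is the block subsequence `zₙ = ∑_{k ∈ sₙ} aₖ xₖ` of `x`: the sets `sₙ` are finite and
successive (`s₀ < s₁ < ⋯`), and the vectors `zₙ` are nonzero. -/
structure IsBlockSubseq {X : Type*} [NormedAddCommGroup X] [NormedSpace ℝ X]
    (x : ℕ → X) (s : ℕ → Finset ℕ) (a : ℕ → ℝ) (z : ℕ → X) : Prop where
  successive : ∀ m n, m < n → ∀ i ∈ s m, ∀ j ∈ s n, i < j
  eq_sum : ∀ n, z n = ∑ k ∈ s n, a k • x k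
  ne_zero : ∀ n, z n ≠ 0

/-- `z` is a block subsequence of `x` with nonnegative coefficients. -/
def IsPositiveBlockSubseq {X : Type*} [NormedAddCommGroup X] [NormedSpace ℝ X]
    (x z : ℕ → X) : Prop :=
  ∃ (s : ℕ → Finset ℕ) (a : ℕ → ℝ), (∀ k, 0 ≤ a k) ∧ IsBlockSubseq x s a z

/-- The sequence `(x₀, y₀, x₁, y₁, …)`. -/
def interleave {X : Type*} (x y : ℕ → X) : ℕ → X :=
  fun n => if n % 2 = 0 then x (n / 2) else y (n / 2)

/-! ### Norm estimates for finite linear combinations -/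

/-- The vector `∑ₙ aₙ xₙ`, for finitely supported scalars `a`. -/
noncomputable def comb {X : Type*} [NormedAddCommGroup X] [NormedSpace ℝ X]
    (a : ℕ →₀ ℝ) (x : ℕ → X) : X :=
  a.sum fun n t => t • x n

/-- The vector `∑ₙ |aₙ| xₙ`, for finitely supported scalars `a`. -/
noncomputable def absComb {X : Type*} [NormedAddCommGroup X] [NormedSpace ℝ X]
    (a : ℕ →₀ ℝ) (x : ℕ → X) : X :=
  a.sum fun n t => |t| • x n

/-- `f ≲ g`: there is a constant `C > 0` with `f a ≤ C * g a` for all `a`. -/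
def LeConst {ι : Type*} (f g : ι → ℝ) : Prop :=
  ∃ C : ℝ, 0 < C ∧ ∀ a, f a ≤ C * g a

/-- `f ≈ g`: `f ≲ g` and `g ≲ f`. -/
def ApproxEq {ι : Type*} (f g : ι → ℝ) : Prop :=
  LeConst f g ∧ LeConst g f

/-- `‖∑ₙ |aₙ| xₙ‖ ≳ ‖∑ₙ aₙ xₙ‖`. -/
def AbsDominates {X : Type*} [NormedAddCommGroup X] [NormedSpace ℝ X] (x : ℕ → X) : Prop :=
  LeConst (fun a : ℕ →₀ ℝ => ‖comb a x‖) (fun a => ‖absComb a x‖)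

/-- No positive block subsequence of `x` is unconditional. -/
def NoUnconditionalPositiveBlock {X : Type*} [NormedAddCommGroup X] [NormedSpace ℝ X]
    (x : ℕ → X) : Prop :=
  ∀ v : ℕ → X, IsPositiveBlockSubseq x v → ¬ IsUnconditionalSeq v

/-!
# Lattice strictly singular operators which are not disjointly strictly singular

**From operators to sequences.** Let `T` be LSS and an isomorphism on the span of disjoint vectors
`eₙ`. On coefficient sequences put `N a = ‖∑ aₙ eₙ‖`, `P a = T (∑ aₙ eₙ⁺)`, `Q a = T (∑ aₙ eₙ⁻)`.
Then `‖P a - Q a‖` is equivalent to the lattice norm `N a`, whereas the LSS property prevents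
`P a + Q b` from being equivalent to `N a + N b` on any sequence of disjoint positive pairs `(a, b)`
(`SplitPair`). This contrast has three consequences.

* After passing to a tail, `‖P a + Q b‖ ≥ δ (N a + N b)` for *positive* `a`, `b`: if `P a + Q b`
  were negligible along positive blocks, then `Q (a + b) ≈ -(P - Q) a` would be bounded below on all
  their combinations (`SplitPair.exists_add_ge`).
* There are normalized positive `c` for which `P c` and `Q c` are almost annihilated by finitely
  many given functionals. Otherwise `N` would be a weighted `ℓ¹` norm, `P - Q` would give an `ℓ¹`
  sequence, and a James-type argument (`LowerL1.exists_nonneg`) would turn it into an `ℓ¹` sequence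
  spanned by positive blocks (`SplitPair.exists_small_functionals`).
* `P c` and `Q c` are uniformly linearly independent for normalized positive `c` far out, since if
  `Q c ≈ r P c` with `|r| ≤ 1`, then `P c ≈ (P - Q) (c / (1 - r))`
  (`SplitPair.exists_le_norm_smul_add`).

The last two allow Mazur's construction of positive blocks `cₙ` for which
`(P c₀, Q c₀, P c₁, Q c₁, …)` is basic (`SplitPair.exists_isBasicSeq`). By the first, absolute
values dominate in this sequence, so that an unconditional positive block sequence would give a lower
estimate for `P a + Q b`; and the signed blocks `P cₙ - Q cₙ` are unconditional. More generally, the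
positive and negative parts of signed blocks of this kind form the two sequences of the second
condition of the theorem (`exists_isDominatedPair`).

**From sequences to operators.** A sequence `x` of nonzero vectors defines a Banach lattice of
scalar sequences with the norm `sup {∑ |aₙ φ(xₙ)| : ‖φ‖ ≤ 1}`, the largest norm of a signed
combination `∑ ± aₙ xₙ`; no basis property is needed (`dualWeights`, `WeightFamily.SeqLattice`). An
operator that sends the unit vectors to a sequence without unconditional positive blocks is LSS on
such a lattice by a gliding hump, because an infinite-dimensional closed sublattice contains a
positive disjoint sequence (`exists_unconditional_of_not_isLSS`). The lattice of
`(x₀, y₀, x₁, y₁, …)` carries an LSS operator which is not DSS, and the lattice of `(xₙ - yₙ)`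
carries two LSS operators whose sum is not LSS.

**From sums to single operators.** If `T₁ + T₂` is an isomorphism on a positive disjoint sequence
and `T₁` is LSS, then `T₁` is negligible on blocks of this sequence, where `T₂` is therefore an
isomorphism (`IsLSS.not_isDSS_of_add`).
-/

/-! ### Finite linear combinations -/

section Combinations

variable {X : Type*} [NormedAddCommGroup X] [NormedSpace ℝ X]

lemma comb_eq (a : ℕ →₀ ℝ) (x : ℕ → X) : comb a x = Finsupp.linearCombination ℝ x a := rfl

/-- The finitely supported sequence `(|aₙ|)`. -/
noncomputable def finsuppAbs {ι : Type*} (a : ι →₀ ℝ) : ι →₀ ℝ := a.mapRange (fun t => |t|) abs_zero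

@[simp] lemma finsuppAbs_apply {ι : Type*} (a : ι →₀ ℝ) (i : ι) : finsuppAbs a i = |a i| := rfl

lemma absComb_eq (a : ℕ →₀ ℝ) (x : ℕ → X) : absComb a x = comb (finsuppAbs a) x := by
  rw [comb, finsuppAbs, Finsupp.sum_mapRange_index (by simp)]
  rfl

lemma comb_mem_span (a : ℕ →₀ ℝ) (x : ℕ → X) : comb a x ∈ Submodule.span ℝ (Set.range x) :=
  (Finsupp.mem_span_range_iff_exists_finsupp).2 ⟨a, rfl⟩

lemma mem_span_iff_comb {x : ℕ → X} {y : X} :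
    y ∈ Submodule.span ℝ (Set.range x) ↔ ∃ a, comb a x = y :=
  Finsupp.mem_span_range_iff_exists_finsupp

lemma sum_smul_eq_comb_filter (F : Finset ℕ) (a : ℕ →₀ ℝ) (x : ℕ → X) :
    ∑ i ∈ F, a i • x i = comb (a.filter (· ∈ F)) x := by
  rw [comb, Finsupp.sum_of_support_subset (s := F)]
  · exact Finset.sum_congr rfl fun i hi => by simp [hi]
  · intro i hi
    simp only [Finsupp.support_filter, Finset.mem_filter] at hi
    exact hi.2
  · simp

lemma sum_eq_comb {F : Finset ℕ} {a : ℕ →₀ ℝ} (h : a.support ⊆ F) (x : ℕ → X) :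
    ∑ i ∈ F, a i • x i = comb a x := by
  rw [comb, Finsupp.sum_of_support_subset (s := F) _ h _ (by simp)]

lemma comb_single (n : ℕ) (t : ℝ) (x : ℕ → X) : comb (Finsupp.single n t) x = t • x n := by
  simp [comb]

lemma comb_add (a b : ℕ →₀ ℝ) (x : ℕ → X) : comb (a + b) x = comb a x + comb b x := by
  simp [comb_eq]

lemma comb_sub (a b : ℕ →₀ ℝ) (x : ℕ → X) : comb (a - b) x = comb a x - comb b x := by
  simp [comb_eq]

lemma comb_smul (t : ℝ) (a : ℕ →₀ ℝ) (x : ℕ → X) : comb (t • a) x = t • comb a x := by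
  simp [comb_eq]

lemma comb_comp (a : ℕ →₀ ℝ) (x : ℕ → X) (φ : ℕ → ℕ) : comb a (x ∘ φ) = comb (a.mapDomain φ) x := by
  rw [comb_eq, comb_eq, Finsupp.linearCombination_mapDomain]

lemma comb_comb (f : ℕ →₀ ℝ) (c : ℕ → ℕ →₀ ℝ) (x : ℕ → X) :
    comb f (fun n => comb (c n) x) = comb (Finsupp.linearCombination ℝ c f) x := by
  simp only [comb_eq]
  rw [Finsupp.linearCombination_linearCombination]

lemma comb_sub_right (a : ℕ →₀ ℝ) (x y : ℕ → X) :
    comb a (fun n => x n - y n) = comb a x - comb a y := by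
  simp [comb, Finsupp.sum, smul_sub]

lemma finsuppAbs_mapDomain {φ : ℕ → ℕ} (hφ : Function.Injective φ) (a : ℕ →₀ ℝ) :
    finsuppAbs (a.mapDomain φ) = (finsuppAbs a).mapDomain φ := by
  ext i
  by_cases hi : i ∈ Set.range φ
  · obtain ⟨j, rfl⟩ := hi
    simp [Finsupp.mapDomain_apply hφ]
  · simp [Finsupp.mapDomain_of_notMem_range _ _ hi]

lemma abs_mapDomain_eq {φ : ℕ → ℕ} (hφ : Function.Injective φ) {a b : ℕ →₀ ℝ}
    (h : ∀ i, |b i| = |a i|) (i : ℕ) : |b.mapDomain φ i| = |a.mapDomain φ i| := by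
  have : finsuppAbs b = finsuppAbs a := Finsupp.ext h
  rw [← finsuppAbs_apply, ← finsuppAbs_apply, finsuppAbs_mapDomain hφ,
    finsuppAbs_mapDomain hφ, this]

/-- A linear map on finitely supported sequences which is geometrically small on the unit vectors
is small on coefficients bounded by `M`. It absorbs the perturbation errors in the block
constructions. -/
lemma norm_map_le_of_small {L : (ℕ →₀ ℝ) →ₗ[ℝ] X} {η M : ℝ} (hη : 0 ≤ η) (hM : 0 ≤ M)
    (hL : ∀ n, ‖L (Finsupp.single n 1)‖ ≤ η * (1 / 2) ^ (n + 1)) {f : ℕ →₀ ℝ}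
    (hf : ∀ n, |f n| ≤ M) : ‖L f‖ ≤ η * M := by
  have h1 : L f = ∑ n ∈ f.support, f n • L (Finsupp.single n 1) := by
    conv_lhs => rw [← Finsupp.sum_single f]
    rw [Finsupp.sum, map_sum]
    refine Finset.sum_congr rfl fun n _ => ?_
    rw [← map_smul, Finsupp.smul_single, smul_eq_mul, mul_one]
  have hs : Summable fun n : ℕ => (1 / 2 : ℝ) ^ (n + 1) :=
    (summable_nat_add_iff 1).2 summable_geometric_two
  have ht : ∑' n : ℕ, (1 / 2 : ℝ) ^ (n + 1) = 1 := by
    have := summable_geometric_two.tsum_eq_zero_add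
    rw [tsum_geometric_two] at this
    norm_num at this ⊢
    linarith
  calc ‖L f‖ ≤ ∑ n ∈ f.support, ‖f n • L (Finsupp.single n 1)‖ := by rw [h1]; exact norm_sum_le _ _
    _ ≤ ∑ n ∈ f.support, M * (η * (1 / 2) ^ (n + 1)) := by
        refine Finset.sum_le_sum fun n _ => ?_
        rw [norm_smul]
        exact mul_le_mul (hf n) (hL n) (norm_nonneg _) hM
    _ = (η * M) * ∑ n ∈ f.support, (1 / 2 : ℝ) ^ (n + 1) := by
        rw [Finset.mul_sum]; exact Finset.sum_congr rfl fun n _ => by ring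
    _ ≤ (η * M) * 1 := by
        refine mul_le_mul_of_nonneg_left ?_ (mul_nonneg hη hM)
        exact (hs.sum_le_tsum _ fun n _ => by positivity).trans ht.le
    _ = η * M := mul_one _

end Combinations

/-! ### Basic and unconditional sequences -/

section Bases

open Filter Topology

variable {X : Type*} [NormedAddCommGroup X] [NormedSpace ℝ X]

lemma exists_biorthogonal {x : ℕ → X} (hx : ∀ n, x n ≠ 0)
    (hK : ∀ n, ∃ K, ∀ a : ℕ →₀ ℝ, ‖a n • x n‖ ≤ K * ‖comb a x‖) :
    ∃ φ : ℕ → StrongDual ℝ X, ∀ (a : ℕ →₀ ℝ) n, φ n (comb a x) = a n := by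
  have hli : LinearIndependent ℝ x := by
    rw [linearIndependent_iff]
    intro a ha
    ext n
    obtain ⟨K, hK⟩ := hK n
    have := hK a
    rw [comb_eq, ha, norm_zero, mul_zero, norm_le_zero_iff, smul_eq_zero] at this
    simpa [hx n] using this
  have key : ∀ n, ∃ φ : StrongDual ℝ X, ∀ a : ℕ →₀ ℝ, φ (comb a x) = a n := by
    intro n
    obtain ⟨K, hK⟩ := hK n
    have hrepr : ∀ a : ℕ →₀ ℝ, hli.repr ⟨comb a x, comb_mem_span a x⟩ = a :=
      fun a => hli.repr_eq rfl
    let f : StrongDual ℝ (Submodule.span ℝ (Set.range x)) :=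
      LinearMap.mkContinuous ((Finsupp.lapply n).comp hli.repr) (K / ‖x n‖) (by
        rintro ⟨y, hy⟩
        obtain ⟨a, rfl⟩ := mem_span_iff_comb.1 hy
        have h0 : 0 < ‖x n‖ := norm_pos_iff.2 (hx n)
        have := hK a
        rw [norm_smul] at this
        change ‖hli.repr ⟨comb a x, hy⟩ n‖ ≤ K / ‖x n‖ * ‖comb a x‖
        rw [hrepr, div_mul_eq_mul_div, le_div_iff₀ h0]
        exact this)
    obtain ⟨g, hg, -⟩ := exists_extension_norm_eq _ f
    refine ⟨g, fun a => ?_⟩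
    have h := hg ⟨comb a x, comb_mem_span a x⟩
    change g (comb a x) = hli.repr ⟨comb a x, comb_mem_span a x⟩ n at h
    rw [h, hrepr]
  choose φ hφ using key
  exact ⟨φ, fun a n => hφ n a⟩

/-- Grünblum's criterion, for summation along an arbitrary filter `L`: uniformly bounded
coordinate projections onto `L`-almost all finite sets make `x` a basis of its closed span. -/
lemma exists_generalSchauderBasis {x : ℕ → X} {φ : ℕ → StrongDual ℝ X}
    (hφ : ∀ (a : ℕ →₀ ℝ) n, φ n (comb a x) = a n) (L : SummationFilter ℕ) {K : ℝ} (hK0 : 0 ≤ K)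
    (hK : ∀ᶠ F in L.filter, ∀ a : ℕ →₀ ℝ, ‖∑ i ∈ F, a i • x i‖ ≤ K * ‖comb a x‖)
    (hcof : ∀ i, ∀ᶠ F in L.filter, i ∈ F) :
    ∃ b : GeneralSchauderBasis ℕ ℝ (closedSpan x) L, ∀ n, (b n : X) = x n := by
  have hmem : ∀ n, x n ∈ closedSpan x := fun n =>
    Submodule.le_topologicalClosure _ (Submodule.subset_span ⟨n, rfl⟩)
  have hclos : ∀ F : Finset ℕ, (∀ a : ℕ →₀ ℝ, ‖∑ i ∈ F, a i • x i‖ ≤ K * ‖comb a x‖) →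
      ∀ y ∈ closedSpan x, ‖∑ i ∈ F, φ i y • x i‖ ≤ K * ‖y‖ := by
    intro F hF y hy
    have hcl : IsClosed {y : X | ‖∑ i ∈ F, φ i y • x i‖ ≤ K * ‖y‖} :=
      isClosed_le (by fun_prop) (by fun_prop)
    refine hcl.closure_subset_iff.2 ?_ hy
    intro z hz
    obtain ⟨a, rfl⟩ := mem_span_iff_comb.1 hz
    simpa only [Set.mem_ofPred_eq, hφ] using hF a
  refine ⟨⟨fun n => ⟨x n, hmem n⟩, fun n => (φ n).comp (closedSpan x).subtypeL, ?_, ?_⟩,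
    fun n => rfl⟩
  · intro i j
    have := hφ (Finsupp.single j 1) i
    rw [comb_single, one_smul] at this
    change φ i (x j) = _
    rw [this, Finsupp.single_eq_pi_single]
    simp only [Pi.single_apply]
    split_ifs <;> rfl
  · rintro ⟨y, hy⟩
    rw [HasSum, Topology.IsInducing.subtypeVal.tendsto_nhds_iff, Metric.tendsto_nhds]
    intro ε hε
    obtain ⟨p, hp, hyp⟩ := Metric.mem_closure_iff.1 hy (ε / (K + 1)) (by positivity)
    obtain ⟨a, rfl⟩ := mem_span_iff_comb.1 hp
    have hsub : ∀ᶠ F in L.filter, a.support ⊆ F := by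
      have := (Filter.eventually_all_finset a.support).2 fun i _ => hcof i
      exact this
    filter_upwards [hK, hsub] with F hF hF'
    have h1 := hclos F hF (y - comb a x) (Submodule.sub_mem _ hy
      (Submodule.le_topologicalClosure _ hp))
    have h2 : ∑ i ∈ F, φ i (y - comb a x) • x i = (∑ i ∈ F, φ i y • x i) - comb a x := by
      rw [← sum_eq_comb hF' x, ← Finset.sum_sub_distrib]
      refine Finset.sum_congr rfl fun i _ => ?_
      rw [sum_eq_comb hF' x, map_sub, hφ, sub_smul]
    rw [h2] at h1
    rw [dist_eq_norm] at hyp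
    rw [lt_div_iff₀ (by positivity)] at hyp
    suffices h : dist (∑ i ∈ F, φ i y • x i) y < ε by
      simpa using h
    rw [dist_eq_norm]
    calc ‖∑ i ∈ F, φ i y • x i - y‖
        = ‖(∑ i ∈ F, φ i y • x i - comb a x) - (y - comb a x)‖ := by congr 1; abel
      _ ≤ K * ‖y - comb a x‖ + ‖y - comb a x‖ := (norm_sub_le _ _).trans (by gcongr)
      _ < ε := by linarith

lemma GeneralSchauderBasis.norm_sum_le_of_closedSpan {x : ℕ → X} {L : SummationFilter ℕ}
    (b : GeneralSchauderBasis ℕ ℝ (closedSpan x) L) (hb : ∀ n, (b n : X) = x n) (F : Finset ℕ)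
    (a : ℕ →₀ ℝ) : ‖∑ i ∈ F, a i • x i‖ ≤ ‖b.proj F‖ * ‖comb a x‖ := by
  let y : closedSpan x := Finsupp.linearCombination ℝ b a
  have hy : (y : X) = comb a x := by
    simp only [y, comb, Finsupp.linearCombination_apply, Finsupp.sum]
    simp [hb]
  have hc : ∀ i, b.coord i y = a i := by
    intro i
    simp only [y, Finsupp.linearCombination_apply, Finsupp.sum, map_sum, map_smul, b.ortho,
      Pi.single_apply, smul_eq_mul, mul_ite, mul_one, mul_zero, Finset.sum_ite_eq]
    split_ifs with h
    · rfl
    · exact (Finsupp.notMem_support_iff.1 h).symm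
  have h := (b.proj F).le_opNorm y
  have h1 : ((b.proj F y : closedSpan x) : X) = ∑ i ∈ F, a i • x i := by
    rw [GeneralSchauderBasis.proj_apply]
    simp [hc, hb]
  have h2 : ‖b.proj F y‖ = ‖∑ i ∈ F, a i • x i‖ := by rw [← h1]; rfl
  have h3 : ‖y‖ = ‖comb a x‖ := by rw [← hy]; rfl
  rwa [h2, h3] at h

lemma isBasicSeq_iff [CompleteSpace X] {x : ℕ → X} :
    IsBasicSeq x ↔ (∀ n, x n ≠ 0) ∧
      ∃ K : ℝ, ∀ (a : ℕ →₀ ℝ) n, ‖∑ i ∈ Finset.range n, a i • x i‖ ≤ K * ‖comb a x‖ := by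
  constructor
  · rintro ⟨b, hb⟩
    have : CompleteSpace (closedSpan x) :=
      (Submodule.isClosed_topologicalClosure _).completeSpace_coe
    obtain ⟨K, hK⟩ := SchauderBasis.exists_norm_proj_le b
    refine ⟨fun n hn => b.linearIndependent.ne_zero n (Subtype.ext ((hb n).trans hn)), K, ?_⟩
    exact fun a n => (b.norm_sum_le_of_closedSpan hb _ a).trans
      (mul_le_mul_of_nonneg_right (hK n) (norm_nonneg _))
  · rintro ⟨hx, K, hK⟩
    have hsing : ∀ n, ∃ K, ∀ a : ℕ →₀ ℝ, ‖a n • x n‖ ≤ K * ‖comb a x‖ := by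
      intro n
      refine ⟨K + K, fun a => ?_⟩
      have : a n • x n =
          (∑ i ∈ Finset.range (n + 1), a i • x i) - ∑ i ∈ Finset.range n, a i • x i := by
        rw [Finset.sum_range_succ]; abel
      rw [this, add_mul]
      exact (norm_sub_le _ _).trans (add_le_add (hK _ _) (hK _ _))
    obtain ⟨φ, hφ⟩ := exists_biorthogonal hx hsing
    refine exists_generalSchauderBasis hφ _ (le_max_right K 0) ?_ ?_
    · rw [SummationFilter.conditional_filter_eq_map_range, eventually_map]
      exact Eventually.of_forall fun n a => (hK a n).trans
        (mul_le_mul_of_nonneg_right (le_max_left _ _) (norm_nonneg _))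
    · intro i
      rw [SummationFilter.conditional_filter_eq_map_range, eventually_map]
      filter_upwards [eventually_gt_atTop i] with n hn using Finset.mem_range.2 hn

lemma isUnconditionalSeq_iff [CompleteSpace X] {x : ℕ → X} :
    IsUnconditionalSeq x ↔ (∀ n, x n ≠ 0) ∧ ∃ K : ℝ, 0 < K ∧
      ∀ a b : ℕ →₀ ℝ, (∀ i, |b i| = |a i|) → ‖comb b x‖ ≤ K * ‖comb a x‖ := by
  constructor
  · rintro ⟨b, hb⟩
    have : CompleteSpace (closedSpan x) :=
      (Submodule.isClosed_topologicalClosure _).completeSpace_coe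
    obtain ⟨K, hK⟩ := UnconditionalSchauderBasis.exists_norm_proj_le b
    have hK0 : 0 ≤ K := (norm_nonneg _).trans (hK ∅)
    have hproj : ∀ (F : Finset ℕ) (a : ℕ →₀ ℝ), ‖∑ i ∈ F, a i • x i‖ ≤ K * ‖comb a x‖ :=
      fun F a => (b.norm_sum_le_of_closedSpan hb F a).trans
        (mul_le_mul_of_nonneg_right (hK F) (norm_nonneg _))
    refine ⟨fun n hn => b.linearIndependent.ne_zero n (Subtype.ext ((hb n).trans hn)),
      2 * K + 1, by positivity, ?_⟩
    intro a c hac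
    -- `c` agrees with `a` on `F` and with `-a` off `F`
    let F := a.support.filter fun i => c i = a i
    have hF : comb c x = (2 : ℝ) • (∑ i ∈ F, a i • x i) - comb a x := by
      rw [sum_smul_eq_comb_filter, ← comb_smul, ← comb_sub]
      congr 1
      ext i
      simp only [Finsupp.coe_sub, Finsupp.coe_smul, Pi.sub_apply, Pi.smul_apply, smul_eq_mul, F,
        Finsupp.filter_apply, Finset.mem_filter, Finsupp.mem_support_iff]
      rcases abs_eq_abs.1 (hac i) with h | h
      · by_cases h0 : a i = 0
        · simp [h, h0]
        · simp [h, h0]; ring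
      · by_cases h0 : a i = 0
        · simp [h, h0]
        · rw [if_neg (fun hh => h0 (by linarith [hh.2]))]
          simp [h]
    rw [hF]
    calc ‖(2 : ℝ) • (∑ i ∈ F, a i • x i) - comb a x‖
        ≤ ‖(2 : ℝ) • (∑ i ∈ F, a i • x i)‖ + ‖comb a x‖ := norm_sub_le _ _
      _ = 2 * ‖∑ i ∈ F, a i • x i‖ + ‖comb a x‖ := by rw [norm_smul]; norm_num
      _ ≤ 2 * (K * ‖comb a x‖) + ‖comb a x‖ := by gcongr; exact hproj F a
      _ = _ := by ring
  · rintro ⟨hx, K, hK0, hK⟩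
    have hproj : ∀ (F : Finset ℕ) (a : ℕ →₀ ℝ), ‖∑ i ∈ F, a i • x i‖ ≤ (1 + K) * ‖comb a x‖ := by
      intro F a
      -- the coordinate projection is the mean of the identity and a change of signs
      let c : ℕ →₀ ℝ := (2 : ℝ) • a.filter (· ∈ F) - a
      have hc : ∀ i, |c i| = |a i| := by
        intro i
        by_cases hi : i ∈ F
        · simp only [Finsupp.coe_sub, Finsupp.coe_smul, Pi.sub_apply, Pi.smul_apply, c,
            smul_eq_mul, Finsupp.filter_apply, if_pos hi]
          congr 1; ring
        · simp [c, hi]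
      have h1 : (2 : ℝ) • ∑ i ∈ F, a i • x i = comb a x + comb c x := by
        rw [sum_smul_eq_comb_filter, ← comb_smul, ← comb_add]
        congr 1
        simp [c]
      have h2 : 2 * ‖∑ i ∈ F, a i • x i‖ ≤ ‖comb a x‖ + K * ‖comb a x‖ := by
        have := norm_add_le (comb a x) (comb c x)
        rw [← h1, norm_smul] at this
        norm_num at this
        linarith [hK a c hc]
      nlinarith [norm_nonneg (∑ i ∈ F, a i • x i)]
    have hsing : ∀ n, ∃ K, ∀ a : ℕ →₀ ℝ, ‖a n • x n‖ ≤ K * ‖comb a x‖ := fun n =>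
      ⟨1 + K, fun a => by simpa using hproj {n} a⟩
    obtain ⟨φ, hφ⟩ := exists_biorthogonal hx hsing
    refine exists_generalSchauderBasis hφ _ (by positivity : 0 ≤ 1 + K) ?_ ?_
    · exact Eventually.of_forall fun F a => hproj F a
    · intro i
      rw [SummationFilter.unconditional_filter]
      filter_upwards [eventually_ge_atTop {i}] with F hF using hF (Finset.mem_singleton_self i)

lemma IsUnconditionalSeq.comp [CompleteSpace X] {x : ℕ → X} (hx : IsUnconditionalSeq x)
    {φ : ℕ → ℕ} (hφ : Function.Injective φ) : IsUnconditionalSeq (x ∘ φ) := by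
  obtain ⟨h0, K, hK0, hK⟩ := isUnconditionalSeq_iff.1 hx
  refine isUnconditionalSeq_iff.2 ⟨fun n => h0 _, K, hK0, fun a b hab => ?_⟩
  rw [comb_comp, comb_comp]
  exact hK _ _ (abs_mapDomain_eq hφ hab)

end Bases

/-! ### Blocks with disjoint or successive supports -/

section Blocks

open Finsupp (linearCombination)

/-- The supports of the members of `c` are pairwise disjoint. -/
def DisjointSupports {ι : Type*} (c : ℕ → ι →₀ ℝ) : Prop :=
  ∀ m n, m ≠ n → Disjoint (c m).support (c n).support

/-- The supports of the members of `c` are successive. -/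
def SuccessiveSupports (c : ℕ → ℕ →₀ ℝ) : Prop :=
  ∀ m n, m < n → ∀ i ∈ (c m).support, ∀ j ∈ (c n).support, i < j

lemma SuccessiveSupports.disjoint {c : ℕ → ℕ →₀ ℝ} (hc : SuccessiveSupports c) :
    DisjointSupports c := by
  intro m n hmn
  rw [Finset.disjoint_left]
  intro i hi hj
  rcases lt_or_gt_of_ne hmn with h | h
  · exact lt_irrefl _ (hc m n h i hi i hj)
  · exact lt_irrefl _ (hc n m h i hj i hi)

variable {ι : Type*} {c : ℕ → ι →₀ ℝ}

lemma linearCombination_finsupp_apply (c : ℕ → ι →₀ ℝ) (f : ℕ →₀ ℝ) (k : ι) :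
    linearCombination ℝ c f k = f.sum fun n t => t * c n k := by
  simp [Finsupp.linearCombination_apply, Finsupp.sum, Finsupp.finsetSum_apply]

lemma DisjointSupports.linearCombination_apply (hc : DisjointSupports c) {n : ℕ} {k : ι}
    (hk : c n k ≠ 0) (f : ℕ →₀ ℝ) : linearCombination ℝ c f k = f n * c n k := by
  rw [linearCombination_finsupp_apply, Finsupp.sum, Finset.sum_eq_single n]
  · intro m _ hmn
    have := Finset.disjoint_right.1 (hc m n hmn) (Finsupp.mem_support_iff.2 hk)
    rw [Finsupp.notMem_support_iff.1 this, mul_zero]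
  · intro hn
    rw [Finsupp.notMem_support_iff.1 hn, zero_mul]

lemma linearCombination_apply_eq_zero {k : ι} (hk : ∀ n, c n k = 0) (f : ℕ →₀ ℝ) :
    linearCombination ℝ c f k = 0 := by
  rw [linearCombination_finsupp_apply]
  simp [Finsupp.sum, hk]

lemma linearCombination_nonneg (hc : ∀ n k, 0 ≤ c n k) {f : ℕ →₀ ℝ} (hf : ∀ n, 0 ≤ f n) (k : ι) :
    0 ≤ linearCombination ℝ c f k := by
  rw [linearCombination_finsupp_apply]
  exact Finset.sum_nonneg fun n _ => mul_nonneg (hf n) (hc n k)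

lemma DisjointSupports.abs_linearCombination_le {d : ℕ → ι →₀ ℝ} (hd : DisjointSupports d)
    (hcd : ∀ n k, |c n k| ≤ |d n k|) {f g : ℕ →₀ ℝ} (hfg : ∀ n, |f n| ≤ |g n|) (k : ι) :
    |linearCombination ℝ c f k| ≤ |linearCombination ℝ d g k| := by
  have hc0 : ∀ n, d n k = 0 → c n k = 0 := fun n h =>
    abs_eq_zero.1 (le_antisymm ((hcd n k).trans (by simp [h])) (abs_nonneg _))
  have hc : DisjointSupports c := by
    intro m n hmn
    refine Finset.disjoint_of_subset_left ?_ (Finset.disjoint_of_subset_right ?_ (hd m n hmn)) <;>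
    · intro i hi
      rw [Finsupp.mem_support_iff] at hi ⊢
      intro h
      exact hi (abs_eq_zero.1 (le_antisymm ((hcd _ i).trans (by simp [h])) (abs_nonneg _)))
  by_cases h : ∀ n, c n k = 0
  · rw [linearCombination_apply_eq_zero h, abs_zero]
    exact abs_nonneg _
  · push Not at h
    obtain ⟨n, hn⟩ := h
    rw [hc.linearCombination_apply hn, hd.linearCombination_apply (mt (hc0 n) hn), abs_mul, abs_mul]
    exact mul_le_mul (hfg n) (hcd n k) (abs_nonneg _) (abs_nonneg _)

lemma DisjointSupports.finsuppAbs_linearCombination (hc : DisjointSupports c)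
    (h0 : ∀ n k, 0 ≤ c n k) (f : ℕ →₀ ℝ) :
    finsuppAbs (linearCombination ℝ c f) = linearCombination ℝ c (finsuppAbs f) := by
  ext k
  by_cases h : ∀ n, c n k = 0
  · simp [linearCombination_apply_eq_zero h]
  · push Not at h
    obtain ⟨n, hn⟩ := h
    rw [finsuppAbs_apply, hc.linearCombination_apply hn, hc.linearCombination_apply hn, abs_mul,
      finsuppAbs_apply, abs_of_nonneg (h0 n k)]

lemma exists_mem_support_of_mem_linearCombination {f : ℕ →₀ ℝ} {k : ι}
    (hk : k ∈ (linearCombination ℝ c f).support) : ∃ n ∈ f.support, k ∈ (c n).support := by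
  by_contra! h
  rw [Finsupp.mem_support_iff, linearCombination_finsupp_apply, Finsupp.sum] at hk
  exact hk (Finset.sum_eq_zero fun n hn => by rw [Finsupp.notMem_support_iff.1 (h n hn), mul_zero])

lemma DisjointSupports.linearCombination (hc : DisjointSupports c) {d : ℕ → ℕ →₀ ℝ}
    (hd : DisjointSupports d) : DisjointSupports fun n => linearCombination ℝ c (d n) := by
  intro m n hmn
  rw [Finset.disjoint_left]
  intro i hi hj
  obtain ⟨p, hp, hip⟩ := exists_mem_support_of_mem_linearCombination hi
  obtain ⟨q, hq, hjq⟩ := exists_mem_support_of_mem_linearCombination hj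
  have hpq : p ≠ q := fun h => Finset.disjoint_left.1 (hd m n hmn) hp (h ▸ hq)
  exact Finset.disjoint_left.1 (hc p q hpq) hip hjq

lemma DisjointSupports.comp (hc : DisjointSupports c) {φ : ℕ → ℕ} (hφ : Function.Injective φ) :
    DisjointSupports (c ∘ φ) :=
  fun _ _ hmn => hc _ _ (hφ.ne hmn)

lemma DisjointSupports.of_subset (hc : DisjointSupports c) {d : ℕ → ι →₀ ℝ}
    (h : ∀ n k, c n k = 0 → d n k = 0) : DisjointSupports d := by
  intro m n hmn
  refine Finset.disjoint_of_subset_left ?_ (Finset.disjoint_of_subset_right ?_ (hc m n hmn)) <;>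
  · intro i hi
    rw [Finsupp.mem_support_iff] at hi ⊢
    exact mt (h _ i) hi

/-- If arbitrarily far out on `ℕ` there are objects with a given property, there is a sequence of
such objects living on successive intervals `[N m, N (m + 1))`. The property may depend on the
index and on the left end of the interval. -/
lemma exists_seq_of_tails {α : Type*} (σ : α → Finset ℕ) (Φ : ℕ → ℕ → α → Prop)
    (h : ∀ m N, ∃ x, (∀ k ∈ σ x, N ≤ k) ∧ Φ m N x) :
    ∃ (f : ℕ → α) (N : ℕ → ℕ), Monotone N ∧ (∀ m, Φ m (N m) (f m)) ∧
      ∀ m, ∀ k ∈ σ (f m), N m ≤ k ∧ k < N (m + 1) := by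
  choose g hg using h
  let N : ℕ → ℕ := fun m => Nat.rec 0 (fun m s => max s ((σ (g m s)).sup id + 1)) m
  have hN : ∀ m, N (m + 1) = max (N m) ((σ (g m (N m))).sup id + 1) := fun m => rfl
  refine ⟨fun m => g m (N m), N, monotone_nat_of_le_succ fun m => ?_, fun m => (hg m (N m)).2,
    fun m k hk => ⟨(hg m (N m)).1 k hk, ?_⟩⟩
  · rw [hN]; exact le_max_left _ _
  · rw [hN]
    have : id k ≤ (σ (g m (N m))).sup id := Finset.le_sup hk
    exact lt_max_of_lt_right (Nat.lt_succ_of_le this)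

lemma exists_seq_successive {α : Type*} (σ : α → Finset ℕ) (Φ : ℕ → α → Prop)
    (h : ∀ m N, ∃ x, (∀ k ∈ σ x, N ≤ k) ∧ Φ m x) :
    ∃ f : ℕ → α, (∀ m, Φ m (f m)) ∧ ∀ m n, m < n → ∀ i ∈ σ (f m), ∀ j ∈ σ (f n), i < j := by
  obtain ⟨f, N, hN, hΦ, hσ⟩ := exists_seq_of_tails σ (fun m _ => Φ m) h
  exact ⟨f, hΦ, fun m n hmn i hi j hj =>
    (hσ m i hi).2.trans_le ((hN hmn).trans (hσ n j hj).1)⟩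

/-- The finitely supported sequence which is `a` on `s` and zero elsewhere. -/
noncomputable def blockCoeff (s : Finset ℕ) (a : ℕ → ℝ) : ℕ →₀ ℝ :=
  Finsupp.onFinset s (fun i => if i ∈ s then a i else 0) fun i hi => by
    by_contra h
    exact hi (if_neg h)

lemma blockCoeff_apply (s : Finset ℕ) (a : ℕ → ℝ) (i : ℕ) :
    blockCoeff s a i = if i ∈ s then a i else 0 := rfl

lemma support_blockCoeff (s : Finset ℕ) (a : ℕ → ℝ) : (blockCoeff s a).support ⊆ s :=
  Finsupp.support_onFinset_subset

variable {X : Type*} [NormedAddCommGroup X] [NormedSpace ℝ X]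

lemma comb_blockCoeff (s : Finset ℕ) (a : ℕ → ℝ) (x : ℕ → X) :
    comb (blockCoeff s a) x = ∑ k ∈ s, a k • x k := by
  rw [← sum_eq_comb (support_blockCoeff s a)]
  exact Finset.sum_congr rfl fun i hi => by rw [blockCoeff_apply, if_pos hi]

lemma isPositiveBlockSubseq_iff {x z : ℕ → X} :
    IsPositiveBlockSubseq x z ↔ ∃ c : ℕ → ℕ →₀ ℝ, (∀ n k, 0 ≤ c n k) ∧ SuccessiveSupports c ∧
      (∀ n, z n = comb (c n) x) ∧ ∀ n, z n ≠ 0 := by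
  constructor
  · rintro ⟨s, a, ha, h⟩
    refine ⟨fun n => blockCoeff (s n) a, fun n k => ?_, fun m n hmn i hi j hj => ?_, fun n => ?_,
      h.ne_zero⟩
    · rw [blockCoeff_apply]
      split_ifs
      exacts [ha k, le_rfl]
    · exact h.successive m n hmn i (support_blockCoeff _ _ hi) j (support_blockCoeff _ _ hj)
    · rw [comb_blockCoeff, h.eq_sum]
  · rintro ⟨c, hc0, hc, hz, hz0⟩
    refine ⟨fun n => (c n).support, fun k => ∑ᶠ n, c n k, fun k => finsum_nonneg fun n => hc0 n k,
      hc, fun n => ?_, hz0⟩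
    rw [hz, comb, Finsupp.sum]
    refine Finset.sum_congr rfl fun k hk => ?_
    rw [finsum_eq_single _ n]
    intro m hmn
    exact Finsupp.notMem_support_iff.1 (Finset.disjoint_right.1 (hc.disjoint m n hmn) hk)

lemma IsBasicSeq.block [CompleteSpace X] {x : ℕ → X} (hx : IsBasicSeq x) {c : ℕ → ℕ →₀ ℝ}
    (hc : SuccessiveSupports c) (h0 : ∀ n, comb (c n) x ≠ 0) :
    IsBasicSeq fun n => comb (c n) x := by
  obtain ⟨-, K, hK⟩ := isBasicSeq_iff.1 hx
  refine isBasicSeq_iff.2 ⟨h0, K, fun f n => ?_⟩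
  -- the first `n` blocks live on `[0, M)`, the others on `[M, ∞)`
  let M := (Finset.range n).sup fun i => (c i).support.sup fun k => k + 1
  have hM : ∀ i < n, ∀ k ∈ (c i).support, k < M := by
    intro i hi k hk
    have h1 : k + 1 ≤ (c i).support.sup fun k => k + 1 :=
      Finset.le_sup (f := fun k => k + 1) hk
    exact lt_of_lt_of_le (Nat.lt_succ_self k) (h1.trans
      (Finset.le_sup (f := fun i => (c i).support.sup fun k => k + 1) (Finset.mem_range.2 hi)))
  have hM' : ∀ i, n ≤ i → ∀ k ∈ (c i).support, M ≤ k := by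
    intro i hi k hk
    refine Finset.sup_le fun j hj => Finset.sup_le fun l hl => ?_
    exact hc j i ((Finset.mem_range.1 hj).trans_le hi) l hl k hk
  have key : ∑ i ∈ Finset.range n, f i • comb (c i) x =
      ∑ k ∈ Finset.range M, (linearCombination ℝ c f k) • x k := by
    rw [sum_smul_eq_comb_filter, sum_smul_eq_comb_filter, comb_comb]
    congr 1
    ext k
    rw [Finsupp.filter_apply]
    by_cases h : ∀ m, c m k = 0
    · rw [linearCombination_apply_eq_zero h, linearCombination_apply_eq_zero h, ite_self]
    · push Not at h
      obtain ⟨m, hm⟩ := h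
      rw [hc.disjoint.linearCombination_apply hm, hc.disjoint.linearCombination_apply hm,
        Finsupp.filter_apply]
      by_cases hmn : m < n
      · rw [if_pos (Finset.mem_range.2 hmn),
          if_pos (Finset.mem_range.2 (hM m hmn k (Finsupp.mem_support_iff.2 hm)))]
      · have := hM' m (not_lt.1 hmn) k (Finsupp.mem_support_iff.2 hm)
        rw [if_neg (by simpa using hmn), if_neg (by simpa using this), zero_mul]
  rw [key, comb_comb]
  exact hK _ _

/-- For positive blocks of a sequence satisfying the absolute-value domination, unconditionality is
the converse domination. -/
lemma AbsDominates.isUnconditionalSeq_iff [CompleteSpace X] {x y : ℕ → X} (hx : AbsDominates x)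
    (hy : IsPositiveBlockSubseq x y) :
    IsUnconditionalSeq y ↔ ∃ K : ℝ, 0 < K ∧ ∀ b, ‖absComb b y‖ ≤ K * ‖comb b y‖ := by
  obtain ⟨c, hc0, hc, hyc, hy0⟩ := isPositiveBlockSubseq_iff.1 hy
  obtain rfl : y = fun n => comb (c n) x := funext hyc
  constructor
  · intro h
    obtain ⟨-, K, hK0, hK⟩ := _root_.isUnconditionalSeq_iff.1 h
    refine ⟨K, hK0, fun b => ?_⟩
    rw [absComb_eq]
    exact hK _ _ fun i => by simp
  · rintro ⟨K, hK0, hK⟩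
    obtain ⟨C, hC0, hC⟩ := hx
    refine _root_.isUnconditionalSeq_iff.2 ⟨hy0, C * K, mul_pos hC0 hK0, fun a b hab => ?_⟩
    have h1 : ‖comb (linearCombination ℝ c b) x‖ ≤ C * ‖absComb (linearCombination ℝ c b) x‖ := hC _
    have h2 : finsuppAbs b = finsuppAbs a := Finsupp.ext hab
    rw [absComb_eq, hc.disjoint.finsuppAbs_linearCombination hc0, h2, ← comb_comb, ← comb_comb,
      ← absComb_eq] at h1
    rw [mul_assoc]
    exact h1.trans (mul_le_mul_of_nonneg_left (hK a) hC0.le)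

lemma comb_finsuppAbs_smul (t : ℝ) (b : ℕ →₀ ℝ) (y : ℕ → X) :
    absComb (t • b) y = |t| • absComb b y := by
  rw [absComb_eq, absComb_eq, ← comb_smul]
  congr 1
  ext i
  simp [abs_mul]

theorem noUnconditionalPositiveBlock_iff [CompleteSpace X] {x : ℕ → X} (hx : AbsDominates x) :
    NoUnconditionalPositiveBlock x ↔
      ∀ y : ℕ → X, IsPositiveBlockSubseq x y → ∀ ε : ℝ, 0 < ε →
        ∃ b : ℕ →₀ ℝ, ‖absComb b y‖ = 1 ∧ ‖comb b y‖ < ε := by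
  refine forall_congr' fun y => forall_congr' fun hy => ?_
  rw [hx.isUnconditionalSeq_iff hy]
  constructor
  · intro h ε hε
    by_contra! hcon
    refine h ⟨ε⁻¹, inv_pos.2 hε, fun b => ?_⟩
    rcases eq_or_lt_of_le (norm_nonneg (absComb b y)) with h0 | h0
    · rw [← h0]; positivity
    · have h1 := hcon (‖absComb b y‖⁻¹ • b) (by
        rw [comb_finsuppAbs_smul, norm_smul, abs_of_pos (inv_pos.2 h0), norm_inv, norm_norm,
          inv_mul_cancel₀ h0.ne'])
      rw [comb_smul, norm_smul, norm_inv, norm_norm, le_inv_mul_iff₀ h0] at h1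
      rw [le_inv_mul_iff₀ hε]
      linarith
  · rintro h ⟨K, hK0, hK⟩
    obtain ⟨b, hb1, hb⟩ := h K⁻¹ (inv_pos.2 hK0)
    have := hK b
    rw [hb1] at this
    have h2 := mul_lt_mul_of_pos_left hb hK0
    rw [mul_inv_cancel₀ hK0.ne'] at h2
    linarith

end Blocks

/-! ### Disjoint vectors in vector lattices -/

section VectorLattice

lemma inf_eq_zero_of_le {E : Type*} [Zero E] [Lattice E] {x y x' y' : E} (h : x ⊓ y = 0)
    (hx' : 0 ≤ x') (hy' : 0 ≤ y') (hx : x' ≤ x) (hy : y' ≤ y) : x' ⊓ y' = 0 :=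
  le_antisymm ((inf_le_inf hx hy).trans h.le) (le_inf hx' hy')

variable {E : Type*} [AddCommGroup E] [Lattice E] [IsOrderedAddMonoid E]

lemma inf_add_eq_zero {x y z : E} (hx : 0 ≤ x) (hy : 0 ≤ y) (hz : 0 ≤ z) (hxy : x ⊓ y = 0)
    (hxz : x ⊓ z = 0) : x ⊓ (y + z) = 0 := by
  refine le_antisymm ?_ (le_inf hx (add_nonneg hy hz))
  have h1 : x ⊓ (y + z) - y ≤ x ⊓ z := by
    refine le_inf ?_ ?_
    · rw [sub_le_iff_le_add]
      exact inf_le_left.trans (le_add_of_nonneg_right hy)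
    · rw [sub_le_iff_le_add, add_comm]
      exact inf_le_right
  rw [hxz, sub_nonpos] at h1
  rw [← hxy]
  exact le_inf inf_le_left h1

lemma abs_add_eq_of_disjoint {x y : E} (h : |x| ⊓ |y| = 0) : |x + y| = |x| + |y| := by
  refine le_antisymm (abs_add_le x y) ?_
  have key : ∀ {x y : E}, |x| ⊓ |y| = 0 → |x| ≤ |x + y| := by
    intro x y h
    have h1 : |x| ≤ |x + y| + |y| := by
      have := abs_add_le (x + y) (-y)
      rwa [add_neg_cancel_right, abs_neg] at this
    have h2 : |x| - |x + y| ≤ |x| ⊓ |y| := by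
      refine le_inf ?_ ?_
      · rw [sub_le_self_iff]; exact abs_nonneg _
      · rwa [sub_le_iff_le_add, add_comm]
    rwa [h, sub_nonpos] at h2
  rw [← inf_add_sup, h, zero_add]
  refine sup_le (key h) ?_
  rw [add_comm]
  exact key (by rwa [inf_comm])

variable [Module ℝ E] [IsOrderedModule ℝ E]

lemma abs_smul_lattice (r : ℝ) (x : E) : |r • x| = |r| • |x| := by
  have key : ∀ r : ℝ, 0 ≤ r → ∀ x : E, |r • x| ≤ r • |x| := by
    intro r hr x
    refine sup_le (smul_le_smul_of_nonneg_left (le_abs_self x) hr) ?_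
    rw [← smul_neg]
    exact smul_le_smul_of_nonneg_left (neg_le_abs x) hr
  have key2 : ∀ r : ℝ, 0 ≤ r → ∀ x : E, |r • x| = r • |x| := by
    intro r hr x
    refine le_antisymm (key r hr x) ?_
    rcases hr.eq_or_lt with rfl | h0
    · simp
    · have := smul_le_smul_of_nonneg_left (key r⁻¹ (inv_nonneg.2 hr) (r • x)) hr
      rwa [smul_smul, smul_smul, inv_mul_cancel₀ h0.ne', one_smul, mul_inv_cancel₀ h0.ne',
        one_smul] at this
  rcases le_total 0 r with h | h
  · rw [key2 r h, abs_of_nonneg h]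
  · rw [← abs_neg, ← neg_smul, key2 (-r) (by linarith), abs_of_nonpos h]

lemma smul_inf_smul_eq_zero {x y : E} (hx : 0 ≤ x) (hy : 0 ≤ y) (h : x ⊓ y = 0) {r s : ℝ}
    (hr : 0 ≤ r) (hs : 0 ≤ s) : (r • x) ⊓ (s • y) = 0 := by
  refine le_antisymm ?_ (le_inf (smul_nonneg hr hx) (smul_nonneg hs hy))
  have hM : 0 < r + s + 1 := by positivity
  have h1 : (r + s + 1)⁻¹ • ((r • x) ⊓ (s • y)) ≤ x ⊓ y := by
    refine le_inf ?_ ?_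
    · refine (smul_le_smul_of_nonneg_left inf_le_left (inv_nonneg.2 hM.le)).trans ?_
      refine (smul_le_smul_of_nonneg_left (smul_le_smul_of_nonneg_right
        (by linarith : r ≤ r + s + 1) hx) (inv_nonneg.2 hM.le)).trans ?_
      rw [smul_smul, inv_mul_cancel₀ hM.ne', one_smul]
    · refine (smul_le_smul_of_nonneg_left inf_le_right (inv_nonneg.2 hM.le)).trans ?_
      refine (smul_le_smul_of_nonneg_left (smul_le_smul_of_nonneg_right
        (by linarith : s ≤ r + s + 1) hy) (inv_nonneg.2 hM.le)).trans ?_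
      rw [smul_smul, inv_mul_cancel₀ hM.ne', one_smul]
  rw [h] at h1
  have h2 := smul_le_smul_of_nonneg_left h1 hM.le
  rwa [smul_smul, mul_inv_cancel₀ hM.ne', one_smul, smul_zero] at h2

lemma inf_sum_smul_eq_zero {y : E} (hy : 0 ≤ y) {e : ℕ → E} (he : ∀ n, 0 ≤ e n) {a : ℕ → ℝ}
    (ha : ∀ n, 0 ≤ a n) {s : Finset ℕ} (h : ∀ n ∈ s, y ⊓ e n = 0) :
    y ⊓ ∑ n ∈ s, a n • e n = 0 := by
  classical
  induction s using Finset.induction_on with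
  | empty => simpa using hy
  | insert i s hi ih =>
    rw [Finset.sum_insert hi]
    refine inf_add_eq_zero hy (smul_nonneg (ha i) (he i))
      (Finset.sum_nonneg fun n _ => smul_nonneg (ha n) (he n)) ?_
      (ih fun n hn => h n (Finset.mem_insert_of_mem hn))
    have := smul_inf_smul_eq_zero hy (he i) (h i (Finset.mem_insert_self i s)) zero_le_one (ha i)
    rwa [one_smul] at this

lemma abs_sum_smul_eq {e : ℕ → E} (he : ∀ m n, m ≠ n → |e m| ⊓ |e n| = 0) (a : ℕ → ℝ)
    (s : Finset ℕ) : |∑ n ∈ s, a n • e n| = ∑ n ∈ s, |a n| • |e n| := by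
  classical
  induction s using Finset.induction_on with
  | empty => simp
  | insert i s hi ih =>
    rw [Finset.sum_insert hi, Finset.sum_insert hi, abs_add_eq_of_disjoint, ih, abs_smul_lattice]
    rw [ih, abs_smul_lattice]
    refine inf_sum_smul_eq_zero (smul_nonneg (abs_nonneg _) (abs_nonneg _))
      (fun n => abs_nonneg _) (fun n => abs_nonneg _) fun n hn => ?_
    have := smul_inf_smul_eq_zero (abs_nonneg _) (abs_nonneg _)
      (he i n (fun h => hi (h ▸ hn))) (abs_nonneg (a i)) zero_le_one
    rwa [one_smul] at this

end VectorLattice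

section BanachLattice

variable {E : Type*} [NormedAddCommGroup E] [NormedSpace ℝ E] [Lattice E] [IsBanachLattice E]

lemma abs_comb {e : ℕ → E} (he : ∀ m n, m ≠ n → |e m| ⊓ |e n| = 0) (a : ℕ →₀ ℝ) :
    |comb a e| = comb (finsuppAbs a) (fun n => |e n|) := by
  have h : (finsuppAbs a).support ⊆ a.support := Finsupp.support_mapRange
  rw [comb, Finsupp.sum, abs_sum_smul_eq he, ← sum_eq_comb h]
  rfl

lemma comb_nonneg {e : ℕ → E} (he : ∀ n, 0 ≤ e n) {a : ℕ →₀ ℝ} (ha : ∀ n, 0 ≤ a n) :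
    0 ≤ comb a e :=
  Finset.sum_nonneg fun n _ => smul_nonneg (ha n) (he n)

lemma comb_mono {e g : ℕ → E} (he : ∀ n, 0 ≤ e n) (heg : ∀ n, e n ≤ g n) {a b : ℕ →₀ ℝ}
    (ha : ∀ n, 0 ≤ a n) (hab : ∀ n, a n ≤ b n) : comb a e ≤ comb b g := by
  rw [← sum_eq_comb (F := a.support ∪ b.support) Finset.subset_union_left,
    ← sum_eq_comb (F := a.support ∪ b.support) Finset.subset_union_right]
  refine Finset.sum_le_sum fun n _ => ?_
  exact (smul_le_smul_of_nonneg_left (heg n) (ha n)).trans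
    (smul_le_smul_of_nonneg_right (hab n) ((he n).trans (heg n)))

lemma norm_comb_le_of_abs_le {e g : ℕ → E} (hg : ∀ m n, m ≠ n → |g m| ⊓ |g n| = 0)
    (heg : ∀ n, |e n| ≤ |g n|) {a b : ℕ →₀ ℝ} (hab : ∀ n, |a n| ≤ |b n|) :
    ‖comb a e‖ ≤ ‖comb b g‖ := by
  have he : ∀ m n, m ≠ n → |e m| ⊓ |e n| = 0 := fun m n hmn =>
    inf_eq_zero_of_le (hg m n hmn) (abs_nonneg _) (abs_nonneg _) (heg m) (heg n)
  apply HasSolidNorm.solid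
  rw [abs_comb he, abs_comb hg]
  exact comb_mono (fun n => abs_nonneg _) heg (fun n => abs_nonneg _) hab

lemma norm_coeff_le {e : ℕ → E} (he : ∀ m n, m ≠ n → |e m| ⊓ |e n| = 0) (f : ℕ →₀ ℝ) (n : ℕ) :
    |f n| * ‖e n‖ ≤ ‖comb f e‖ := by
  have := norm_comb_le_of_abs_le he (fun n => le_rfl) (a := Finsupp.single n (f n)) (b := f) (by
    intro m
    by_cases h : n = m
    · subst h; simp
    · rw [Finsupp.single_eq_of_ne' h, abs_zero]; exact abs_nonneg _)
  rwa [comb_single, norm_smul] at this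

lemma disjoint_comb {e : ℕ → E} (he : ∀ m n, m ≠ n → |e m| ⊓ |e n| = 0) {c : ℕ → ℕ →₀ ℝ}
    (hc : DisjointSupports c) (m n : ℕ) (hmn : m ≠ n) :
    |comb (c m) e| ⊓ |comb (c n) e| = 0 := by
  rw [abs_comb he, abs_comb he, comb, comb, Finsupp.sum, Finsupp.sum]
  refine inf_sum_smul_eq_zero (Finset.sum_nonneg fun n _ => smul_nonneg (abs_nonneg _)
    (abs_nonneg _)) (fun n => abs_nonneg _) (fun n => abs_nonneg _) fun j hj => ?_
  rw [inf_comm]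
  refine inf_sum_smul_eq_zero (abs_nonneg _) (fun n => abs_nonneg _) (fun n => abs_nonneg _)
    fun i hi => he j i ?_
  rintro rfl
  exact Finset.disjoint_left.1 (hc m n hmn) (Finsupp.support_mapRange hi)
    (Finsupp.support_mapRange hj)

variable {X : Type*} [NormedAddCommGroup X] [NormedSpace ℝ X]

lemma isIsoOn_closedSpan {E : Type*} [NormedAddCommGroup E] [NormedSpace ℝ E] {T : E →L[ℝ] X}
    {u : ℕ → E} :
    IsIsoOn T (closedSpan u) ↔ ∃ c : ℝ, 0 < c ∧ ∀ f, c * ‖comb f u‖ ≤ ‖T (comb f u)‖ := by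
  refine exists_congr fun c => and_congr_right fun _ => ⟨fun h f => h _ ?_, fun h y hy => ?_⟩
  · exact Submodule.le_topologicalClosure _ (comb_mem_span f u)
  · have hcl : IsClosed {y : E | c * ‖y‖ ≤ ‖T y‖} := isClosed_le (by fun_prop) (by fun_prop)
    refine hcl.closure_subset_iff.2 ?_ hy
    intro z hz
    obtain ⟨f, rfl⟩ := mem_span_iff_comb.1 hz
    exact h f

lemma supClosed_infClosed_of_abs_mem {S : Submodule ℝ E} (h : ∀ x ∈ S, |x| ∈ S) :
    SupClosed (S : Set E) ∧ InfClosed (S : Set E) := by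
  constructor
  · intro x hx y hy
    rw [sup_eq_half_smul_add_add_abs_sub ℝ]
    exact S.smul_mem _ (S.add_mem (S.add_mem hx hy) (h _ (S.sub_mem hy hx)))
  · intro x hx y hy
    rw [inf_eq_half_smul_add_sub_abs_sub ℝ]
    exact S.smul_mem _ (S.sub_mem (S.add_mem hx hy) (h _ (S.sub_mem hy hx)))

/-- The closed span of a positive disjoint sequence is a sublattice. -/
lemma abs_mem_closedSpan {u : ℕ → E} (hu0 : ∀ n, 0 ≤ u n)
    (hu : ∀ m n, m ≠ n → |u m| ⊓ |u n| = 0) {x : E} (hx : x ∈ closedSpan u) :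
    |x| ∈ closedSpan u := by
  have hcont : Continuous fun x : E => |x| := continuous_id.sup continuous_neg
  have hcl : IsClosed {x : E | |x| ∈ closedSpan u} :=
    (Submodule.isClosed_topologicalClosure _).preimage hcont
  refine hcl.closure_subset_iff.2 ?_ hx
  intro z hz
  obtain ⟨f, rfl⟩ := mem_span_iff_comb.1 hz
  have h2 : (fun n => |u n|) = u := funext fun n => abs_of_nonneg (hu0 n)
  change |comb f u| ∈ closedSpan u
  rw [abs_comb hu, h2]
  exact Submodule.le_topologicalClosure _ (comb_mem_span _ _)

lemma not_finiteDimensional_closedSpan {u : ℕ → E} (hu0 : ∀ n, u n ≠ 0)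
    (hu : ∀ m n, m ≠ n → |u m| ⊓ |u n| = 0) : ¬ FiniteDimensional ℝ (closedSpan u) := by
  intro hfin
  have hmem : ∀ n, u n ∈ closedSpan u := fun n =>
    Submodule.le_topologicalClosure _ (Submodule.subset_span ⟨n, rfl⟩)
  have hli : LinearIndependent ℝ u := by
    rw [linearIndependent_iff]
    intro f hf
    ext n
    have := norm_coeff_le hu f n
    rw [comb_eq, hf, norm_zero] at this
    have h0 : 0 < ‖u n‖ := norm_pos_iff.2 (hu0 n)
    have h1 : |f n| ≤ 0 := by
      by_contra! h
      exact absurd (mul_pos h h0) (not_lt.2 this)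
    simpa using h1
  have hli' : LinearIndependent ℝ fun n => (⟨u n, hmem n⟩ : closedSpan u) :=
    LinearIndependent.of_comp (closedSpan u).subtype hli
  exact not_finite_iff_infinite.2 inferInstance hli'.finite

lemma IsLSS.not_isIso {T : E →L[ℝ] X} (hT : IsLSS T) {u : ℕ → E} (hu0 : ∀ n, 0 ≤ u n)
    (hu1 : ∀ n, u n ≠ 0) (hu : ∀ m n, m ≠ n → |u m| ⊓ |u n| = 0) :
    ¬ ∃ c : ℝ, 0 < c ∧ ∀ f, c * ‖comb f u‖ ≤ ‖T (comb f u)‖ := by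
  rw [← isIsoOn_closedSpan]
  obtain ⟨h1, h2⟩ := supClosed_infClosed_of_abs_mem (S := closedSpan u)
    fun x hx => abs_mem_closedSpan hu0 hu hx
  exact hT _ h1 h2 (Submodule.isClosed_topologicalClosure _)
    (not_finiteDimensional_closedSpan hu1 hu)

/-- In the span of the `N`-th tail of a positive disjoint sequence, an LSS operator almost
annihilates some normalized vector. -/
lemma IsLSS.exists_small {T : E →L[ℝ] X} (hT : IsLSS T) {u : ℕ → E} (hu0 : ∀ n, 0 ≤ u n)
    (hu1 : ∀ n, u n ≠ 0) (hu : ∀ m n, m ≠ n → |u m| ⊓ |u n| = 0) (N : ℕ) {ε : ℝ} (hε : 0 < ε) :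
    ∃ f : ℕ →₀ ℝ, (∀ k ∈ f.support, N ≤ k) ∧ ‖comb f u‖ = 1 ∧ ‖T (comb f u)‖ ≤ ε := by
  have h := hT.not_isIso (u := u ∘ (· + N)) (fun n => hu0 _) (fun n => hu1 _)
    (fun m n hmn => hu _ _ (by simpa using hmn))
  push Not at h
  obtain ⟨f, hf⟩ := h ε hε
  rw [comb_comp] at hf
  have h0 : 0 < ‖comb (f.mapDomain (· + N)) u‖ := by
    by_contra h0
    rw [le_antisymm (not_lt.1 h0) (norm_nonneg _), mul_zero] at hf
    exact absurd hf (not_lt.2 (norm_nonneg _))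
  refine ⟨‖comb (f.mapDomain (· + N)) u‖⁻¹ • f.mapDomain (· + N), fun k hk => ?_, ?_, ?_⟩
  · have := Finsupp.mapDomain_support (Finsupp.support_smul hk)
    obtain ⟨j, -, rfl⟩ := Finset.mem_image.1 this
    exact Nat.le_add_left N j
  · rw [comb_smul, norm_smul, norm_inv, norm_norm, inv_mul_cancel₀ h0.ne']
  · rw [comb_smul, map_smul, norm_smul, norm_inv, norm_norm, inv_mul_le_iff₀ h0, mul_comm]
    exact hf.le

/-! ### Disjoint sequences in infinite-dimensional sublattices -/

/-- A nonzero positive element of the sublattice `S` that does not dominate two disjoint nonzero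
positive elements of `S`. -/
structure IsSublatticeAtom (S : Submodule ℝ E) (x : E) : Prop where
  mem : x ∈ S
  nonneg : 0 ≤ x
  ne_zero : x ≠ 0
  eq_zero_or : ∀ u ∈ S, ∀ v ∈ S, 0 ≤ u → 0 ≤ v → u ≤ x → v ≤ x → u ⊓ v = 0 → u = 0 ∨ v = 0

/-- Subtracting from `y` the largest possible multiple of an atom leaves a vector disjoint from
this atom. -/
lemma IsSublatticeAtom.exists_sub {S : Submodule ℝ E} (hsup : SupClosed (S : Set E))
    (hinf : InfClosed (S : Set E)) {x y : E} (hx : IsSublatticeAtom S x) (hyS : y ∈ S)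
    (hy : 0 ≤ y) : ∃ t : ℝ, 0 ≤ t ∧ 0 ≤ y - t • x ∧ (y - t • x) ⊓ x = 0 := by
  let A : Set ℝ := {t | 0 ≤ t ∧ t • x ≤ y}
  have hx0 : 0 < ‖x‖ := norm_pos_iff.2 hx.ne_zero
  have hAcl : IsClosed A := by
    have h1 : IsClosed {t : ℝ | 0 ≤ t} := isClosed_Ici
    have h2 : IsClosed {t : ℝ | t • x ≤ y} := isClosed_le (by fun_prop) (by fun_prop)
    exact h1.inter h2
  have hAne : A.Nonempty := ⟨0, le_rfl, by simpa using hy⟩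
  have hAbd : BddAbove A := by
    refine ⟨‖y‖ / ‖x‖, fun t ht => ?_⟩
    rw [le_div_iff₀ hx0]
    have h : ‖t • x‖ ≤ ‖y‖ := by
      apply HasSolidNorm.solid
      rw [abs_of_nonneg (smul_nonneg ht.1 hx.nonneg), abs_of_nonneg hy]
      exact ht.2
    rwa [norm_smul, Real.norm_of_nonneg ht.1] at h
  obtain ⟨ht0, ht⟩ := hAcl.csSup_mem hAne hAbd
  set t := sSup A
  have hy' : 0 ≤ y - t • x := sub_nonneg.2 ht
  have hmax : ∀ ε : ℝ, 0 < ε → ¬ ε • x ≤ y - t • x := by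
    intro ε hε h
    have : t + ε ∈ A := ⟨by positivity, by rw [add_smul, add_comm]; exact le_sub_iff_add_le.1 h⟩
    linarith [le_csSup hAbd this]
  refine ⟨t, ht0, hy', ?_⟩
  have hxS := hx.mem
  have hy'S : y - t • x ∈ S := S.sub_mem hyS (S.smul_mem _ hxS)
  set z := (y - t • x) ⊓ x with hz
  have hzS : z ∈ S := hinf hy'S hxS
  have hz0 : 0 ≤ z := le_inf hy' hx.nonneg
  -- for small `ε` the negative part of `z - ε x` cannot vanish, so the positive part does
  have hsmall : ∀ ε : ℝ, 0 < ε → ε ≤ 1 → z ≤ ε • x := by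
    intro ε hε hε1
    have hwS : z - ε • x ∈ S := S.sub_mem hzS (S.smul_mem _ hxS)
    have hεx : 0 ≤ ε • x := smul_nonneg hε.le hx.nonneg
    have hp : (z - ε • x)⁺ ≤ x := sup_le ((sub_le_self _ hεx).trans inf_le_right) hx.nonneg
    have hn : (z - ε • x)⁻ ≤ x := by
      refine sup_le ?_ hx.nonneg
      rw [neg_sub]
      refine (sub_le_self _ hz0).trans ?_
      have := smul_le_smul_of_nonneg_right hε1 hx.nonneg
      rwa [one_smul] at this
    rcases hx.eq_zero_or ((z - ε • x)⁺) (hsup hwS S.zero_mem) ((z - ε • x)⁻)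
      (hsup (S.neg_mem hwS) S.zero_mem) (posPart_nonneg _) (negPart_nonneg _) hp hn
      (posPart_inf_negPart_eq_zero _) with h | h
    · exact sub_nonpos.1 (posPart_eq_zero.1 h)
    · exact absurd ((sub_nonneg.1 (negPart_eq_zero.1 h)).trans inf_le_left) (hmax ε hε)
  refine le_antisymm ?_ hz0
  have hlim : Filter.Tendsto (fun n : ℕ => (1 / ((n : ℝ) + 1)) • x) Filter.atTop (nhds 0) := by
    have := (tendsto_one_div_add_atTop_nhds_zero_nat (𝕜 := ℝ)).smul_const x
    rwa [zero_smul] at this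
  refine ge_of_tendsto' hlim fun n => hsmall _ (by positivity) ?_
  rw [div_le_one (by positivity)]
  linarith [(Nat.cast_nonneg n : (0 : ℝ) ≤ n)]

/-- A sublattice without atoms below `x` contains a disjoint sequence, obtained by splitting. -/
lemma exists_disjoint_seq_or_atom {E : Type*} [NormedAddCommGroup E] [NormedSpace ℝ E] [Lattice E]
    {S : Submodule ℝ E} {x : E} (hxS : x ∈ S) (hx : 0 ≤ x)
    (hx0 : x ≠ 0) :
    (∃ u : ℕ → E, (∀ n, u n ∈ S ∧ 0 ≤ u n ∧ u n ≠ 0) ∧ ∀ m n, m < n → u m ⊓ u n = 0) ∨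
      ∃ a, IsSublatticeAtom S a ∧ a ≤ x := by
  by_contra! h
  obtain ⟨hseq, hat⟩ := h
  let B := {y : E // y ∈ S ∧ 0 ≤ y ∧ y ≠ 0 ∧ y ≤ x}
  have hsplit : ∀ y : B, ∃ p : B × B, p.1.1 ≤ y.1 ∧ p.2.1 ≤ y.1 ∧ p.1.1 ⊓ p.2.1 = 0 := by
    rintro ⟨y, hyS, hy0, hy1, hyx⟩
    have : ¬ ∀ u ∈ S, ∀ v ∈ S, 0 ≤ u → 0 ≤ v → u ≤ y → v ≤ y → u ⊓ v = 0 → u = 0 ∨ v = 0 :=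
      fun h => hat y ⟨hyS, hy0, hy1, h⟩ hyx
    push Not at this
    obtain ⟨u, hu, v, hv, hu0, hv0, huy, hvy, huv, hu1, hv1⟩ := this
    exact ⟨(⟨u, hu, hu0, hu1, huy.trans hyx⟩, ⟨v, hv, hv0, hv1, hvy.trans hyx⟩), huy, hvy, huv⟩
  choose p hp1 hp2 hp3 using hsplit
  let y : ℕ → B := fun n => Nat.rec ⟨x, hxS, hx, hx0, le_rfl⟩ (fun _ b => (p b).1) n
  have hy : ∀ n, y (n + 1) = (p (y n)).1 := fun n => rfl
  have hanti : Antitone fun n => (y n).1 := antitone_nat_of_succ_le fun n => by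
    rw [hy]; exact hp1 _
  obtain ⟨m, n, hmn, h⟩ := hseq (fun n => (p (y n)).2.1)
    (fun n => ⟨(p (y n)).2.2.1, (p (y n)).2.2.2.1, (p (y n)).2.2.2.2.1⟩)
  refine h (inf_eq_zero_of_le (by rw [inf_comm]; exact hp3 (y m)) (p (y m)).2.2.2.1
    (p (y n)).2.2.2.1 le_rfl ?_)
  have := hanti (Nat.succ_le_of_lt hmn)
  simp only [Nat.succ_eq_add_one, hy] at this
  exact (hp2 _).trans this

lemma exists_disjoint_seq {S : Submodule ℝ E} (hsup : SupClosed (S : Set E))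
    (hinf : InfClosed (S : Set E)) (hS : ¬ FiniteDimensional ℝ S) :
    ∃ u : ℕ → E, (∀ n, u n ∈ S ∧ 0 ≤ u n ∧ u n ≠ 0) ∧ ∀ m n, m < n → u m ⊓ u n = 0 := by
  classical
  by_contra hno
  have hatom : ∀ x ∈ S, 0 ≤ x → x ≠ 0 → ∃ a, IsSublatticeAtom S a ∧ a ≤ x := fun x hxS hx hx0 =>
    (exists_disjoint_seq_or_atom hxS hx hx0).resolve_left hno
  -- subtract from `y` its components along finitely many disjoint atoms
  have hproj : ∀ s : Finset E, (∀ a ∈ s, IsSublatticeAtom S a) → ∀ y ∈ S, 0 ≤ y →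
      ∃ y' ∈ S, 0 ≤ y' ∧ y - y' ∈ Submodule.span ℝ (s : Set E) ∧ ∀ a ∈ s, a ⊓ y' = 0 := by
    intro s
    induction s using Finset.induction_on with
    | empty => exact fun _ y hyS hy => ⟨y, hyS, hy, by simp, by simp⟩
    | insert a s ha ih =>
      intro hs y hyS hy
      obtain ⟨y', hy'S, hy', hspan, hdisj⟩ :=
        ih (fun b hb => hs b (Finset.mem_insert_of_mem hb)) y hyS hy
      have haa := hs a (Finset.mem_insert_self a s)
      obtain ⟨t, ht, hpos, hinf0⟩ := haa.exists_sub hsup hinf hy'S hy'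
      refine ⟨y' - t • a, S.sub_mem hy'S (S.smul_mem _ haa.mem), hpos, ?_, fun b hb => ?_⟩
      · rw [← sub_add]
        refine Submodule.add_mem _ (Submodule.span_mono ?_ hspan)
          (Submodule.smul_mem _ _ (Submodule.subset_span ?_)) <;> simp
      · rcases Finset.mem_insert.1 hb with rfl | hb
        · rwa [inf_comm]
        · exact inf_eq_zero_of_le (hdisj b hb) (hs b (Finset.mem_insert_of_mem hb)).nonneg hpos
            le_rfl (sub_le_self _ (smul_nonneg ht haa.nonneg))
  obtain ⟨f, hf, hdisj⟩ := exists_seq_of_forall_finset_exists (IsSublatticeAtom S)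
    (fun a b => a ⊓ b = 0) (by
      intro s hs
      have hnle : ¬ S ≤ Submodule.span ℝ (s : Set E) := fun hle =>
        hS (Submodule.finiteDimensional_of_le hle)
      obtain ⟨y, hyS, hy⟩ := SetLike.not_le_iff_exists.1 hnle
      obtain ⟨w, hwS, hw0, hw⟩ : ∃ w ∈ S, 0 ≤ w ∧ w ∉ Submodule.span ℝ (s : Set E) := by
        by_contra! h
        refine hy ?_
        rw [← posPart_sub_negPart y]
        exact Submodule.sub_mem _ (h _ (hsup hyS S.zero_mem) (posPart_nonneg y))
          (h _ (hsup (S.neg_mem hyS) S.zero_mem) (negPart_nonneg y))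
      obtain ⟨w', hw'S, hw'0, hspan, hw'⟩ := hproj s hs w hwS hw0
      obtain ⟨a, ha, haw⟩ := hatom w' hw'S hw'0 (by
        rintro rfl
        exact hw (by simpa using hspan))
      exact ⟨a, ha, fun b hb => inf_eq_zero_of_le (hw' b hb) (hs b hb).nonneg ha.nonneg le_rfl haw⟩)
  exact hno ⟨f, fun n => ⟨(hf n).mem, (hf n).nonneg, (hf n).ne_zero⟩, hdisj⟩

/-- An operator which is not LSS is an isomorphism on the span of a normalized positive disjoint
sequence. -/
lemma exists_disjoint_seq_of_not_isLSS {T : E →L[ℝ] X} (hT : ¬ IsLSS T) :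
    ∃ u : ℕ → E, (∀ n, 0 ≤ u n) ∧ (∀ n, ‖u n‖ = 1) ∧ (∀ m n, m ≠ n → |u m| ⊓ |u n| = 0) ∧
      ∃ c : ℝ, 0 < c ∧ ∀ f, c * ‖comb f u‖ ≤ ‖T (comb f u)‖ := by
  simp only [IsLSS] at hT
  push Not at hT
  obtain ⟨S, hsup, hinf, -, hfin, c, hc, hcS⟩ := hT
  obtain ⟨u, hu, hdisj⟩ := exists_disjoint_seq hsup hinf hfin
  have hpos : ∀ n, 0 < ‖u n‖ := fun n => norm_pos_iff.2 (hu n).2.2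
  have hdisj' : ∀ m n, m ≠ n → u m ⊓ u n = 0 := fun m n hmn => by
    rcases lt_or_gt_of_ne hmn with h | h
    · exact hdisj m n h
    · rw [inf_comm]; exact hdisj n m h
  have h0 : ∀ n, 0 ≤ ‖u n‖⁻¹ • u n := fun n =>
    smul_nonneg (inv_nonneg.2 (norm_nonneg _)) (hu n).2.1
  refine ⟨fun n => ‖u n‖⁻¹ • u n, h0, fun n => ?_, fun m n hmn => ?_, c, hc, fun f => hcS _ ?_⟩
  · rw [norm_smul, norm_inv, norm_norm, inv_mul_cancel₀ (hpos n).ne']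
  · rw [abs_of_nonneg (h0 m), abs_of_nonneg (h0 n)]
    exact smul_inf_smul_eq_zero (hu m).2.1 (hu n).2.1 (hdisj' m n hmn)
      (inv_nonneg.2 (norm_nonneg _)) (inv_nonneg.2 (norm_nonneg _))
  · exact Submodule.sum_mem _ fun n _ => S.smul_mem _ (S.smul_mem _ (hu n).1)

/-- If a sum of two LSS operators is not LSS, then the second one is not DSS: on suitable signed
blocks the first summand is negligible. -/
theorem IsLSS.not_isDSS_of_add {T₁ T₂ : E →L[ℝ] X} (h₁ : IsLSS T₁) (h : ¬ IsLSS (T₁ + T₂)) :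
    ¬ IsDSS T₂ := by
  obtain ⟨u, hu0, hu1, hu, c, hc, hcu⟩ := exists_disjoint_seq_of_not_isLSS h
  have hne : ∀ n, u n ≠ 0 := fun n hn => by simpa [hn] using hu1 n
  obtain ⟨d, hd, hsucc⟩ := exists_seq_successive (fun f : ℕ →₀ ℝ => f.support)
    (fun m f => ‖comb f u‖ = 1 ∧ ‖T₁ (comb f u)‖ ≤ c / 2 * (1 / 2) ^ (m + 1))
    (fun m N => h₁.exists_small hu0 hne hu N (by positivity))
  have hds : DisjointSupports d := SuccessiveSupports.disjoint hsucc
  have hg := disjoint_comb hu hds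
  intro hDSS
  refine hDSS (fun n => comb (d n) u) (fun n hn => ?_) hg ?_
  · simpa [hn] using (hd n).1
  · refine isIsoOn_closedSpan.2 ⟨c / 2, by positivity, fun f => ?_⟩
    have h1 : ‖T₁ (comb f fun n => comb (d n) u)‖ ≤ c / 2 * ‖comb f fun n => comb (d n) u‖ := by
      refine norm_map_le_of_small (L := T₁.toLinearMap ∘ₗ
        Finsupp.linearCombination ℝ fun n => comb (d n) u) (by positivity) (norm_nonneg _)
        (fun n => ?_) fun n => ?_
      · simpa using (hd n).2
      · have := norm_coeff_le hg f n
        rwa [(hd n).1, mul_one] at this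
    have h2 : c * ‖comb f fun n => comb (d n) u‖ ≤ ‖(T₁ + T₂) (comb f fun n => comb (d n) u)‖ := by
      rw [comb_comb]; exact hcu _
    have h3 := norm_add_le (T₁ (comb f fun n => comb (d n) u)) (T₂ (comb f fun n => comb (d n) u))
    rw [← add_apply] at h3
    linarith

end BanachLattice

/-! ### Sequence lattices given by families of weights -/

section SequenceLattice

open Filter Topology
open scoped ENNReal NNReal

/-- A family of weights on an index set `ι`, bounded and not identically zero at each index. It
gives the lattice norm `‖a‖ = sup_j ∑ᵢ |aᵢ| wⱼᵢ`. -/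
structure WeightFamily (κ : Type*) (ι : Type*) where
  /-- the weights -/
  w : κ → ι → ℝ≥0
  bdd : ∀ i, ∃ B : ℝ≥0, ∀ j, w j i ≤ B
  pos : ∀ i, ∃ j, 0 < w j i

namespace WeightFamily

variable {κ ι : Type*} (W : WeightFamily κ ι)

/-- The extended lattice norm `sup_j ∑ᵢ |aᵢ| wⱼᵢ` of a family of scalars. -/
noncomputable def eNorm (a : ι → ℝ) : ℝ≥0∞ := ⨆ j, ∑' i, ‖a i‖ₑ * (W.w j i : ℝ≥0∞)

lemma eNorm_mono {a b : ι → ℝ} (h : ∀ i, |a i| ≤ |b i|) : W.eNorm a ≤ W.eNorm b := by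
  refine iSup_mono fun j => ENNReal.tsum_le_tsum fun i => ?_
  gcongr
  exact enorm_le_iff_norm_le.2 (h i)

lemma eNorm_zero : W.eNorm 0 = 0 := by simp [eNorm]

lemma eNorm_add_le (a b : ι → ℝ) : W.eNorm (a + b) ≤ W.eNorm a + W.eNorm b := by
  refine iSup_le fun j => ?_
  calc ∑' i, ‖(a + b) i‖ₑ * (W.w j i : ℝ≥0∞)
      ≤ ∑' i, (‖a i‖ₑ * (W.w j i : ℝ≥0∞) + ‖b i‖ₑ * (W.w j i : ℝ≥0∞)) := by
        refine ENNReal.tsum_le_tsum fun i => ?_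
        rw [← add_mul]
        gcongr
        exact enorm_add_le _ _
    _ = ∑' i, ‖a i‖ₑ * (W.w j i : ℝ≥0∞) + ∑' i, ‖b i‖ₑ * (W.w j i : ℝ≥0∞) := ENNReal.tsum_add
    _ ≤ _ := add_le_add (le_iSup (fun j => ∑' i, ‖a i‖ₑ * (W.w j i : ℝ≥0∞)) j)
        (le_iSup (fun j => ∑' i, ‖b i‖ₑ * (W.w j i : ℝ≥0∞)) j)

lemma eNorm_smul (t : ℝ) (a : ι → ℝ) : W.eNorm (t • a) = ‖t‖ₑ * W.eNorm a := by
  rw [eNorm, eNorm, ENNReal.mul_iSup]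
  refine iSup_congr fun j => ?_
  rw [← ENNReal.tsum_mul_left]
  refine tsum_congr fun i => ?_
  rw [Pi.smul_apply, smul_eq_mul, enorm_mul, mul_assoc]

lemma exists_enorm_apply_le (i : ι) : ∃ C : ℝ≥0, ∀ a, ‖a i‖ₑ ≤ C * W.eNorm a := by
  obtain ⟨j, hj⟩ := W.pos i
  refine ⟨(W.w j i)⁻¹, fun a => ?_⟩
  have h : ‖a i‖ₑ * (W.w j i : ℝ≥0∞) ≤ W.eNorm a :=
    (ENNReal.le_tsum (f := fun i => ‖a i‖ₑ * (W.w j i : ℝ≥0∞)) i).trans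
      (le_iSup (fun j => ∑' i, ‖a i‖ₑ * (W.w j i : ℝ≥0∞)) j)
  rw [ENNReal.coe_inv hj.ne', mul_comm, ← div_eq_mul_inv,
    ENNReal.le_div_iff_mul_le (Or.inl (by simpa using hj.ne')) (Or.inl (by simp))]
  exact h

lemma eNorm_eq_iSup_sum (F : Finset ι) {a : ι → ℝ} (ha : ∀ i ∉ F, a i = 0) :
    W.eNorm a = ⨆ j, ∑ i ∈ F, ‖a i‖ₑ * (W.w j i : ℝ≥0∞) := by
  refine iSup_congr fun j => tsum_eq_sum fun i hi => ?_
  rw [ha i hi, enorm_zero, zero_mul]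

lemma eNorm_ne_top_of_finite (F : Finset ι) {a : ι → ℝ} (ha : ∀ i ∉ F, a i = 0) :
    W.eNorm a ≠ ⊤ := by
  choose B hB using W.bdd
  have h : W.eNorm a ≤ ∑ i ∈ F, ‖a i‖ₑ * (B i : ℝ≥0∞) := by
    rw [W.eNorm_eq_iSup_sum F ha]
    refine iSup_le fun j => Finset.sum_le_sum fun i _ => ?_
    gcongr
    exact hB i j
  refine ne_top_of_le_ne_top ?_ h
  exact ENNReal.sum_ne_top.2 fun i _ => ENNReal.mul_ne_top (by simp) (by simp)

/-- Lower semicontinuity of the norm for pointwise convergence (Fatou property). -/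
lemma eNorm_le_of_tendsto {a : ℕ → ι → ℝ} {b : ι → ℝ} {C : ℝ≥0∞}
    (h : ∀ i, Tendsto (fun n => a n i) atTop (𝓝 (b i))) (hC : ∀ᶠ n in atTop, W.eNorm (a n) ≤ C) :
    W.eNorm b ≤ C := by
  refine iSup_le fun j => ?_
  rw [ENNReal.tsum_eq_iSup_sum]
  refine iSup_le fun F => ?_
  have ht : Tendsto (fun n => ∑ i ∈ F, ‖a n i‖ₑ * (W.w j i : ℝ≥0∞)) atTop
      (𝓝 (∑ i ∈ F, ‖b i‖ₑ * (W.w j i : ℝ≥0∞))) := by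
    refine tendsto_finsetSum F fun i _ => ?_
    refine ENNReal.Tendsto.mul_const ?_ (Or.inr ENNReal.coe_ne_top)
    exact (continuous_enorm.tendsto _).comp (h i)
  refine le_of_tendsto ht (hC.mono fun n hn => ?_)
  refine le_trans ?_ hn
  exact (ENNReal.sum_le_tsum F).trans (le_iSup (fun j => ∑' i, ‖a n i‖ₑ * (W.w j i : ℝ≥0∞)) j)

lemma eNorm_indicator_mono {s : Set ι} {a b : ι → ℝ} (h : ∀ i, |a i| ≤ |b i|) :
    W.eNorm (s.indicator a) ≤ W.eNorm (s.indicator b) := by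
  refine W.eNorm_mono fun i => ?_
  by_cases hi : i ∈ s
  · simpa [hi] using h i
  · simp [hi]

lemma eNorm_indicator_le (s : Set ι) (a : ι → ℝ) : W.eNorm (s.indicator a) ≤ W.eNorm a := by
  refine W.eNorm_mono fun i => ?_
  by_cases hi : i ∈ s
  · simp [hi]
  · simp [hi]

/-- The families of scalars whose restrictions to complements of finite sets have arbitrarily small
norm: the closure of the finitely supported families. -/
def space : Submodule ℝ (ι → ℝ) where
  carrier := {a | ∀ ε : ℝ≥0∞, 0 < ε → ∃ F : Finset ι, W.eNorm ((F : Set ι)ᶜ.indicator a) ≤ ε}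
  zero_mem' := fun ε _ => ⟨∅, by simp [eNorm_zero]⟩
  add_mem' := by
    classical
    intro a b ha hb ε hε
    obtain ⟨F, hF⟩ := ha (ε / 2) (ENNReal.half_pos hε.ne')
    obtain ⟨G, hG⟩ := hb (ε / 2) (ENNReal.half_pos hε.ne')
    refine ⟨F ∪ G, ?_⟩
    rw [Set.indicator_add']
    refine (W.eNorm_add_le _ _).trans ?_
    rw [← ENNReal.add_halves ε]
    refine add_le_add (le_trans (W.eNorm_mono fun i => ?_) hF)
      (le_trans (W.eNorm_mono fun i => ?_) hG)
    · by_cases hi : i ∈ F <;> by_cases hj : i ∈ G <;> simp [hi, hj]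
    · by_cases hi : i ∈ F <;> by_cases hj : i ∈ G <;> simp [hi, hj]
  smul_mem' := by
    intro t a ha ε hε
    rcases eq_or_ne t 0 with rfl | ht
    · exact ⟨∅, by simp [eNorm_zero]⟩
    · have ht' : ‖t‖ₑ ≠ 0 := by simpa using ht
      obtain ⟨F, hF⟩ := ha (ε / ‖t‖ₑ) (ENNReal.div_pos hε.ne' (by simp))
      refine ⟨F, ?_⟩
      rw [show (F : Set ι)ᶜ.indicator (t • a) = t • (F : Set ι)ᶜ.indicator a by
        ext i; by_cases hi : i ∈ F <;> simp [hi], eNorm_smul]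
      calc ‖t‖ₑ * W.eNorm ((F : Set ι)ᶜ.indicator a) ≤ ‖t‖ₑ * (ε / ‖t‖ₑ) := by gcongr
        _ = ε := ENNReal.mul_div_cancel ht' (by simp)

lemma mem_space_of_abs_le {a b : ι → ℝ} (hb : b ∈ W.space) (h : ∀ i, |a i| ≤ |b i|) :
    a ∈ W.space := fun ε hε =>
  (hb ε hε).imp fun _ hF => (W.eNorm_indicator_mono h).trans hF

lemma abs_mem_space {a : ι → ℝ} (ha : a ∈ W.space) : |a| ∈ W.space :=
  W.mem_space_of_abs_le ha fun i => by simp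

lemma sup_mem_space {a b : ι → ℝ} (ha : a ∈ W.space) (hb : b ∈ W.space) : a ⊔ b ∈ W.space := by
  refine W.mem_space_of_abs_le (W.space.add_mem (W.abs_mem_space ha) (W.abs_mem_space hb))
    fun i => ?_
  simp only [Pi.sup_apply, Pi.add_apply, Pi.abs_apply]
  rw [abs_of_nonneg (add_nonneg (abs_nonneg (a i)) (abs_nonneg (b i)))]
  exact abs_max_le_max_abs_abs.trans (max_le_add_of_nonneg (abs_nonneg _) (abs_nonneg _))

lemma inf_mem_space {a b : ι → ℝ} (ha : a ∈ W.space) (hb : b ∈ W.space) : a ⊓ b ∈ W.space := by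
  have : a ⊓ b = -(-a ⊔ -b) := by rw [neg_sup, neg_neg, neg_neg]
  rw [this]
  exact W.space.neg_mem (W.sup_mem_space (W.space.neg_mem ha) (W.space.neg_mem hb))

lemma eNorm_ne_top {a : ι → ℝ} (ha : a ∈ W.space) : W.eNorm a ≠ ⊤ := by
  obtain ⟨F, hF⟩ := ha 1 one_pos
  have h : a = (F : Set ι).indicator a + (F : Set ι)ᶜ.indicator a :=
    (Set.indicator_self_add_compl _ _).symm
  rw [h]
  refine ne_top_of_le_ne_top ?_ (W.eNorm_add_le _ _)
  refine ENNReal.add_ne_top.2 ⟨W.eNorm_ne_top_of_finite F fun i hi => ?_, ?_⟩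
  · simp [hi]
  · exact ne_top_of_le_ne_top ENNReal.one_ne_top hF

lemma finite_mem_space (F : Finset ι) {a : ι → ℝ} (ha : ∀ i ∉ F, a i = 0) : a ∈ W.space := by
  intro ε _
  refine ⟨F, ?_⟩
  have : (F : Set ι)ᶜ.indicator a = 0 := by
    ext i
    by_cases hi : i ∈ F
    · simp [hi]
    · simp [hi, ha i hi]
  rw [this, eNorm_zero]
  exact zero_le

/-- The Banach lattice of a weight family. It is a type synonym of `W.space`, to keep the norm
topology apart from the topology of pointwise convergence. -/
def SeqLattice : Type _ := {a : ι → ℝ // a ∈ W.space}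

namespace SeqLattice

variable {W}

/-- The scalars of an element of the sequence lattice. -/
def coeff (a : W.SeqLattice) : ι → ℝ := Subtype.val (p := fun a : ι → ℝ => a ∈ W.space) a

lemma coeff_mem (a : W.SeqLattice) : a.coeff ∈ W.space :=
  Subtype.property (p := fun a : ι → ℝ => a ∈ W.space) a

/-- The element of the sequence lattice with given scalars. -/
def mk (a : ι → ℝ) (ha : a ∈ W.space) : W.SeqLattice :=
  Subtype.mk (p := fun a : ι → ℝ => a ∈ W.space) a ha

@[simp] lemma coeff_mk (a : ι → ℝ) (ha : a ∈ W.space) : (mk a ha).coeff = a := rfl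

lemma ext {a b : W.SeqLattice} (h : ∀ i, a.coeff i = b.coeff i) : a = b :=
  Subtype.ext (funext h)

instance : AddCommGroup W.SeqLattice := inferInstanceAs (AddCommGroup W.space)
instance : Module ℝ W.SeqLattice := inferInstanceAs (Module ℝ W.space)
instance : Lattice W.SeqLattice :=
  Subtype.lattice (fun _ _ => W.sup_mem_space) (fun _ _ => W.inf_mem_space)

lemma coeff_zero : (0 : W.SeqLattice).coeff = 0 := rfl
lemma coeff_add (a b : W.SeqLattice) : (a + b).coeff = a.coeff + b.coeff := rfl
lemma coeff_sub (a b : W.SeqLattice) : (a - b).coeff = a.coeff - b.coeff := rfl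
lemma coeff_smul (t : ℝ) (a : W.SeqLattice) : (t • a).coeff = t • a.coeff := rfl
lemma coeff_abs (a : W.SeqLattice) : |a|.coeff = |a.coeff| := rfl
lemma coeff_inf (a b : W.SeqLattice) : (a ⊓ b).coeff = a.coeff ⊓ b.coeff := rfl
lemma le_def {a b : W.SeqLattice} : a ≤ b ↔ ∀ i, a.coeff i ≤ b.coeff i := Iff.rfl

noncomputable instance : Norm W.SeqLattice := ⟨fun a => (W.eNorm a.coeff).toReal⟩

lemma ofReal_norm (a : W.SeqLattice) : ENNReal.ofReal ‖a‖ = W.eNorm a.coeff :=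
  ENNReal.ofReal_toReal (W.eNorm_ne_top a.coeff_mem)

lemma norm_le_iff {a : W.SeqLattice} {r : ℝ} (hr : 0 ≤ r) :
    ‖a‖ ≤ r ↔ W.eNorm a.coeff ≤ ENNReal.ofReal r := by
  rw [← ofReal_norm, ENNReal.ofReal_le_ofReal_iff hr]

lemma core : NormedSpace.Core ℝ W.SeqLattice where
  norm_nonneg _ := ENNReal.toReal_nonneg
  norm_smul t a := by
    change (W.eNorm (t • a.coeff)).toReal = ‖t‖ * (W.eNorm a.coeff).toReal
    rw [eNorm_smul, ENNReal.toReal_mul, toReal_enorm]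
  norm_triangle a b := by
    change (W.eNorm (a.coeff + b.coeff)).toReal ≤
      (W.eNorm a.coeff).toReal + (W.eNorm b.coeff).toReal
    rw [← ENNReal.toReal_add (W.eNorm_ne_top a.coeff_mem) (W.eNorm_ne_top b.coeff_mem)]
    exact ENNReal.toReal_mono
      (ENNReal.add_ne_top.2 ⟨W.eNorm_ne_top a.coeff_mem, W.eNorm_ne_top b.coeff_mem⟩)
      (W.eNorm_add_le _ _)
  norm_eq_zero_iff a := by
    constructor
    · intro h
      have h0 : W.eNorm a.coeff = 0 := by
        rw [← ofReal_norm, h, ENNReal.ofReal_zero]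
      refine ext fun i => ?_
      obtain ⟨C, hC⟩ := W.exists_enorm_apply_le i
      have := hC a.coeff
      rw [h0, mul_zero] at this
      simpa [coeff_zero] using this
    · rintro rfl
      change (W.eNorm 0).toReal = 0
      rw [eNorm_zero, ENNReal.toReal_zero]

noncomputable instance : NormedAddCommGroup W.SeqLattice := NormedAddCommGroup.ofCore core
noncomputable instance : NormedSpace ℝ W.SeqLattice := NormedSpace.ofCore core

lemma exists_abs_apply_le (i : ι) : ∃ C : ℝ, ∀ a : W.SeqLattice, |a.coeff i| ≤ C * ‖a‖ := by
  obtain ⟨C, hC⟩ := W.exists_enorm_apply_le i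
  refine ⟨C, fun a => ?_⟩
  have := ENNReal.toReal_mono (ENNReal.mul_ne_top ENNReal.coe_ne_top (W.eNorm_ne_top a.coeff_mem))
    (hC a.coeff)
  rwa [toReal_enorm, ENNReal.toReal_mul, ENNReal.coe_toReal, Real.norm_eq_abs] at this

instance : HasSolidNorm W.SeqLattice where
  solid _ b h := ENNReal.toReal_mono (W.eNorm_ne_top b.coeff_mem) (W.eNorm_mono fun i => h i)

instance : IsOrderedAddMonoid W.SeqLattice where
  add_le_add_left _ _ h c := fun i => add_le_add_left (h i) (c.coeff i)

instance : IsOrderedModule ℝ W.SeqLattice where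
  smul_le_smul_of_nonneg_left _ ht _ _ h := fun i => mul_le_mul_of_nonneg_left (h i) ht
  smul_le_smul_of_nonneg_right _ ha _ _ h := fun i => mul_le_mul_of_nonneg_right h (ha i)

instance : CompleteSpace W.SeqLattice := by
  refine Metric.complete_of_cauchySeq_tendsto fun u hu => ?_
  have hlim : ∀ i, ∃ b : ℝ, Tendsto (fun n => (u n).coeff i) atTop (𝓝 b) := by
    intro i
    obtain ⟨C, hC⟩ := exists_abs_apply_le (W := W) i
    let L : W.SeqLattice →L[ℝ] ℝ :=
      LinearMap.mkContinuous ⟨⟨fun a => a.coeff i, fun _ _ => rfl⟩, fun _ _ => rfl⟩ C hC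
    exact cauchySeq_tendsto_of_complete (L.uniformContinuous.comp_cauchySeq hu)
  choose b hb using hlim
  have hclose : ∀ ε : ℝ, 0 < ε → ∃ n₀, ∀ n ≥ n₀, W.eNorm ((u n).coeff - b) ≤ ENNReal.ofReal ε := by
    intro ε hε
    obtain ⟨n₀, hn₀⟩ := Metric.cauchySeq_iff.1 hu ε hε
    refine ⟨n₀, fun n hn => ?_⟩
    refine W.eNorm_le_of_tendsto (a := fun m => (u n).coeff - (u m).coeff)
      (fun i => (hb i).const_sub ((u n).coeff i)) ?_
    filter_upwards [eventually_ge_atTop n₀] with m hm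
    have := hn₀ n hn m hm
    rw [dist_eq_norm] at this
    exact (norm_le_iff (a := u n - u m) hε.le).1 this.le
  have hbmem : b ∈ W.space := by
    intro ε hε
    obtain ⟨δ, hδ, hδε⟩ : ∃ δ : ℝ, 0 < δ ∧ ENNReal.ofReal δ ≤ ε / 2 := by
      rcases eq_or_ne ε ⊤ with rfl | h
      · exact ⟨1, one_pos, by simp [ENNReal.top_div]⟩
      · have h2 : ε / 2 ≠ ⊤ := ENNReal.div_ne_top h (by simp)
        exact ⟨(ε / 2).toReal, ENNReal.toReal_pos (ENNReal.half_pos hε.ne').ne' h2,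
          (ENNReal.ofReal_toReal h2).le⟩
    obtain ⟨n, hn⟩ := hclose δ hδ
    obtain ⟨F, hF⟩ := (u n).coeff_mem (ε / 2) (ENNReal.half_pos hε.ne')
    refine ⟨F, ?_⟩
    have hsplit : (F : Set ι)ᶜ.indicator b =
        (F : Set ι)ᶜ.indicator (u n).coeff +
          (-1 : ℝ) • (F : Set ι)ᶜ.indicator ((u n).coeff - b) := by
      ext i
      by_cases hi : i ∈ F <;> simp [hi]
    rw [hsplit, ← ENNReal.add_halves ε]
    refine (W.eNorm_add_le _ _).trans (add_le_add hF ?_)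
    rw [eNorm_smul]
    simp only [enorm_neg, enorm_one, one_mul]
    exact (W.eNorm_indicator_le _ _).trans ((hn n le_rfl).trans hδε)
  refine ⟨mk b hbmem, ?_⟩
  rw [Metric.tendsto_atTop]
  intro ε hε
  obtain ⟨n₀, hn₀⟩ := hclose (ε / 2) (by positivity)
  refine ⟨n₀, fun n hn => ?_⟩
  rw [dist_eq_norm]
  have : ‖u n - mk b hbmem‖ ≤ ε / 2 := (norm_le_iff (by positivity)).2 (hn₀ n hn)
  linarith

instance : IsBanachLattice W.SeqLattice where

/-- A finitely supported family as an element of the sequence lattice. -/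
def ofFinite (F : Finset ι) (a : ι → ℝ) (ha : ∀ i ∉ F, a i = 0) : W.SeqLattice :=
  mk a (W.finite_mem_space F ha)

/-- The restriction of an element to a finite set of indices. -/
noncomputable def restrict (F : Finset ι) (a : W.SeqLattice) : W.SeqLattice :=
  ofFinite F ((F : Set ι).indicator a.coeff) fun i hi => by simp [hi]

lemma exists_norm_sub_restrict_le (a : W.SeqLattice) {ε : ℝ} (hε : 0 < ε) :
    ∃ F : Finset ι, ‖a - restrict F a‖ ≤ ε := by
  obtain ⟨F, hF⟩ := a.coeff_mem (ENNReal.ofReal ε) (ENNReal.ofReal_pos.2 hε)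
  refine ⟨F, (norm_le_iff hε.le).2 (le_trans (le_of_eq ?_) hF)⟩
  congr 1
  ext i
  rw [coeff_sub, restrict, ofFinite, coeff_mk, Pi.sub_apply]
  by_cases hi : i ∈ F <;> simp [hi]

variable {X : Type*} [NormedAddCommGroup X] [NormedSpace ℝ X] [CompleteSpace X]

lemma summable_smul {x : ι → X} {B : ℝ≥0}
    (h : ∀ (F : Finset ι) (a : ι → ℝ), ‖∑ i ∈ F, a i • x i‖ₑ ≤ B * W.eNorm a)
    (a : W.SeqLattice) : Summable fun i => a.coeff i • x i := by
  rw [summable_iff_vanishing_norm]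
  intro ε hε
  obtain ⟨F, hF⟩ := a.coeff_mem (ENNReal.ofReal (ε / (2 * (B + 1))))
    (ENNReal.ofReal_pos.2 (by positivity))
  refine ⟨F, fun t ht => ?_⟩
  have h1 : ∑ i ∈ t, a.coeff i • x i = ∑ i ∈ t, (F : Set ι)ᶜ.indicator a.coeff i • x i := by
    refine Finset.sum_congr rfl fun i hi => ?_
    have : i ∉ F := Finset.disjoint_left.1 ht hi
    simp [this]
  have h2 := (h t ((F : Set ι)ᶜ.indicator a.coeff)).trans (mul_le_mul_right hF (B : ℝ≥0∞))
  rw [← h1, ← ENNReal.ofReal_coe_nnreal, ← ENNReal.ofReal_mul B.coe_nonneg, ← _root_.ofReal_norm,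
    ENNReal.ofReal_le_ofReal_iff (by positivity)] at h2
  have h3 : (B : ℝ) * (ε / (2 * (B + 1))) < ε := by
    rw [mul_div_assoc', div_lt_iff₀ (by positivity)]
    nlinarith [B.coe_nonneg, mul_nonneg B.coe_nonneg hε.le]
  exact h2.trans_lt h3

/-- The operator `a ↦ ∑ᵢ aᵢ xᵢ` on the sequence lattice. -/
noncomputable def sumOp (x : ι → X) (B : ℝ≥0)
    (h : ∀ (F : Finset ι) (a : ι → ℝ), ‖∑ i ∈ F, a i • x i‖ₑ ≤ B * W.eNorm a) :
    W.SeqLattice →L[ℝ] X :=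
  LinearMap.mkContinuous
    { toFun := fun a => ∑' i, a.coeff i • x i
      map_add' := fun a b => by
        rw [← (summable_smul h a).tsum_add (summable_smul h b)]
        exact tsum_congr fun i => by rw [coeff_add, Pi.add_apply, add_smul]
      map_smul' := fun t a => by
        rw [RingHom.id_apply, ← (summable_smul h a).tsum_const_smul]
        exact tsum_congr fun i => by
          rw [coeff_smul, Pi.smul_apply, smul_eq_mul, mul_smul] } B fun a => by
    refine le_of_tendsto (summable_smul h a).hasSum.norm (Eventually.of_forall fun F => ?_)
    have := h F a.coeff
    rwa [← ofReal_norm, ← ENNReal.ofReal_coe_nnreal, ← ENNReal.ofReal_mul B.coe_nonneg,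
      ← _root_.ofReal_norm, ENNReal.ofReal_le_ofReal_iff (by positivity)] at this

lemma sumOp_apply {x : ι → X} {B : ℝ≥0}
    (h : ∀ (F : Finset ι) (a : ι → ℝ), ‖∑ i ∈ F, a i • x i‖ₑ ≤ B * W.eNorm a)
    (a : W.SeqLattice) : sumOp x B h a = ∑' i, a.coeff i • x i := rfl

lemma sumOp_apply_of_finite {x : ι → X} {B : ℝ≥0}
    (h : ∀ (F : Finset ι) (a : ι → ℝ), ‖∑ i ∈ F, a i • x i‖ₑ ≤ B * W.eNorm a)
    {F : Finset ι} {a : W.SeqLattice} (ha : ∀ i ∉ F, a.coeff i = 0) :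
    sumOp x B h a = ∑ i ∈ F, a.coeff i • x i := by
  rw [sumOp_apply]
  exact tsum_eq_sum fun i hi => by rw [ha i hi, zero_smul]

end SeqLattice

end WeightFamily

end SequenceLattice

/-! ### The sequence lattice of a sequence of vectors -/

section DualWeights

open Filter Topology
open scoped ENNReal NNReal

variable {X : Type u} [NormedAddCommGroup X] [NormedSpace ℝ X]

/-- The weights `i ↦ |φ(xᵢ)|`, for `φ` in the dual unit ball. The resulting norm of a finitely
supported `a` is the largest norm of `∑ᵢ ± aᵢ xᵢ`. The index set `ℕ` is lifted to an arbitrary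
universe, so that the sequence lattice lives there too. -/
noncomputable def dualWeights (x : ℕ → X) (hx : ∀ n, x n ≠ 0) :
    WeightFamily {φ : StrongDual ℝ X // ‖φ‖ ≤ 1} (ULift.{v} ℕ) where
  w φ i := ‖φ.1 (x i.down)‖₊
  bdd i := ⟨‖x i.down‖₊, fun φ => by
    have := φ.1.le_of_opNorm_le φ.2 (x i.down)
    rw [one_mul] at this
    exact this⟩
  pos i := by
    obtain ⟨φ, hφ, h⟩ := exists_dual_vector'' ℝ (x i.down)
    refine ⟨⟨φ, hφ⟩, ?_⟩
    rw [nnnorm_pos]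
    intro h0
    rw [h0] at h
    exact hx i.down (norm_eq_zero.1 (by simpa using h.symm))

variable {x : ℕ → X} {hx : ∀ n, x n ≠ 0}

lemma enorm_sum_le_dualWeights (F : Finset (ULift.{v} ℕ)) (a : ULift.{v} ℕ → ℝ) :
    ‖∑ i ∈ F, a i • x i.down‖ₑ ≤ (dualWeights.{u, v} x hx).eNorm a := by
  obtain ⟨φ, hφ, h⟩ := exists_dual_vector'' ℝ (∑ i ∈ F, a i • x i.down)
  have h1 : ‖∑ i ∈ F, a i • x i.down‖ₑ = ‖φ (∑ i ∈ F, a i • x i.down)‖ₑ := by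
    rw [h, ← ofReal_norm, ← ofReal_norm]
    simp
  rw [h1, map_sum]
  refine (enorm_sum_le _ _).trans ?_
  refine le_trans ?_ (le_iSup (fun j => ∑' i, ‖a i‖ₑ * ((dualWeights x hx).w j i : ℝ≥0∞)) ⟨φ, hφ⟩)
  refine le_trans (Finset.sum_le_sum fun i _ => ?_) (ENNReal.sum_le_tsum F)
  rw [map_smul, smul_eq_mul, enorm_mul]
  rfl

/-- The lattice norm of a finitely supported family is attained by signed combinations. -/
lemma dualWeights_norm_le {f : ℕ →₀ ℝ} {M : ℝ}
    (hM : ∀ g : ℕ →₀ ℝ, (∀ i, |g i| = |f i|) → ‖comb g x‖ ≤ M) :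
    (dualWeights.{u, v} x hx).eNorm (fun i => f i.down) ≤ ENNReal.ofReal M := by
  classical
  have hinj : Function.Injective (ULift.up : ℕ → ULift.{v} ℕ) := ULift.up_injective
  rw [WeightFamily.eNorm_eq_iSup_sum _ (f.support.map ⟨_, hinj⟩) (fun i hi => by
    by_contra h
    exact hi (Finset.mem_map.2 ⟨i.down, Finsupp.mem_support_iff.2 h, rfl⟩))]
  refine iSup_le fun φ => ?_
  rw [Finset.sum_map]
  -- choose the signs so that all terms `gᵢ φ(xᵢ)` are nonnegative
  let g : ℕ →₀ ℝ := Finsupp.onFinset f.support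
    (fun i => if 0 ≤ f i * φ.1 (x i) then f i else -f i) (by
      intro i hi
      by_contra h
      rw [Finsupp.notMem_support_iff] at h
      simp [h] at hi)
  have hgi : ∀ i, g i = if 0 ≤ f i * φ.1 (x i) then f i else -f i := fun i => rfl
  have hg : ∀ i, |g i| = |f i| := fun i => by
    rw [hgi]
    split_ifs
    · rfl
    · rw [abs_neg]
  have hterm : ∀ i, g i * φ.1 (x i) = |f i| * |φ.1 (x i)| := fun i => by
    rw [hgi, ← abs_mul]
    split_ifs with h
    · rw [abs_of_nonneg h]
    · rw [abs_of_neg (not_le.1 h), neg_mul]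
  have h1 : φ.1 (comb g x) = ∑ i ∈ f.support, |f i| * |φ.1 (x i)| := by
    rw [← sum_eq_comb (F := f.support) Finsupp.support_onFinset_subset, map_sum]
    exact Finset.sum_congr rfl fun i _ => by rw [map_smul, smul_eq_mul, hterm]
  have h2 : ∑ i ∈ f.support, |f i| * |φ.1 (x i)| ≤ M := by
    rw [← h1]
    have h3 := φ.1.le_of_opNorm_le φ.2 (comb g x)
    rw [one_mul] at h3
    exact (le_abs_self _).trans (h3.trans (hM g hg))
  refine le_trans (le_of_eq ?_) (ENNReal.ofReal_le_ofReal h2)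
  rw [ENNReal.ofReal_sum_of_nonneg fun i _ => by positivity]
  refine Finset.sum_congr rfl fun i _ => ?_
  rw [ENNReal.ofReal_mul (abs_nonneg _), ← Real.norm_eq_abs, ← Real.norm_eq_abs, ofReal_norm,
    ofReal_norm]
  rfl

end DualWeights

section UnitVectors

open scoped ENNReal NNReal

namespace WeightFamily.SeqLattice

variable {κ : Type u} {W : WeightFamily κ (ULift.{v} ℕ)}

/-- The element of the sequence lattice with the given finitely supported scalars. -/
noncomputable def ofFinsupp (f : ℕ →₀ ℝ) : W.SeqLattice :=
  ofFinite (f.support.map ⟨ULift.up, ULift.up_injective⟩) (fun i => f i.down) fun i hi => by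
    by_contra h
    exact hi (Finset.mem_map.2 ⟨i.down, Finsupp.mem_support_iff.2 h, rfl⟩)

@[simp] lemma coeff_ofFinsupp (f : ℕ →₀ ℝ) (i : ULift.{v} ℕ) :
    (ofFinsupp f : W.SeqLattice).coeff i = f i.down := rfl

lemma coeff_comb (f : ℕ →₀ ℝ) (u : ℕ → W.SeqLattice) (i : ULift.{v} ℕ) :
    (comb f u).coeff i = f.sum fun n t => t * (u n).coeff i := by
  let L : W.SeqLattice →ₗ[ℝ] ℝ := ⟨⟨fun a => a.coeff i, fun _ _ => rfl⟩, fun _ _ => rfl⟩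
  change L (comb f u) = _
  simp only [comb, Finsupp.sum, map_sum, map_smul, smul_eq_mul]
  rfl

lemma comb_ofFinsupp (f : ℕ →₀ ℝ) (c : ℕ → ℕ →₀ ℝ) :
    comb f (fun n => (ofFinsupp (c n) : W.SeqLattice)) =
      ofFinsupp (Finsupp.linearCombination ℝ c f) := by
  refine ext fun i => ?_
  rw [coeff_comb, coeff_ofFinsupp, linearCombination_finsupp_apply]
  rfl

lemma disjoint_ofFinsupp {c : ℕ → ℕ →₀ ℝ} (hc : DisjointSupports c) (m n : ℕ) (hmn : m ≠ n) :
    |(ofFinsupp (c m) : W.SeqLattice)| ⊓ |ofFinsupp (c n)| = 0 := by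
  refine ext fun i => ?_
  rw [coeff_inf, coeff_abs, coeff_abs, coeff_zero]
  simp only [Pi.inf_apply, Pi.abs_apply, coeff_ofFinsupp, Pi.zero_apply]
  by_cases h : c m i.down = 0
  · rw [h, abs_zero]; exact inf_eq_left.2 (abs_nonneg _)
  · rw [Finsupp.notMem_support_iff.1
      (Finset.disjoint_left.1 (hc m n hmn) (Finsupp.mem_support_iff.2 h)), abs_zero]
    exact inf_eq_right.2 (abs_nonneg _)

lemma ofFinsupp_ne_zero {f : ℕ →₀ ℝ} (hf : f ≠ 0) : (ofFinsupp f : W.SeqLattice) ≠ 0 := by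
  intro h
  refine hf (Finsupp.ext fun n => ?_)
  have := congrArg (fun a => a.coeff (ULift.up n)) h
  simpa [coeff_zero] using this

variable {X : Type*} [NormedAddCommGroup X] [NormedSpace ℝ X] [CompleteSpace X]

lemma sumOp_ofFinsupp {x : ℕ → X} {B : ℝ≥0}
    (h : ∀ (F : Finset (ULift.{v} ℕ)) (a : ULift.{v} ℕ → ℝ),
      ‖∑ i ∈ F, a i • x i.down‖ₑ ≤ B * W.eNorm a) (f : ℕ →₀ ℝ) :
    sumOp (fun i => x i.down) B h (ofFinsupp f) = comb f x := by
  rw [sumOp_apply_of_finite h (F := f.support.map ⟨ULift.up, ULift.up_injective⟩)]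
  · rw [Finset.sum_map]
    rfl
  · intro i hi
    by_contra h
    exact hi (Finset.mem_map.2 ⟨i.down, Finsupp.mem_support_iff.2 h, rfl⟩)

/-- Gliding hump: an operator on a sequence lattice which is not LSS sends some positive block
sequence of the unit vectors to an unconditional sequence. -/
theorem exists_unconditional_of_not_isLSS {T : W.SeqLattice →L[ℝ] X} (hT : ¬ IsLSS T) {x : ℕ → X}
    (hTx : ∀ f, T (ofFinsupp f) = comb f x) :
    ∃ z, IsPositiveBlockSubseq x z ∧ IsUnconditionalSeq z := by
  classical
  obtain ⟨u, hu0, hu1, hu, c, hc, hcu⟩ := exists_disjoint_seq_of_not_isLSS hT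
  have hcoord0 : ∀ n i, 0 ≤ (u n).coeff i := fun n i => hu0 n i
  have hcoord : ∀ m n, m ≠ n → ∀ i, (u m).coeff i = 0 ∨ (u n).coeff i = 0 := by
    intro m n hmn i
    have h := congrArg (fun a => a.coeff i) (hu m n hmn)
    simp only [coeff_inf, coeff_abs, Pi.inf_apply, Pi.abs_apply, coeff_zero, Pi.zero_apply] at h
    rcases min_choice |(u m).coeff i| |(u n).coeff i| with h' | h'
    · left; exact abs_eq_zero.1 (h'.symm.trans h)
    · right; exact abs_eq_zero.1 (h'.symm.trans h)
  -- by disjointness only finitely many `u n` charge a given finite set of indices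
  have hfar : ∀ N : ℕ, ∃ n, N ≤ n ∧ ∀ i < N, (u n).coeff (ULift.up i) = 0 := by
    intro N
    have hfin : {n | ∃ i ∈ Set.Iio N, (u n).coeff (ULift.up i) ≠ 0}.Finite := by
      have : {n | ∃ i ∈ Set.Iio N, (u n).coeff (ULift.up i) ≠ 0} =
          ⋃ i ∈ Set.Iio N, {n | (u n).coeff (ULift.up i) ≠ 0} := by
        ext n; simp
      rw [this]
      refine (Set.finite_Iio N).biUnion fun i _ => Set.Subsingleton.finite ?_
      intro m hm n hn
      by_contra hmn
      exact (hcoord m n hmn (ULift.up i)).elim hm hn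
    obtain ⟨n, hn, hNn⟩ := (Filter.eventually_atTop.2 ⟨N, fun n hn => hn⟩ :
      ∀ᶠ n in Filter.atTop, N ≤ n).and
        (Nat.cofinite_eq_atTop ▸ hfin.compl_mem_cofinite : _ ∈ Filter.atTop) |>.exists
    refine ⟨n, hn, fun i hi => ?_⟩
    by_contra h
    exact hNn ⟨i, hi, h⟩
  set η : ℝ := c / (2 * (‖T‖ + 1)) with hη
  have hη0 : 0 < η := by positivity
  -- truncations of the `u n`, on successive sets
  obtain ⟨p, hp, hsucc⟩ := exists_seq_successive
    (fun p : ℕ × (ℕ →₀ ℝ) => insert p.1 p.2.support)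
    (fun m p => (∀ k, 0 ≤ p.2 k) ∧ (∀ k, p.2 k ≤ (u p.1).coeff (ULift.up k)) ∧
      ‖u p.1 - ofFinsupp p.2‖ ≤ η * (1 / 2) ^ (m + 1)) (by
    intro m N
    obtain ⟨n, hNn, hn⟩ := hfar N
    obtain ⟨F, hF⟩ := exists_norm_sub_restrict_le (u n)
      (show (0 : ℝ) < η * (1 / 2) ^ (m + 1) by positivity)
    let G : Finset ℕ := F.map ⟨ULift.down, ULift.down_injective⟩
    let g : ℕ →₀ ℝ := blockCoeff G fun k => (u n).coeff (ULift.up k)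
    have hmemG : ∀ i : ULift.{v} ℕ, i.down ∈ G ↔ i ∈ F := by
      rintro ⟨k⟩
      simp only [G, Finset.mem_map, Function.Embedding.coeFn_mk]
      constructor
      · rintro ⟨j, hj, rfl⟩; exact hj
      · exact fun h => ⟨_, h, rfl⟩
    refine ⟨(n, g), fun k hk => ?_, fun k => ?_, fun k => ?_, ?_⟩
    · rcases Finset.mem_insert.1 hk with rfl | hk
      · exact hNn
      · by_contra hkN
        rw [Finsupp.mem_support_iff] at hk
        simp only [g, blockCoeff_apply, hn k (not_le.1 hkN), ite_self, ne_eq,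
          not_true_eq_false] at hk
    · simp only [g, blockCoeff_apply]
      split_ifs
      exacts [hcoord0 _ _, le_rfl]
    · simp only [g, blockCoeff_apply]
      split_ifs
      exacts [le_rfl, hcoord0 _ _]
    · have : (ofFinsupp g : W.SeqLattice) = restrict F (u n) := by
        refine ext fun i => ?_
        rw [coeff_ofFinsupp, restrict, ofFinite, coeff_mk, blockCoeff_apply]
        simp only [hmemG, Set.indicator_apply, Finset.mem_coe]
      simpa only [this] using hF)
  have hpinj : Function.Injective fun m => (p m).1 := by
    refine StrictMono.injective fun m n hmn => ?_
    exact hsucc m n hmn _ (Finset.mem_insert_self _ _) _ (Finset.mem_insert_self _ _)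
  let d : ℕ → ℕ →₀ ℝ := fun m => (p m).2
  have hd : SuccessiveSupports d := fun m n hmn i hi j hj =>
    hsucc m n hmn i (Finset.mem_insert_of_mem hi) j (Finset.mem_insert_of_mem hj)
  let w : ℕ → W.SeqLattice := fun m => u (p m).1
  have hw : ∀ m n, m ≠ n → |w m| ⊓ |w n| = 0 := fun m n hmn => hu _ _ (hpinj.ne hmn)
  let e : ℕ → W.SeqLattice := fun m => ofFinsupp (d m)
  have hew : ∀ n, |e n| ≤ |w n| := fun n => by
    rw [le_def]
    intro i
    rw [coeff_abs, coeff_abs, Pi.abs_apply, Pi.abs_apply]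
    change |d n i.down| ≤ |(w n).coeff i|
    rw [abs_of_nonneg ((hp n).1 _), abs_of_nonneg (hcoord0 _ _)]
    exact (hp n).2.1 _
  have hTe : ∀ f, comb f (fun m => comb (d m) x) = T (comb f e) := by
    intro f
    rw [comb_ofFinsupp, hTx, comb_comb]
  -- the image of the truncated sequence still dominates the original one
  have hlower : ∀ f, c / 2 * ‖comb f w‖ ≤ ‖comb f fun m => comb (d m) x‖ := by
    intro f
    have h1 : c * ‖comb f w‖ ≤ ‖T (comb f w)‖ := by
      have := hcu (f.mapDomain fun m => (p m).1)
      rwa [← comb_comp] at this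
    have h2 : ‖comb f fun n => w n - e n‖ ≤ η * ‖comb f w‖ := by
      refine norm_map_le_of_small (L := Finsupp.linearCombination ℝ fun n => w n - e n) hη0.le
        (norm_nonneg _) (fun n => ?_) fun n => ?_
      · simpa using (hp n).2.2
      · have := norm_coeff_le hw f n
        rwa [hu1, mul_one] at this
    have h3 : ‖T (comb f w) - T (comb f e)‖ ≤ c / 2 * ‖comb f w‖ := by
      rw [← map_sub, ← comb_sub_right]
      refine (T.le_opNorm _).trans ?_
      have h4 : ‖T‖ * η ≤ c / 2 := by
        rw [hη, mul_div_assoc', div_le_iff₀ (by positivity)]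
        nlinarith [norm_nonneg T]
      calc ‖T‖ * ‖comb f fun n => w n - e n‖ ≤ ‖T‖ * (η * ‖comb f w‖) := by gcongr
        _ = (‖T‖ * η) * ‖comb f w‖ := by ring
        _ ≤ _ := by gcongr
    rw [hTe]
    have h5 := norm_sub_norm_le (T (comb f w)) (T (comb f e))
    linarith
  have hne : ∀ n, comb (d n) x ≠ 0 := by
    intro n hn
    have := hlower (Finsupp.single n 1)
    rw [comb_single, comb_single, hn, smul_zero, norm_zero, one_smul, hu1, mul_one] at this
    linarith
  refine ⟨fun m => comb (d m) x, isPositiveBlockSubseq_iff.2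
    ⟨d, fun n => (hp n).1, hd, fun n => rfl, hne⟩, ?_⟩
  refine isUnconditionalSeq_iff.2 ⟨hne, (‖T‖ + 1) * (2 / c), by positivity, fun a b hab => ?_⟩
  have h1 : ‖comb b e‖ ≤ ‖comb a w‖ :=
    norm_comb_le_of_abs_le hw hew fun n => (hab n).le
  calc ‖comb b fun m => comb (d m) x‖ = ‖T (comb b e)‖ := by rw [hTe]
    _ ≤ ‖T‖ * ‖comb b e‖ := T.le_opNorm _
    _ ≤ (‖T‖ + 1) * ‖comb a w‖ := by gcongr; linarith
    _ ≤ (‖T‖ + 1) * ((2 / c) * ‖comb a fun m => comb (d m) x‖) := by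
        gcongr
        have := hlower a
        rw [div_mul_eq_mul_div, le_div_iff₀ hc]
        linarith
    _ = _ := by ring

end WeightFamily.SeqLattice

end UnitVectors

/-! ### From pairs of basic sequences to operators on Banach lattices -/

section Operators

open WeightFamily SeqLattice
open scoped ENNReal NNReal

variable {X : Type u} [NormedAddCommGroup X] [NormedSpace ℝ X]

lemma interleave_two_mul {X : Type*} (x y : ℕ → X) (n : ℕ) : interleave x y (2 * n) = x n := by
  simp [interleave]

lemma interleave_two_mul_add_one {X : Type*} (x y : ℕ → X) (n : ℕ) :
    interleave x y (2 * n + 1) = y n := by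
  have h1 : (2 * n + 1) % 2 = 1 := by omega
  have h2 : (2 * n + 1) / 2 = n := by omega
  simp [interleave, h1, h2]

lemma injective_two_mul : Function.Injective fun n : ℕ => 2 * n := fun m n h => by
  simpa using h

lemma injective_two_mul_add_one : Function.Injective fun n : ℕ => 2 * n + 1 := fun m n h => by
  simpa using h

/-- The coefficients of even index. -/
noncomputable def evenPart (A : ℕ →₀ ℝ) : ℕ →₀ ℝ :=
  A.comapDomain (fun n => 2 * n) injective_two_mul.injOn

/-- The coefficients of odd index. -/
noncomputable def oddPart (A : ℕ →₀ ℝ) : ℕ →₀ ℝ :=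
  A.comapDomain (fun n => 2 * n + 1) injective_two_mul_add_one.injOn

@[simp] lemma evenPart_apply (A : ℕ →₀ ℝ) (n : ℕ) : evenPart A n = A (2 * n) := rfl
@[simp] lemma oddPart_apply (A : ℕ →₀ ℝ) (n : ℕ) : oddPart A n = A (2 * n + 1) := rfl

lemma mapDomain_evenPart_add (A : ℕ →₀ ℝ) :
    (evenPart A).mapDomain (fun n => 2 * n) + (oddPart A).mapDomain (fun n => 2 * n + 1) = A := by
  ext k
  rw [Finsupp.add_apply]
  rcases Nat.even_or_odd' k with ⟨n, rfl | rfl⟩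
  · rw [Finsupp.mapDomain_apply injective_two_mul, Finsupp.mapDomain_of_notMem_range, add_zero]
    · rfl
    · rintro ⟨m, hm⟩
      simp only at hm
      omega
  · rw [Finsupp.mapDomain_apply injective_two_mul_add_one, Finsupp.mapDomain_of_notMem_range,
      zero_add]
    · rfl
    · rintro ⟨m, hm⟩
      simp only at hm
      omega

lemma interleave_comp_even {X : Type*} (x y : ℕ → X) : interleave x y ∘ (fun n => 2 * n) = x :=
  funext fun n => interleave_two_mul x y n

lemma interleave_comp_odd {X : Type*} (x y : ℕ → X) : interleave x y ∘ (fun n => 2 * n + 1) = y :=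
  funext fun n => interleave_two_mul_add_one x y n

lemma comb_interleave (A : ℕ →₀ ℝ) (x y : ℕ → X) :
    comb A (interleave x y) = comb (evenPart A) x + comb (oddPart A) y := by
  conv_lhs => rw [← mapDomain_evenPart_add A]
  rw [comb_add, ← comb_comp, ← comb_comp, interleave_comp_even, interleave_comp_odd]

lemma IsPositiveBlockSubseq.of_comp {x z : ℕ → X} {φ : ℕ → ℕ} (hφ : StrictMono φ)
    (h : IsPositiveBlockSubseq (x ∘ φ) z) : IsPositiveBlockSubseq x z := by
  obtain ⟨c, hc0, hc, hz, hz0⟩ := isPositiveBlockSubseq_iff.1 h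
  refine isPositiveBlockSubseq_iff.2 ⟨fun n => (c n).mapDomain φ, fun n k => ?_, ?_,
    fun n => by rw [hz, comb_comp], hz0⟩
  · by_cases hk : k ∈ Set.range φ
    · obtain ⟨j, rfl⟩ := hk
      rw [Finsupp.mapDomain_apply hφ.injective]
      exact hc0 n j
    · rw [Finsupp.mapDomain_of_notMem_range _ _ hk]
  · intro m n hmn i hi j hj
    obtain ⟨i', hi', rfl⟩ := Finset.mem_image.1 (Finsupp.mapDomain_support hi)
    obtain ⟨j', hj', rfl⟩ := Finset.mem_image.1 (Finsupp.mapDomain_support hj)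
    exact hφ (hc m n hmn i' hi' j' hj')

lemma IsLSS.neg {E : Type*} [NormedAddCommGroup E] [NormedSpace ℝ E] [Lattice E] {T : E →L[ℝ] X}
    (hT : IsLSS T) : IsLSS (-T) := by
  intro S h1 h2 h3 h4 ⟨c, hc, h⟩
  exact hT S h1 h2 h3 h4 ⟨c, hc, fun v hv => by simpa using h v hv⟩

/-- The differences `xₙ - yₙ` form an unconditional sequence, equivalent to the maximum of the two
sequences, whereas no positive block of `(x₀, y₀, x₁, y₁, …)` is unconditional. -/
structure IsDominatedPair (x y : ℕ → X) : Prop where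
  noUncond : NoUnconditionalPositiveBlock (interleave x y)
  uncond : IsUnconditionalSeq fun n => x n - y n
  approx : ApproxEq (fun a : ℕ →₀ ℝ => ‖comb a (fun n => x n - y n)‖)
    (fun a => max ‖comb a x‖ ‖comb a y‖)

lemma norm_comb_le_of_sumOp_bound {x : ℕ → X} {hx : ∀ n, x n ≠ 0} {y : ℕ → X} {C : ℝ} (hC : 0 ≤ C)
    (h : ∀ a, ‖comb a y‖ ≤ C * ‖comb a x‖) (F : Finset (ULift.{v} ℕ)) (a : ULift.{v} ℕ → ℝ) :
    ‖∑ i ∈ F, a i • y i.down‖ₑ ≤ (C.toNNReal : ℝ≥0∞) * (dualWeights.{u, v} x hx).eNorm a := by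
  let G : Finset ℕ := F.map ⟨ULift.down, ULift.down_injective⟩
  let f : ℕ →₀ ℝ := blockCoeff G fun k => a (ULift.up k)
  have hf : ∀ z : ℕ → X, ∑ i ∈ F, a i • z i.down = comb f z := fun z => by
    rw [comb_blockCoeff, Finset.sum_map]
    rfl
  have h1 := enorm_sum_le_dualWeights (hx := hx) F a
  rw [hf] at h1 ⊢
  refine le_trans ?_ (mul_le_mul_right h1 _)
  rw [← _root_.ofReal_norm, ← _root_.ofReal_norm, ENNReal.ofNNReal_toNNReal,
    ← ENNReal.ofReal_mul hC]
  exact ENNReal.ofReal_le_ofReal (h f)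

variable [CompleteSpace X]

lemma isLSS_of_noUncond {κ : Type u} {W : WeightFamily κ (ULift.{v} ℕ)} {T : W.SeqLattice →L[ℝ] X}
    {x : ℕ → X} (hTx : ∀ f, T (ofFinsupp f) = comb f x) (hx : NoUnconditionalPositiveBlock x) :
    IsLSS T := by
  by_contra hT
  obtain ⟨z, hz, hz'⟩ := exists_unconditional_of_not_isLSS hT hTx
  exact hx z hz hz'

/-- The operator sends the unit vectors of the lattice of `w = (x₀, y₀, x₁, y₁, …)` to `w`. It is an
isomorphism on the span of the disjoint vectors `e₂ₙ - e₂ₙ₊₁`, since all signed combinations of `x`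
and of `y` are dominated by those of `x - y`. -/
theorem IsDominatedPair.exists_isLSS_not_isDSS {x y : ℕ → X} (hx : ∀ n, x n ≠ 0)
    (hy : ∀ n, y n ≠ 0) (h : IsDominatedPair x y) :
    ∃ (E : Type v) (_ : NormedAddCommGroup E) (_ : NormedSpace ℝ E) (_ : Lattice E)
      (_ : IsBanachLattice E) (T : E →L[ℝ] X), IsLSS T ∧ ¬ IsDSS T := by
  have hw : ∀ n, interleave x y n ≠ 0 := fun n => by
    unfold interleave
    split_ifs
    exacts [hx _, hy _]
  have hb := norm_comb_le_of_sumOp_bound.{u, v} (x := interleave x y) (hx := hw) zero_le_one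
    (fun a => (one_mul ‖comb a (interleave x y)‖).ge)
  refine ⟨(dualWeights.{u, v} (interleave x y) hw).SeqLattice, inferInstance, inferInstance,
    inferInstance, inferInstance, sumOp (fun i => interleave x y i.down) _ hb,
    isLSS_of_noUncond (sumOp_ofFinsupp hb) h.noUncond, fun hDSS => ?_⟩
  obtain ⟨-, K, hK0, hK⟩ := isUnconditionalSeq_iff.1 h.uncond
  obtain ⟨-, C, hC0, hC⟩ := h.approx
  -- the disjoint vectors `e₂ₙ - e₂ₙ₊₁`
  let d : ℕ → ℕ →₀ ℝ := fun n => Finsupp.single (2 * n) 1 - Finsupp.single (2 * n + 1) 1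
  have hd : DisjointSupports d := by
    intro m n hmn
    rw [Finset.disjoint_left]
    intro i hi hj
    have key : ∀ n, i ∈ (d n).support → i = 2 * n ∨ i = 2 * n + 1 := by
      intro n hn
      by_contra! hcon
      rw [Finsupp.mem_support_iff] at hn
      simp [d, Ne.symm hcon.1, Ne.symm hcon.2] at hn
    have h1 := key m hi
    have h2 := key n hj
    omega
  have hd0 : ∀ n, d n ≠ 0 := fun n hn => by
    have := DFunLike.congr_fun hn (2 * n)
    simp [d] at this
  have hdf : ∀ f : ℕ →₀ ℝ, (∀ n, Finsupp.linearCombination ℝ d f (2 * n) = f n) ∧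
      ∀ n, Finsupp.linearCombination ℝ d f (2 * n + 1) = -f n := by
    intro f
    constructor
    · intro n
      have h1 : d n (2 * n) = 1 := by simp [d]
      rw [hd.linearCombination_apply (n := n) (by rw [h1]; exact one_ne_zero), h1, mul_one]
    · intro n
      have h1 : d n (2 * n + 1) = -1 := by simp [d]
      rw [hd.linearCombination_apply (n := n) (by rw [h1]; norm_num), h1, mul_neg_one]
  have hTd : ∀ f, comb (Finsupp.linearCombination ℝ d f) (interleave x y) =
      comb f fun n => x n - y n := by
    intro f
    have he : evenPart (Finsupp.linearCombination ℝ d f) = f := Finsupp.ext (hdf f).1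
    have ho : oddPart (Finsupp.linearCombination ℝ d f) = -f := Finsupp.ext (hdf f).2
    rw [comb_interleave, he, ho, comb_sub_right, ← neg_one_smul ℝ f, comb_smul, neg_one_smul,
      sub_eq_add_neg]
  refine hDSS (fun n => ofFinsupp (d n)) (fun n => ofFinsupp_ne_zero (hd0 n))
    (disjoint_ofFinsupp hd) (isIsoOn_closedSpan.2 ⟨(2 * C * K)⁻¹, by positivity, fun f => ?_⟩)
  rw [comb_ofFinsupp, sumOp_ofFinsupp, hTd, inv_mul_le_iff₀ (by positivity)]
  refine (norm_le_iff (by positivity)).2 (dualWeights_norm_le fun g hg => ?_)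
  have hge : ∀ n, |evenPart g n| = |f n| := fun n => by rw [evenPart_apply, hg, (hdf f).1]
  have hgo : ∀ n, |oddPart g n| = |f n| := fun n => by
    rw [oddPart_apply, hg, (hdf f).2, abs_neg]
  have h1 : ‖comb (evenPart g) x‖ ≤ C * ‖comb (evenPart g) fun n => x n - y n‖ :=
    (le_max_left _ _).trans (hC _)
  have h2 : ‖comb (oddPart g) y‖ ≤ C * ‖comb (oddPart g) fun n => x n - y n‖ :=
    (le_max_right _ _).trans (hC _)
  have h3 := mul_le_mul_of_nonneg_left (hK f _ hge) hC0.le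
  have h4 := mul_le_mul_of_nonneg_left (hK f _ hgo) hC0.le
  rw [comb_interleave]
  refine (norm_add_le _ _).trans ?_
  linarith

/-- On the lattice of the unconditional sequence `(xₙ - yₙ)`, the operators are `eₙ ↦ xₙ` and
`eₙ ↦ -yₙ`. -/
theorem IsDominatedPair.exists_isLSS_add_not_isLSS {x y : ℕ → X} (h : IsDominatedPair x y) :
    ∃ (E : Type v) (_ : NormedAddCommGroup E) (_ : NormedSpace ℝ E) (_ : Lattice E)
      (_ : IsBanachLattice E) (T₁ T₂ : E →L[ℝ] X), IsLSS T₁ ∧ IsLSS T₂ ∧ ¬ IsLSS (T₁ + T₂) := by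
  obtain ⟨hw, K, hK0, hK⟩ := isUnconditionalSeq_iff.1 h.uncond
  obtain ⟨-, C, hC0, hC⟩ := h.approx
  have hb₁ := norm_comb_le_of_sumOp_bound.{u, v} (hx := hw) hC0.le
    (fun a => (le_max_left _ _).trans (hC a))
  have hb₂ := norm_comb_le_of_sumOp_bound.{u, v} (hx := hw) hC0.le
    (fun a => (le_max_right _ _).trans (hC a))
  have hx : NoUnconditionalPositiveBlock x := fun z hz =>
    h.noUncond z (IsPositiveBlockSubseq.of_comp (φ := fun n => 2 * n)
      (fun m n hmn => by simpa using hmn) (by rwa [interleave_comp_even]))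
  have hy : NoUnconditionalPositiveBlock y := fun z hz =>
    h.noUncond z (IsPositiveBlockSubseq.of_comp (φ := fun n => 2 * n + 1)
      (fun m n hmn => by simpa using hmn) (by rwa [interleave_comp_odd]))
  refine ⟨(dualWeights.{u, v} _ hw).SeqLattice, inferInstance, inferInstance,
    inferInstance, inferInstance, sumOp (fun i => x i.down) _ hb₁,
    -sumOp (fun i => y i.down) _ hb₂, isLSS_of_noUncond (sumOp_ofFinsupp hb₁) hx,
    (isLSS_of_noUncond (sumOp_ofFinsupp hb₂) hy).neg, fun hLSS => ?_⟩
  -- the sum is an isomorphism on the span of the unit vectors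
  let d : ℕ → ℕ →₀ ℝ := fun n => Finsupp.single n 1
  have hd : DisjointSupports d := fun m n hmn => by
    simp only [d]
    rw [Finsupp.support_single _ one_ne_zero, Finsupp.support_single _ one_ne_zero]
    simpa using hmn
  have hdf : ∀ f : ℕ →₀ ℝ, Finsupp.linearCombination ℝ d f = f := fun f => by
    simp [Finsupp.linearCombination_apply, d]
  refine hLSS.not_isIso (u := fun n => ofFinsupp (d n)) (fun n => ?_)
    (fun n => ofFinsupp_ne_zero (by simp [d])) (disjoint_ofFinsupp hd)
    ⟨K⁻¹, by positivity, fun f => ?_⟩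
  · rw [le_def]
    intro i
    rw [coeff_ofFinsupp, coeff_zero]
    simp only [d, Finsupp.single_apply, Pi.zero_apply]
    split_ifs <;> norm_num
  · rw [comb_ofFinsupp, hdf, add_apply, neg_apply, sumOp_ofFinsupp,
      sumOp_ofFinsupp, ← sub_eq_add_neg, ← comb_sub_right, inv_mul_le_iff₀ hK0]
    exact (norm_le_iff (by positivity)).2 (dualWeights_norm_le fun g hg => hK f g hg)

end Operators

/-! ### Splitting a signed block sequence into its positive and negative parts -/

section SplitBlocks

open Filter
open Finsupp (linearCombination)

variable {X : Type u} [NormedAddCommGroup X] [NormedSpace ℝ X]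

/-- If `x = (∑ₖ dₙ(k) wₖ)ₙ` with nonnegative `dₙ` and the supports of `d₂ₙ` and `d₂ₙ₊₁` both precede
those of `d₂ₙ₊₂` and `d₂ₙ₊₃`, then every second member of a positive block sequence of `x` forms a
positive block sequence of `w`. -/
lemma IsPositiveBlockSubseq.comp_two_mul {w x z : ℕ → X} {d : ℕ → ℕ →₀ ℝ}
    (hx : ∀ n, x n = comb (d n) w) (hd0 : ∀ n k, 0 ≤ d n k)
    (hd : ∀ m n, m / 2 < n / 2 → ∀ i ∈ (d m).support, ∀ j ∈ (d n).support, i < j)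
    (h : IsPositiveBlockSubseq x z) : IsPositiveBlockSubseq w (z ∘ fun n => 2 * n) := by
  obtain ⟨c, hc0, hc, hz, hz0⟩ := isPositiveBlockSubseq_iff.1 h
  obtain rfl : x = fun n => comb (d n) w := funext hx
  refine isPositiveBlockSubseq_iff.2 ⟨fun n => linearCombination ℝ d (c (2 * n)),
    fun n k => linearCombination_nonneg hd0 (hc0 _) k, fun m n hmn i hi j hj => ?_,
    fun n => ?_, fun n => hz0 _⟩
  · obtain ⟨p, hp, hip⟩ := exists_mem_support_of_mem_linearCombination hi
    obtain ⟨q, hq, hjq⟩ := exists_mem_support_of_mem_linearCombination hj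
    -- the nonempty support of the skipped block separates `p` and `q`
    obtain ⟨r, hr⟩ : (c (2 * m + 1)).support.Nonempty := by
      rw [Finsupp.support_nonempty_iff]
      intro h0
      refine hz0 (2 * m + 1) ?_
      rw [hz, h0]
      simp [comb]
    have h1 := hc (2 * m) (2 * m + 1) (by omega) p hp r hr
    have h2 := hc (2 * m + 1) (2 * n) (by omega) r hr q hq
    exact hd p q (by omega) i hip j hjq
  · rw [Function.comp_apply, hz, comb_comb]

variable [CompleteSpace X]

lemma IsUnconditionalSeq.neg {x : ℕ → X} (hx : IsUnconditionalSeq x) :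
    IsUnconditionalSeq fun n => -x n := by
  obtain ⟨h0, K, hK0, hK⟩ := isUnconditionalSeq_iff.1 hx
  have hneg : ∀ a : ℕ →₀ ℝ, comb a (fun n => -x n) = -comb a x := fun a => by
    simp [comb, Finsupp.sum]
  refine isUnconditionalSeq_iff.2 ⟨fun n => neg_ne_zero.2 (h0 n), K, hK0, fun a b hab => ?_⟩
  rw [hneg, hneg, norm_neg, norm_neg]
  exact hK a b hab

/-- The positive and the negated negative parts of the signed blocks form the pair. Both are
eventually nonzero, because otherwise `z` or `-z`, which are unconditional, would have a subsequence
consisting of positive blocks. -/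
theorem exists_isDominatedPair {x z : ℕ → X} {s : ℕ → Finset ℕ} {a : ℕ → ℝ} (hx : IsBasicSeq x)
    (hno : NoUnconditionalPositiveBlock x) (hz : IsBlockSubseq x s a z)
    (h₁ : ApproxEq (fun b : ℕ →₀ ℝ => ‖comb b z‖)
      (fun b => ‖absComb b (fun n => ∑ k ∈ s n, |a k| • x k)‖))
    (h₂ : ApproxEq (fun b : ℕ →₀ ℝ => ‖absComb b (fun n => ∑ k ∈ s n, |a k| • x k)‖)
      (fun b => max ‖comb b (fun n => ∑ k ∈ s n with 0 < a k, a k • x k)‖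
        ‖comb b (fun n => ∑ k ∈ s n with a k < 0, a k • x k)‖)) :
    ∃ x' y' : ℕ → X, IsBasicSeq x' ∧ IsBasicSeq y' ∧ IsDominatedPair x' y' := by
  obtain ⟨⟨C₁, hC₁, h₁a⟩, C₂, hC₂, h₁b⟩ := h₁
  obtain ⟨⟨C₃, hC₃, h₂a⟩, C₄, hC₄, h₂b⟩ := h₂
  simp only at h₁a h₁b h₂a h₂b
  have hunc : IsUnconditionalSeq z := by
    refine isUnconditionalSeq_iff.2 ⟨hz.ne_zero, C₁ * C₂, by positivity, fun b b' hbb' => ?_⟩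
    have hab : finsuppAbs b' = finsuppAbs b := Finsupp.ext hbb'
    have h := h₁a b'
    rw [absComb_eq, hab, ← absComb_eq] at h
    rw [mul_assoc]
    exact h.trans (mul_le_mul_of_nonneg_left (h₁b b) hC₁.le)
  set zp : ℕ → X := fun n => ∑ k ∈ s n with 0 < a k, a k • x k with hzp
  set zm : ℕ → X := fun n => ∑ k ∈ s n with a k < 0, a k • x k with hzm
  have hsum : ∀ n, z n = zp n + zm n := by
    intro n
    rw [hz.eq_sum, hzp, hzm]
    simp only
    rw [Finset.sum_filter, Finset.sum_filter, ← Finset.sum_add_distrib]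
    refine Finset.sum_congr rfl fun k _ => ?_
    rcases lt_trichotomy (a k) 0 with h | h | h
    · rw [if_neg (not_lt.2 h.le), if_pos h, zero_add]
    · simp [h]
    · rw [if_pos h, if_neg (not_lt.2 h.le), add_zero]
  let cp : ℕ → ℕ →₀ ℝ := fun n => blockCoeff ((s n).filter fun k => 0 < a k) a
  let cm : ℕ → ℕ →₀ ℝ := fun n => blockCoeff ((s n).filter fun k => a k < 0) fun k => -a k
  have hcp : ∀ n, comb (cp n) x = zp n := fun n => comb_blockCoeff _ _ _
  have hcm : ∀ n, comb (cm n) x = -zm n := fun n => by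
    simp only [cm, comb_blockCoeff, neg_smul, Finset.sum_neg_distrib, hzm]
  have hcp0 : ∀ n k, 0 ≤ cp n k := fun n k => by
    simp only [cp, blockCoeff_apply, Finset.mem_filter]
    split_ifs with h
    exacts [h.2.le, le_rfl]
  have hcm0 : ∀ n k, 0 ≤ cm n k := fun n k => by
    simp only [cm, blockCoeff_apply, Finset.mem_filter]
    split_ifs with h
    exacts [by linarith [h.2], le_rfl]
  have hsp : ∀ n, (cp n).support ⊆ s n := fun n =>
    (support_blockCoeff _ _).trans (Finset.filter_subset _ _)
  have hsm : ∀ n, (cm n).support ⊆ s n := fun n =>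
    (support_blockCoeff _ _).trans (Finset.filter_subset _ _)
  -- if one of the parts vanished infinitely often, the other would yield a positive block
  have hpne : ∀ᶠ n in atTop, zp n ≠ 0 := by
    by_contra h
    obtain ⟨φ, hφ, hφ0⟩ := extraction_of_frequently_atTop (not_eventually.1 h)
    have hz' : ∀ n, comb (cm (φ n)) x = -z (φ n) := fun n => by
      rw [hcm, hsum, not_not.1 (hφ0 n), zero_add]
    refine hno (fun n => -z (φ n)) (isPositiveBlockSubseq_iff.2 ⟨fun n => cm (φ n),
      fun n => hcm0 _, fun m n hmn i hi j hj =>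
        hz.successive _ _ (hφ hmn) i (hsm _ hi) j (hsm _ hj),
      fun n => (hz' n).symm, fun n => neg_ne_zero.2 (hz.ne_zero _)⟩) (hunc.comp hφ.injective).neg
  have hmne : ∀ᶠ n in atTop, zm n ≠ 0 := by
    by_contra h
    obtain ⟨φ, hφ, hφ0⟩ := extraction_of_frequently_atTop (not_eventually.1 h)
    have hz' : ∀ n, comb (cp (φ n)) x = z (φ n) := fun n => by
      rw [hcp, hsum, not_not.1 (hφ0 n), add_zero]
    refine hno (z ∘ φ) (isPositiveBlockSubseq_iff.2 ⟨fun n => cp (φ n),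
      fun n => hcp0 _, fun m n hmn i hi j hj =>
        hz.successive _ _ (hφ hmn) i (hsp _ hi) j (hsp _ hj),
      fun n => (hz' n).symm, fun n => hz.ne_zero _⟩) (hunc.comp hφ.injective)
  obtain ⟨N, hN⟩ := eventually_atTop.1 (hpne.and hmne)
  have hinj : Function.Injective fun n => n + N := add_left_injective N
  have hx' : (fun n => zp (n + N)) = fun n => comb (cp (n + N)) x := funext fun n => (hcp _).symm
  have hy' : (fun n => -zm (n + N)) = fun n => comb (cm (n + N)) x := funext fun n => (hcm _).symm
  have hsub : (fun n => zp (n + N) - -zm (n + N)) = z ∘ fun n => n + N :=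
    funext fun n => by rw [sub_neg_eq_add, Function.comp_apply, hsum]
  refine ⟨fun n => zp (n + N), fun n => -zm (n + N), ?_, ?_, ?_, ?_, ?_⟩
  · rw [hx']
    refine hx.block (fun m n hmn i hi j hj => ?_) fun n => ?_
    · exact hz.successive (m + N) (n + N) (by omega) i (hsp _ hi) j (hsp _ hj)
    · rw [hcp]; exact (hN _ (Nat.le_add_left _ _)).1
  · rw [hy']
    refine hx.block (fun m n hmn i hi j hj => ?_) fun n => ?_
    · exact hz.successive (m + N) (n + N) (by omega) i (hsm _ hi) j (hsm _ hj)
    · rw [hcm]; exact neg_ne_zero.2 (hN _ (Nat.le_add_left _ _)).2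
  · intro v hv hunc'
    let d : ℕ → ℕ →₀ ℝ := interleave (fun n => cp (n + N)) fun n => cm (n + N)
    have hds : ∀ n, (d n).support ⊆ s (n / 2 + N) := fun n => by
      simp only [d, interleave]
      split_ifs
      exacts [hsp _, hsm _]
    refine hno _ (hv.comp_two_mul (w := x) (d := d) (fun n => ?_) (fun n k => ?_)
      fun m n hmn i hi j hj => ?_) (hunc'.comp injective_two_mul)
    · simp only [d, interleave]
      split_ifs
      exacts [(hcp _).symm, (hcm _).symm]
    · simp only [d, interleave]
      split_ifs
      exacts [hcp0 _ _, hcm0 _ _]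
    · exact hz.successive (m / 2 + N) (n / 2 + N) (by omega) i (hds _ hi) j (hds _ hj)
  · rw [hsub]
    exact hunc.comp hinj
  · have hneg : ∀ b : ℕ →₀ ℝ, ‖comb b fun n => -zm (n + N)‖ =
        ‖comb (b.mapDomain fun n => n + N) zm‖ := fun b => by
      rw [← comb_comp, ← norm_neg]
      simp [comb, Finsupp.sum]
    have hpos : ∀ b : ℕ →₀ ℝ, ‖comb b fun n => zp (n + N)‖ =
        ‖comb (b.mapDomain fun n => n + N) zp‖ := fun b => by
      rw [← comb_comp]; rfl
    simp only [hsub, hneg, hpos, comb_comp]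
    refine ⟨⟨C₁ * C₃, by positivity, fun b => ?_⟩, C₄ * C₂, by positivity, fun b => ?_⟩
    · rw [mul_assoc]
      exact (h₁a _).trans (mul_le_mul_of_nonneg_left (h₂a _) hC₁.le)
    · rw [mul_assoc]
      exact (h₂b _).trans (mul_le_mul_of_nonneg_left (h₁b _) hC₄.le)

end SplitBlocks

/-! ### Split pairs: the two halves of an operator that preserves a disjoint sequence -/

section SplitPairs

open Finsupp (linearCombination)

lemma linearCombination_add_left {ι : Type*} (a b : ℕ → ι →₀ ℝ) (f : ℕ →₀ ℝ) :
    linearCombination ℝ (fun n => a n + b n) f =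
      linearCombination ℝ a f + linearCombination ℝ b f := by
  simp [Finsupp.linearCombination_apply, Finsupp.sum, Finset.sum_add_distrib]

lemma linearCombination_linearCombination {ι : Type*} (c : ℕ → ι →₀ ℝ) (d : ℕ → ℕ →₀ ℝ)
    (f : ℕ →₀ ℝ) : linearCombination ℝ (fun n => linearCombination ℝ c (d n)) f =
      linearCombination ℝ c (linearCombination ℝ d f) :=
  (Finsupp.apply_linearCombination ℝ (linearCombination ℝ c) d f).symm

variable {X : Type*} [NormedAddCommGroup X] [NormedSpace ℝ X]

/-- The situation obtained from a lattice strictly singular operator `T` and disjoint vectors `eₙ`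
on whose span `T` is an isomorphism, written on coefficient sequences:
`N a = ‖∑ aₙ eₙ‖`, `P a = T (∑ aₙ eₙ⁺)`, `Q a = T (∑ aₙ eₙ⁻)`. The last field says that `T` is not
bounded below on disjoint positive vectors of the form `∑ aₖ eₖ⁺ + ∑ bₖ eₖ⁻`. -/
structure SplitPair (N : Seminorm ℝ (ℕ →₀ ℝ)) (P Q : (ℕ →₀ ℝ) →ₗ[ℝ] X) (C : ℝ) : Prop where
  pos : 0 < C
  solid : ∀ {a b : ℕ →₀ ℝ}, (∀ k, |a k| ≤ |b k|) → N a ≤ N b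
  pos_of_ne : ∀ {a : ℕ →₀ ℝ}, a ≠ 0 → 0 < N a
  left_le : ∀ a, ‖P a‖ ≤ C * N a
  right_le : ∀ a, ‖Q a‖ ≤ C * N a
  le_sub : ∀ a, N a ≤ C * ‖P a - Q a‖
  not_le : ∀ a b : ℕ → ℕ →₀ ℝ, (∀ n k, 0 ≤ a n k) → (∀ n k, 0 ≤ b n k) →
    DisjointSupports a → DisjointSupports b →
    (∀ n, a n ≠ 0 ∨ b n ≠ 0) → ¬ ∃ c : ℝ, 0 < c ∧ ∀ f,
      c * (N (linearCombination ℝ a f) + N (linearCombination ℝ b f)) ≤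
        ‖P (linearCombination ℝ a f) + Q (linearCombination ℝ b f)‖

namespace SplitPair

variable {N : Seminorm ℝ (ℕ →₀ ℝ)} {P Q : (ℕ →₀ ℝ) →ₗ[ℝ] X} {C : ℝ}

lemma symm (h : SplitPair N P Q C) : SplitPair N Q P C where
  pos := h.pos
  solid := h.solid
  pos_of_ne := h.pos_of_ne
  left_le := h.right_le
  right_le := h.left_le
  le_sub a := by rw [norm_sub_rev]; exact h.le_sub a
  not_le a b ha hb hda hdb h0 hcon := by
    refine h.not_le b a hb ha hdb hda (fun n => (h0 n).symm) ?_
    obtain ⟨c, hc, hcf⟩ := hcon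
    exact ⟨c, hc, fun f => by rw [add_comm (N _), add_comm (P _)]; exact hcf f⟩

lemma congr (h : SplitPair N P Q C) {a b : ℕ →₀ ℝ} (hab : ∀ k, |a k| = |b k|) : N a = N b :=
  le_antisymm (h.solid fun k => (hab k).le) (h.solid fun k => (hab k).ge)

lemma finsuppAbs_linearCombination (h : SplitPair N P Q C) {c : ℕ → ℕ →₀ ℝ}
    (hd : DisjointSupports c) (h0 : ∀ n k, 0 ≤ c n k) (f : ℕ →₀ ℝ) :
    N (linearCombination ℝ c (finsuppAbs f)) = N (linearCombination ℝ c f) := by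
  rw [← hd.finsuppAbs_linearCombination h0]
  exact h.congr fun k => by simp

lemma abs_mul_le (h : SplitPair N P Q C) {c : ℕ → ℕ →₀ ℝ} (hd : DisjointSupports c) (f : ℕ →₀ ℝ)
    (n : ℕ) : |f n| * N (c n) ≤ N (linearCombination ℝ c f) := by
  have h1 : |f n| * N (c n) = N (linearCombination ℝ c (Finsupp.single n (f n))) := by
    rw [Finsupp.linearCombination_single, map_smul_eq_mul, Real.norm_eq_abs]
  rw [h1]
  refine h.solid (hd.abs_linearCombination_le (fun n k => le_rfl) fun m => ?_)
  by_cases hm : n = m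
  · subst hm; simp
  · rw [Finsupp.single_eq_of_ne' hm, abs_zero]
    exact abs_nonneg _

/-- Split pairs pass to positive blocks. -/
lemma block (h : SplitPair N P Q C) {c : ℕ → ℕ →₀ ℝ} (hd : DisjointSupports c)
    (h0 : ∀ n k, 0 ≤ c n k) (hc : ∀ n, c n ≠ 0) :
    SplitPair (N.comp (linearCombination ℝ c)) (P ∘ₗ linearCombination ℝ c)
      (Q ∘ₗ linearCombination ℝ c) C where
  pos := h.pos
  solid hab := h.solid (hd.abs_linearCombination_le (fun n k => le_rfl) hab)
  pos_of_ne {a} ha := by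
    obtain ⟨n, hn⟩ := Finsupp.ne_iff.1 ha
    exact (mul_pos (abs_pos.2 hn) (h.pos_of_ne (hc n))).trans_le (h.abs_mul_le hd a n)
  left_le a := h.left_le _
  right_le a := h.right_le _
  le_sub a := h.le_sub _
  not_le a b ha hb hda hdb hab := by
    have hne : ∀ d : ℕ →₀ ℝ, d ≠ 0 → linearCombination ℝ c d ≠ 0 := by
      intro d hd0 hcon
      obtain ⟨n, hn⟩ := Finsupp.ne_iff.1 hd0
      have h1 := (mul_pos (abs_pos.2 hn) (h.pos_of_ne (hc n))).trans_le (h.abs_mul_le hd d n)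
      rw [hcon, map_zero] at h1
      exact lt_irrefl _ h1
    have := h.not_le (fun n => linearCombination ℝ c (a n)) (fun n => linearCombination ℝ c (b n))
      (fun n => linearCombination_nonneg h0 (ha n)) (fun n => linearCombination_nonneg h0 (hb n))
      (hd.linearCombination hda) (hd.linearCombination hdb)
      (fun n => (hab n).imp (hne _) (hne _))
    simp only [linearCombination_linearCombination] at this
    exact this

/-- On positive elements of a tail the left half is bounded below. Otherwise `P` would be negligible
on some positive blocks `aₙ`, where `Q ≈ -(P - Q)` would be bounded below. -/
lemma exists_left_ge (h : SplitPair N P Q C) : ∃ (m : ℕ) (δ : ℝ), 0 < δ ∧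
    ∀ a : ℕ →₀ ℝ, (∀ k, 0 ≤ a k) → (∀ k ∈ a.support, m ≤ k) → δ * N a ≤ ‖P a‖ := by
  by_contra! hcon
  have hC := h.pos
  set η : ℝ := 1 / (2 * C) with hη
  have hη0 : 0 < η := by positivity
  obtain ⟨c, hc, hs⟩ := exists_seq_successive (fun a : ℕ →₀ ℝ => a.support)
    (fun m a => (∀ k, 0 ≤ a k) ∧ N a = 1 ∧ ‖P a‖ ≤ η * (1 / 2) ^ (m + 1)) (by
      intro m M
      obtain ⟨a, ha0, haM, ha⟩ := hcon M (η * (1 / 2) ^ (m + 1)) (by positivity)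
      have hN : 0 < N a := by
        rcases (apply_nonneg N a).eq_or_lt with h1 | h1
        · rw [← h1, mul_zero] at ha
          exact absurd ha (norm_nonneg _).not_gt
        · exact h1
      refine ⟨(N a)⁻¹ • a, fun k hk => haM k (Finsupp.support_smul hk), fun k => ?_, ?_, ?_⟩
      · exact mul_nonneg (inv_nonneg.2 hN.le) (ha0 k)
      · rw [map_smul_eq_mul, norm_inv, Real.norm_of_nonneg hN.le, inv_mul_cancel₀ hN.ne']
      · rw [map_smul, norm_smul, norm_inv, Real.norm_of_nonneg hN.le, inv_mul_le_iff₀ hN, mul_comm]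
        exact ha.le)
  have hd : DisjointSupports c := SuccessiveSupports.disjoint hs
  refine h.not_le (fun _ => 0) c (fun _ _ => le_rfl) (fun n => (hc n).1) (fun _ _ _ => by simp) hd
    (fun n => Or.inr fun h0 => by have := (hc n).2.1; simp [h0] at this)
    ⟨1 / (2 * C), by positivity, fun f => ?_⟩
  have h1 : ‖P (linearCombination ℝ c f)‖ ≤ η * N (linearCombination ℝ c f) :=
    norm_map_le_of_small (L := P ∘ₗ linearCombination ℝ c) hη0.le (apply_nonneg _ _)
      (fun n => by simpa using (hc n).2.2)
      fun n => by simpa [(hc n).2.1] using h.abs_mul_le hd f n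
  have h2 := h.le_sub (linearCombination ℝ c f)
  have h3 := norm_sub_le (P (linearCombination ℝ c f)) (Q (linearCombination ℝ c f))
  have h4 : linearCombination ℝ (fun _ : ℕ => (0 : ℕ →₀ ℝ)) f = 0 := by
    simp [Finsupp.linearCombination_apply]
  rw [h4, map_zero, map_zero, zero_add, zero_add, one_div_mul_eq_div, div_le_iff₀ (by positivity)]
  have h5 : C * ‖P (linearCombination ℝ c f) - Q (linearCombination ℝ c f)‖ ≤
      C * (η * N (linearCombination ℝ c f) + ‖Q (linearCombination ℝ c f)‖) :=
    mul_le_mul_of_nonneg_left (by linarith) hC.le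
  have h6 : C * (η * N (linearCombination ℝ c f)) = N (linearCombination ℝ c f) / 2 := by
    rw [hη]; field_simp
  rw [mul_add, h6] at h5
  linarith

/-- If `P aₙ + Q bₙ` were small for positive blocks with `bₙ` normalized and `N aₙ ≤ N bₙ`, then
`aₙ` would control `bₙ`, since `P` and `Q` are bounded below on positive elements, and
`Q (aₙ + bₙ) ≈ -(P - Q) aₙ` would be bounded below on all combinations. -/
lemma exists_add_ge_of_le (h : SplitPair N P Q C) : ∃ (m : ℕ) (δ : ℝ), 0 < δ ∧
    ∀ a b : ℕ →₀ ℝ, (∀ k, 0 ≤ a k) → (∀ k, 0 ≤ b k) → (∀ k ∈ a.support, m ≤ k) →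
      (∀ k ∈ b.support, m ≤ k) → N a ≤ N b → δ * N b ≤ ‖P a + Q b‖ := by
  classical
  obtain ⟨m₁, δ, hδ, hQ⟩ := h.symm.exists_left_ge
  by_contra! hcon
  have hC := h.pos
  set K : ℝ := 2 * C / δ with hK
  have hK0 : 0 < K := by positivity
  set η : ℝ := min (δ / 2) (1 / (2 * C * K)) with hη
  have hη0 : 0 < η := by positivity
  obtain ⟨p, hp, hs⟩ := exists_seq_successive
    (fun p : (ℕ →₀ ℝ) × (ℕ →₀ ℝ) => p.1.support ∪ p.2.support)
    (fun m p => (∀ k, 0 ≤ p.1 k) ∧ (∀ k, 0 ≤ p.2 k) ∧ (∀ k ∈ p.2.support, m₁ ≤ k) ∧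
      N p.2 = 1 ∧ ‖P p.1 + Q p.2‖ ≤ η * (1 / 2) ^ (m + 1)) (by
      intro m M
      obtain ⟨a, b, ha0, hb0, haM, hbM, hab, hlt⟩ :=
        hcon (max M m₁) (η * (1 / 2) ^ (m + 1)) (by positivity)
      have hN : 0 < N b := by
        rcases (apply_nonneg N b).eq_or_lt with h1 | h1
        · rw [← h1, mul_zero] at hlt
          exact absurd hlt (norm_nonneg _).not_gt
        · exact h1
      refine ⟨((N b)⁻¹ • a, (N b)⁻¹ • b), fun k hk => ?_, fun k => ?_, fun k => ?_, fun k hk => ?_,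
        ?_, ?_⟩
      · rcases Finset.mem_union.1 hk with hk | hk
        · exact (le_max_left _ _).trans (haM k (Finsupp.support_smul hk))
        · exact (le_max_left _ _).trans (hbM k (Finsupp.support_smul hk))
      · exact mul_nonneg (inv_nonneg.2 hN.le) (ha0 k)
      · exact mul_nonneg (inv_nonneg.2 hN.le) (hb0 k)
      · exact (le_max_right _ _).trans (hbM k (Finsupp.support_smul hk))
      · rw [map_smul_eq_mul, norm_inv, Real.norm_of_nonneg hN.le, inv_mul_cancel₀ hN.ne']
      · rw [map_smul, map_smul, ← smul_add, norm_smul, norm_inv, Real.norm_of_nonneg hN.le,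
          inv_mul_le_iff₀ hN, mul_comm]
        exact hlt.le)
  choose ha0 hb0 hbm hb1 hsmall using hp
  set a : ℕ → ℕ →₀ ℝ := fun n => (p n).1 with ha
  set b : ℕ → ℕ →₀ ℝ := fun n => (p n).2 with hb
  have hda : DisjointSupports a := SuccessiveSupports.disjoint fun m n hmn i hi j hj =>
    hs m n hmn i (Finset.mem_union_left _ hi) j (Finset.mem_union_left _ hj)
  have hdb : DisjointSupports b := SuccessiveSupports.disjoint fun m n hmn i hi j hj =>
    hs m n hmn i (Finset.mem_union_right _ hi) j (Finset.mem_union_right _ hj)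
  have hdab : DisjointSupports fun n => a n + b n :=
    SuccessiveSupports.disjoint fun m n hmn i hi j hj =>
      hs m n hmn i (Finsupp.support_add hi) j (Finsupp.support_add hj)
  have herr : ∀ f : ℕ →₀ ℝ, ‖P (linearCombination ℝ a f) + Q (linearCombination ℝ b f)‖ ≤
      η * N (linearCombination ℝ b f) := fun f =>
    norm_map_le_of_small (L := P ∘ₗ linearCombination ℝ a + Q ∘ₗ linearCombination ℝ b) hη0.le
      (apply_nonneg _ _) (fun n => by simpa using hsmall n)
      fun n => by simpa [hb, hb1 n] using h.abs_mul_le hdb f n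
  refine h.not_le (fun _ => 0) (fun n => a n + b n) (fun _ _ => le_rfl)
    (fun n k => add_nonneg (ha0 n k) (hb0 n k)) (fun _ _ _ => by simp) hdab
    (fun n => Or.inr fun h0 => ?_) ⟨1 / (2 * C * (1 + K)), by positivity, fun f => ?_⟩
  · have h1 : N (p n).2 ≤ N (a n + b n) := h.solid fun k => by
      rw [Finsupp.add_apply, abs_of_nonneg (hb0 n k),
        abs_of_nonneg (add_nonneg (ha0 n k) (hb0 n k))]
      exact le_add_of_nonneg_left (ha0 n k)
    rw [h0, map_zero, hb1] at h1
    linarith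
  · have h4 : linearCombination ℝ (fun _ : ℕ => (0 : ℕ →₀ ℝ)) f = 0 := by
      simp [Finsupp.linearCombination_apply]
    rw [h4, map_zero, map_zero, zero_add, zero_add, linearCombination_add_left]
    set A := N (linearCombination ℝ a f) with hA
    set B := N (linearCombination ℝ b f) with hB
    have hA0 : 0 ≤ A := apply_nonneg _ _
    have hB0 : 0 ≤ B := apply_nonneg _ _
    have hBA : B ≤ K * A := by
      have h1 := hQ (linearCombination ℝ b (finsuppAbs f))
        (linearCombination_nonneg hb0 fun n => by simp) (fun k hk => by
          obtain ⟨n, -, hn⟩ := exists_mem_support_of_mem_linearCombination hk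
          exact hbm n k hn)
      have h2 := herr (finsuppAbs f)
      have h3 := h.left_le (linearCombination ℝ a (finsuppAbs f))
      rw [h.finsuppAbs_linearCombination hdb hb0] at h1 h2
      rw [h.finsuppAbs_linearCombination hda ha0] at h3
      have h5 := norm_sub_le (P (linearCombination ℝ a (finsuppAbs f)) +
        Q (linearCombination ℝ b (finsuppAbs f))) (P (linearCombination ℝ a (finsuppAbs f)))
      rw [add_sub_cancel_left] at h5
      have h6 : η * B ≤ δ / 2 * B := mul_le_mul_of_nonneg_right (min_le_left _ _) hB0
      rw [hK, div_mul_eq_mul_div, le_div_iff₀ hδ]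
      linarith
    have h1 := h.le_sub (linearCombination ℝ a f)
    have h2 : P (linearCombination ℝ a f) - Q (linearCombination ℝ a f) =
        (P (linearCombination ℝ a f) + Q (linearCombination ℝ b f)) -
          Q (linearCombination ℝ a f + linearCombination ℝ b f) := by
      rw [map_add]; abel
    have h3 := norm_sub_le (P (linearCombination ℝ a f) + Q (linearCombination ℝ b f))
      (Q (linearCombination ℝ a f + linearCombination ℝ b f))
    rw [← h2] at h3
    have h5 : C * (η * B) ≤ A / 2 := by
      have h6 : η * B ≤ 1 / (2 * C * K) * (K * A) :=
        mul_le_mul (min_le_right _ _) hBA hB0 (by positivity)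
      calc C * (η * B) ≤ C * (1 / (2 * C * K) * (K * A)) := mul_le_mul_of_nonneg_left h6 hC.le
        _ = A / 2 := by field_simp
    have h6 := mul_le_mul_of_nonneg_left (h3.trans (add_le_add_left (herr f) _)) hC.le
    have h7 : N (linearCombination ℝ a f + linearCombination ℝ b f) ≤ A + B := map_add_le_add _ _ _
    rw [mul_add] at h6
    rw [one_div_mul_eq_div, div_le_iff₀ (by positivity)]
    have h8 : A ≤ 2 * (C * ‖Q (linearCombination ℝ a f + linearCombination ℝ b f)‖) := by linarith
    have h9 := mul_le_mul_of_nonneg_left h8 (by positivity : 0 ≤ 1 + K)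
    linarith

lemma exists_add_ge (h : SplitPair N P Q C) : ∃ (m : ℕ) (δ : ℝ), 0 < δ ∧
    ∀ a b : ℕ →₀ ℝ, (∀ k, 0 ≤ a k) → (∀ k, 0 ≤ b k) → (∀ k ∈ a.support, m ≤ k) →
      (∀ k ∈ b.support, m ≤ k) → δ * (N a + N b) ≤ ‖P a + Q b‖ := by
  obtain ⟨m₁, δ₁, hδ₁, h₁⟩ := h.exists_add_ge_of_le
  obtain ⟨m₂, δ₂, hδ₂, h₂⟩ := h.symm.exists_add_ge_of_le
  refine ⟨max m₁ m₂, min δ₁ δ₂ / 2, by positivity, fun a b ha hb ham hbm => ?_⟩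
  have hd : 0 < min δ₁ δ₂ := by positivity
  rcases le_total (N a) (N b) with hab | hab
  · refine le_trans ?_ (h₁ a b ha hb (fun k hk => (le_max_left _ _).trans (ham k hk))
      (fun k hk => (le_max_left _ _).trans (hbm k hk)) hab)
    have h3 := mul_le_mul_of_nonneg_right (min_le_left δ₁ δ₂) (apply_nonneg N b)
    have h4 := mul_le_mul_of_nonneg_left hab hd.le
    linarith
  · rw [add_comm (P a)]
    refine le_trans ?_ (h₂ b a hb ha (fun k hk => (le_max_right _ _).trans (hbm k hk))
      (fun k hk => (le_max_right _ _).trans (ham k hk)) hab)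
    have h3 := mul_le_mul_of_nonneg_right (min_le_right δ₁ δ₂) (apply_nonneg N a)
    have h4 := mul_le_mul_of_nonneg_left hab hd.le
    linarith

end SplitPair

/-- A split pair for which `(a, b) ↦ P a + Q b` is bounded below on positive elements. -/
structure PositiveSplitPair (N : Seminorm ℝ (ℕ →₀ ℝ)) (P Q : (ℕ →₀ ℝ) →ₗ[ℝ] X) (C δ : ℝ) : Prop
    extends SplitPair N P Q C where
  lower_pos : 0 < δ
  lower : ∀ a b : ℕ →₀ ℝ, (∀ k, 0 ≤ a k) → (∀ k, 0 ≤ b k) → δ * (N a + N b) ≤ ‖P a + Q b‖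

variable {N : Seminorm ℝ (ℕ →₀ ℝ)} {P Q : (ℕ →₀ ℝ) →ₗ[ℝ] X} {C δ : ℝ}

lemma PositiveSplitPair.block (h : PositiveSplitPair N P Q C δ) {c : ℕ → ℕ →₀ ℝ}
    (hd : DisjointSupports c) (h0 : ∀ n k, 0 ≤ c n k) (hc : ∀ n, c n ≠ 0) :
    PositiveSplitPair (N.comp (linearCombination ℝ c)) (P ∘ₗ linearCombination ℝ c)
      (Q ∘ₗ linearCombination ℝ c) C δ where
  toSplitPair := h.toSplitPair.block hd h0 hc
  lower_pos := h.lower_pos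
  lower _ _ ha hb := h.lower _ _ (linearCombination_nonneg h0 ha) (linearCombination_nonneg h0 hb)

/-- The unit vectors of index at least `m`. -/
noncomputable def shiftSeq (m : ℕ) : ℕ → ℕ →₀ ℝ := fun n => Finsupp.single (n + m) 1

lemma shiftSeq_nonneg (m n k : ℕ) : 0 ≤ shiftSeq m n k := by
  rw [shiftSeq, Finsupp.single_apply]
  split_ifs <;> norm_num

lemma shiftSeq_ne_zero (m n : ℕ) : shiftSeq m n ≠ 0 :=
  Finsupp.single_ne_zero.2 one_ne_zero

lemma disjointSupports_shiftSeq (m : ℕ) : DisjointSupports (shiftSeq m) := by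
  intro i j hij
  rw [shiftSeq, shiftSeq, Finsupp.support_single _ one_ne_zero,
    Finsupp.support_single _ one_ne_zero,
    Finset.disjoint_singleton]
  omega

lemma le_of_mem_support_shiftSeq {m k : ℕ} {a : ℕ →₀ ℝ}
    (hk : k ∈ (linearCombination ℝ (shiftSeq m) a).support) : m ≤ k := by
  obtain ⟨n, -, hn⟩ := exists_mem_support_of_mem_linearCombination hk
  rw [shiftSeq, Finsupp.support_single _ one_ne_zero, Finset.mem_singleton] at hn
  omega

lemma SplitPair.exists_positiveSplitPair (h : SplitPair N P Q C) :
    ∃ (N' : Seminorm ℝ (ℕ →₀ ℝ)) (P' Q' : (ℕ →₀ ℝ) →ₗ[ℝ] X) (δ : ℝ),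
      PositiveSplitPair N' P' Q' C δ := by
  obtain ⟨m, δ, hδ, hm⟩ := h.exists_add_ge
  refine ⟨_, _, _, δ, h.block (disjointSupports_shiftSeq m) (shiftSeq_nonneg m)
    (shiftSeq_ne_zero m), hδ, fun _ _ ha hb => ?_⟩
  exact hm _ _ (linearCombination_nonneg (shiftSeq_nonneg m) ha)
    (linearCombination_nonneg (shiftSeq_nonneg m) hb) (fun k => le_of_mem_support_shiftSeq)
    fun k => le_of_mem_support_shiftSeq

end SplitPairs

/-! ### The split pair of an operator which is lattice but not disjointly strictly singular -/

section OfOperator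

open Finsupp (linearCombination)

variable {E : Type*} [NormedAddCommGroup E] [NormedSpace ℝ E] [Lattice E] [IsBanachLattice E]
variable {X : Type*} [NormedAddCommGroup X] [NormedSpace ℝ X]

lemma IsLSS.exists_splitPair {T : E →L[ℝ] X} (hT : IsLSS T) (hT' : ¬ IsDSS T) :
    ∃ (N : Seminorm ℝ (ℕ →₀ ℝ)) (P Q : (ℕ →₀ ℝ) →ₗ[ℝ] X) (C : ℝ), SplitPair N P Q C := by
  rw [IsDSS] at hT'
  push Not at hT'
  obtain ⟨e, he0, he, hiso⟩ := hT'
  obtain ⟨c, hc0, hc⟩ := isIsoOn_closedSpan.1 hiso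
  have hp : ∀ n, |(e n)⁺| ≤ |e n| := fun n => by
    rw [abs_of_nonneg (posPart_nonneg _), ← posPart_add_negPart]
    exact le_add_of_nonneg_right (negPart_nonneg _)
  have hm : ∀ n, |(e n)⁻| ≤ |e n| := fun n => by
    rw [abs_of_nonneg (negPart_nonneg _), ← posPart_add_negPart]
    exact le_add_of_nonneg_left (posPart_nonneg _)
  have hN : ∀ (g : ℕ → E), (∀ n, |g n| ≤ |e n|) → ∀ a, ‖comb a g‖ ≤ ‖comb a e‖ := fun g hg a =>
    norm_comb_le_of_abs_le he hg fun n => le_rfl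
  have hsub : ∀ a, comb a e = comb a (fun n => (e n)⁺) - comb a (fun n => (e n)⁻) := fun a => by
    rw [← comb_sub_right]
    simp only [posPart_sub_negPart]
  refine ⟨(normSeminorm ℝ E).comp (linearCombination ℝ e),
    T.toLinearMap ∘ₗ linearCombination ℝ fun n => (e n)⁺,
    T.toLinearMap ∘ₗ linearCombination ℝ fun n => (e n)⁻, max (‖T‖ + 1) c⁻¹, ?_⟩
  have hT1 : ∀ v, ‖T v‖ ≤ max (‖T‖ + 1) c⁻¹ * ‖v‖ := fun v =>
    (T.le_opNorm v).trans (mul_le_mul_of_nonneg_right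
      ((le_add_of_nonneg_right zero_le_one).trans (le_max_left _ _)) (norm_nonneg _))
  have hmax : 0 < max (‖T‖ + 1) c⁻¹ := lt_max_of_lt_right (inv_pos.2 hc0)
  have hpos : ∀ {a : ℕ →₀ ℝ}, a ≠ 0 → 0 < ‖comb a e‖ := fun {a} ha => by
    obtain ⟨n, hn⟩ := Finsupp.ne_iff.1 ha
    exact (mul_pos (abs_pos.2 hn) (norm_pos_iff.2 (he0 n))).trans_le (norm_coeff_le he a n)
  refine ⟨hmax, fun hab => norm_comb_le_of_abs_le he (fun n => le_rfl) hab, hpos,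
    fun a => ?_, fun a => ?_, fun a => ?_, ?_⟩
  · exact (hT1 _).trans (mul_le_mul_of_nonneg_left (hN _ hp a) hmax.le)
  · exact (hT1 _).trans (mul_le_mul_of_nonneg_left (hN _ hm a) hmax.le)
  · have h1 : ‖comb a e‖ ≤ c⁻¹ * ‖T (comb a e)‖ := by
      rw [le_inv_mul_iff₀ hc0]; exact hc a
    have h2 : T (comb a e) = T (comb a fun n => (e n)⁺) - T (comb a fun n => (e n)⁻) := by
      rw [hsub, map_sub]
    rw [h2] at h1
    exact h1.trans (mul_le_mul_of_nonneg_right (le_max_right _ _) (norm_nonneg _))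
  · rintro a b ha hb hda hdb hab ⟨t, ht, h⟩
    set u : ℕ → E := fun n => comb (a n) (fun n => (e n)⁺) + comb (b n) (fun n => (e n)⁻) with hu
    have hu' : ∀ f, comb f u = comb (linearCombination ℝ a f) (fun n => (e n)⁺) +
        comb (linearCombination ℝ b f) fun n => (e n)⁻ := fun f => by
      rw [← comb_comb, ← comb_comb]
      simp only [comb, hu, smul_add, Finsupp.sum_add]
    have hTu : ∀ f, T (comb f u) = T (comb (linearCombination ℝ a f) fun n => (e n)⁺) +
        T (comb (linearCombination ℝ b f) fun n => (e n)⁻) := fun f => by rw [hu', map_add]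
    have hp0 : ∀ n, 0 ≤ comb (a n) (fun n => (e n)⁺) := fun n =>
      comb_nonneg (fun n => posPart_nonneg _) (ha n)
    have hm0 : ∀ n, 0 ≤ comb (b n) (fun n => (e n)⁻) := fun n =>
      comb_nonneg (fun n => negPart_nonneg _) (hb n)
    refine hT.not_isIso (u := u) (fun n => add_nonneg (hp0 n) (hm0 n)) (fun n h0 => ?_) ?_
      ⟨t, ht, fun f => ?_⟩
    · have h1 : t * (‖comb (linearCombination ℝ a (Finsupp.single n 1)) e‖ +
          ‖comb (linearCombination ℝ b (Finsupp.single n 1)) e‖) ≤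
          ‖T (comb (linearCombination ℝ a (Finsupp.single n 1)) fun n => (e n)⁺) +
            T (comb (linearCombination ℝ b (Finsupp.single n 1)) fun n => (e n)⁻)‖ :=
        h (Finsupp.single n 1)
      rw [← hTu, comb_single, h0, smul_zero, map_zero, norm_zero, Finsupp.linearCombination_single,
        Finsupp.linearCombination_single, one_smul, one_smul] at h1
      have h2 : 0 < ‖comb (a n) e‖ + ‖comb (b n) e‖ := by
        rcases hab n with h3 | h3
        · exact add_pos_of_pos_of_nonneg (hpos h3) (norm_nonneg _)
        · exact add_pos_of_nonneg_of_pos (norm_nonneg _) (hpos h3)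
      exact absurd h1 (mul_pos ht h2).not_ge
    · intro m n hmn
      rw [abs_of_nonneg (add_nonneg (hp0 m) (hm0 m)), abs_of_nonneg (add_nonneg (hp0 n) (hm0 n))]
      have hpp := disjoint_comb (e := fun n => (e n)⁺) (fun i j hij =>
        inf_eq_zero_of_le (he i j hij) (abs_nonneg _) (abs_nonneg _) (hp i) (hp j)) hda m n hmn
      have hmm := disjoint_comb (e := fun n => (e n)⁻) (fun i j hij =>
        inf_eq_zero_of_le (he i j hij) (abs_nonneg _) (abs_nonneg _) (hm i) (hm j)) hdb m n hmn
      rw [abs_of_nonneg (hp0 m), abs_of_nonneg (hp0 n)] at hpp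
      rw [abs_of_nonneg (hm0 m), abs_of_nonneg (hm0 n)] at hmm
      have hpm : ∀ i j, (e i)⁺ ⊓ (e j)⁻ = 0 := by
        intro i j
        by_cases hij : i = j
        · subst hij
          exact posPart_inf_negPart_eq_zero _
        · exact inf_eq_zero_of_le (he i j hij) (posPart_nonneg _) (negPart_nonneg _)
            ((le_abs_self _).trans (hp i)) ((le_abs_self _).trans (hm j))
      have hpm' : ∀ i j, comb (a i) (fun n => (e n)⁺) ⊓ comb (b j) (fun n => (e n)⁻) = 0 := by
        intro i j
        refine inf_sum_smul_eq_zero (hp0 i) (fun n => negPart_nonneg _) (hb j) fun k _ => ?_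
        rw [inf_comm]
        refine inf_sum_smul_eq_zero (negPart_nonneg _) (fun n => posPart_nonneg _) (ha i)
          fun l _ => ?_
        rw [inf_comm]
        exact hpm l k
      have hmp' := hpm' n m
      rw [inf_comm] at hmp'
      have key : ∀ {v : E}, 0 ≤ v → comb (a m) (fun n => (e n)⁺) ⊓ v = 0 →
          comb (b m) (fun n => (e n)⁻) ⊓ v = 0 → (u m) ⊓ v = 0 := by
        intro v hv h1 h2
        rw [inf_comm]
        rw [inf_comm] at h1 h2
        exact inf_add_eq_zero hv (hp0 m) (hm0 m) h1 h2
      exact inf_add_eq_zero (add_nonneg (hp0 m) (hm0 m)) (hp0 n) (hm0 n) (key (hp0 n) hpp hmp')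
        (key (hm0 n) (hpm' m n) hmm)
    · refine (mul_le_mul_of_nonneg_left ?_ ht.le).trans
        ((h f).trans_eq (congrArg norm (hTu f)).symm)
      rw [hu']
      exact (norm_add_le _ _).trans (add_le_add (hN _ hp _) (hN _ hm _))

end OfOperator

/-! ### Positive copies of `ℓ¹`: a James-type argument -/

section WeightedL1

open Finsupp (linearCombination)

variable {ι : Type*}

/-- The weighted `ℓ¹` norm `∑ₖ |aₖ| wₖ`. -/
noncomputable def weightedL1 (w : ι → ℝ) (a : ι →₀ ℝ) : ℝ := linearCombination ℝ w (finsuppAbs a)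

lemma weightedL1_eq_sum {w : ι → ℝ} {a : ι →₀ ℝ} {F : Finset ι} (h : a.support ⊆ F) :
    weightedL1 w a = ∑ k ∈ F, |a k| * w k := by
  have h1 : (finsuppAbs a).support ⊆ F := Finsupp.support_mapRange.trans h
  rw [weightedL1, Finsupp.linearCombination_apply, Finsupp.sum_of_support_subset _ h1 _ (by simp)]
  rfl

lemma weightedL1_nonneg {w : ι → ℝ} (hw : ∀ k, 0 ≤ w k) (a : ι →₀ ℝ) : 0 ≤ weightedL1 w a := by
  rw [weightedL1_eq_sum subset_rfl]
  exact Finset.sum_nonneg fun k _ => mul_nonneg (abs_nonneg _) (hw k)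

lemma weightedL1_smul (w : ι → ℝ) (t : ℝ) (a : ι →₀ ℝ) :
    weightedL1 w (t • a) = |t| * weightedL1 w a := by
  rw [weightedL1_eq_sum (Finsupp.support_smul (b := t) (g := a)), weightedL1_eq_sum subset_rfl,
    Finset.mul_sum]
  exact Finset.sum_congr rfl fun k _ => by rw [Finsupp.smul_apply, smul_eq_mul, abs_mul, mul_assoc]

lemma weightedL1_single (w : ι → ℝ) (k : ι) (t : ℝ) :
    weightedL1 w (Finsupp.single k t) = |t| * w k := by
  rw [weightedL1_eq_sum Finsupp.support_single_subset, Finset.sum_singleton, Finsupp.single_eq_same]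

lemma weightedL1_linearCombination {w : ι → ℝ} {c : ℕ → ι →₀ ℝ} (hc : DisjointSupports c)
    (f : ℕ →₀ ℝ) : weightedL1 w (linearCombination ℝ c f) =
      weightedL1 (fun n => weightedL1 w (c n)) f := by
  have h1 : finsuppAbs (linearCombination ℝ c f) =
      linearCombination ℝ (fun n => finsuppAbs (c n)) (finsuppAbs f) := by
    ext k
    have hd : DisjointSupports fun n => finsuppAbs (c n) := hc.of_subset fun n k h => by simp [h]
    by_cases h : ∀ n, c n k = 0
    · simp [linearCombination_apply_eq_zero h,
        linearCombination_apply_eq_zero (c := fun n => finsuppAbs (c n)) (k := k) (by simp [h])]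
    · push Not at h
      obtain ⟨n, hn⟩ := h
      rw [finsuppAbs_apply, hc.linearCombination_apply hn,
        hd.linearCombination_apply (n := n) (by simpa using hn), finsuppAbs_apply,
        finsuppAbs_apply, abs_mul]
  rw [weightedL1, h1, Finsupp.apply_linearCombination]
  rfl

lemma weightedL1_mono_weight {w w' : ι → ℝ} (h : ∀ k, w k ≤ w' k) (a : ι →₀ ℝ) :
    weightedL1 w a ≤ weightedL1 w' a := by
  rw [weightedL1_eq_sum subset_rfl, weightedL1_eq_sum subset_rfl]
  exact Finset.sum_le_sum fun k _ => mul_le_mul_of_nonneg_left (h k) (abs_nonneg _)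

lemma linearCombination_smul_left (t : ℝ) (c : ℕ → ι →₀ ℝ) (f : ℕ →₀ ℝ) :
    linearCombination ℝ (fun n => t • c n) f = t • linearCombination ℝ c f := by
  rw [Finsupp.linearCombination_apply, Finsupp.linearCombination_apply, Finsupp.smul_sum]
  exact Finsupp.sum_congr fun n _ => smul_comm _ _ _

lemma weightedL1_const (t : ℝ) (a : ι →₀ ℝ) :
    weightedL1 (fun _ => t) a = t * weightedL1 (fun _ => 1) a := by
  rw [weightedL1_eq_sum subset_rfl, weightedL1_eq_sum subset_rfl, Finset.mul_sum]
  exact Finset.sum_congr rfl fun k _ => by ring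

variable {X : Type*} [NormedAddCommGroup X] [NormedSpace ℝ X]

lemma norm_map_le_weightedL1 {w : ι → ℝ} {V : (ι →₀ ℝ) →ₗ[ℝ] X}
    (h : ∀ k, ‖V (Finsupp.single k 1)‖ ≤ w k) (a : ι →₀ ℝ) : ‖V a‖ ≤ weightedL1 w a := by
  rw [weightedL1_eq_sum subset_rfl]
  have h1 : V a = ∑ k ∈ a.support, a k • V (Finsupp.single k 1) := by
    conv_lhs => rw [← Finsupp.sum_single a]
    rw [Finsupp.sum, map_sum]
    refine Finset.sum_congr rfl fun k _ => ?_
    rw [← map_smul, Finsupp.smul_single, smul_eq_mul, mul_one]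
  rw [h1]
  refine (norm_sum_le _ _).trans (Finset.sum_le_sum fun k _ => ?_)
  rw [norm_smul, Real.norm_eq_abs]
  exact mul_le_mul_of_nonneg_left (h k) (abs_nonneg _)

/-- `V` maps disjoint vectors `uₙ` of weighted `ℓ¹` norm at most `1` to a sequence with lower
`ℓ¹` estimate `δ`. -/
structure LowerL1 (w : ι → ℝ) (V : (ι →₀ ℝ) →ₗ[ℝ] X) (δ : ℝ) (u : ℕ → ι →₀ ℝ) : Prop where
  disjoint : DisjointSupports u
  le_one : ∀ n, weightedL1 w (u n) ≤ 1
  le_norm : ∀ f, δ * weightedL1 (fun _ => 1) f ≤ ‖V (linearCombination ℝ u f)‖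

/-- The positive part of a finitely supported sequence. -/
noncomputable def finsuppPos (a : ι →₀ ℝ) : ι →₀ ℝ := a.mapRange (fun t => max t 0) (by simp)

@[simp] lemma finsuppPos_apply (a : ι →₀ ℝ) (k : ι) : finsuppPos a k = max (a k) 0 := rfl

lemma finsuppPos_sub (a : ι →₀ ℝ) : finsuppPos a - finsuppPos (-a) = a := by
  ext k
  rcases le_total 0 (a k) with h | h <;> simp [h]

lemma weightedL1_finsuppPos_add (w : ι → ℝ) (a : ι →₀ ℝ) :
    weightedL1 w (finsuppPos a) + weightedL1 w (finsuppPos (-a)) = weightedL1 w a := by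
  have h1 : (finsuppPos (-a)).support ⊆ a.support :=
    Finsupp.support_mapRange.trans (by rw [Finsupp.support_neg])
  have h2 : (finsuppPos a).support ⊆ a.support := Finsupp.support_mapRange
  rw [weightedL1_eq_sum h2, weightedL1_eq_sum h1,
    weightedL1_eq_sum subset_rfl, ← Finset.sum_add_distrib]
  refine Finset.sum_congr rfl fun k _ => ?_
  rcases le_total 0 (a k) with h | h <;> simp [h]

/-- A lower `ℓ¹` estimate on disjoint vectors yields one on disjoint positive vectors. If the
estimate is nearly optimal and, after changes of sign, the negative parts have norm at most `1/2`,
then blocks on which the positive parts are small would improve the optimal constant. -/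
lemma LowerL1.exists_nonneg {w : ι → ℝ} {V : (ι →₀ ℝ) →ₗ[ℝ] X} {δ : ℝ} {u : ℕ → ι →₀ ℝ}
    (h : LowerL1 w V δ u) (hw : ∀ k, 0 ≤ w k) (hδ : 0 < δ) {C : ℝ} (hC : 0 ≤ C)
    (hV : ∀ a, ‖V a‖ ≤ C * weightedL1 w a) :
    ∃ (u' : ℕ → ι →₀ ℝ) (δ' : ℝ), 0 < δ' ∧ (∀ n k, 0 ≤ u' n k) ∧ LowerL1 w V δ' u' := by
  set D : Set ℝ := {δ | ∃ u, LowerL1 w V δ u} with hD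
  have hbdd : BddAbove D := by
    refine ⟨C, ?_⟩
    rintro d ⟨v, hv⟩
    have h1 := hv.le_norm (Finsupp.single 0 1)
    rw [weightedL1_single, Finsupp.linearCombination_single, one_smul, abs_one, one_mul,
      mul_one] at h1
    exact h1.trans ((hV _).trans (mul_le_of_le_one_right hC (hv.le_one 0)))
  have hδs : δ ≤ sSup D := le_csSup hbdd ⟨u, h⟩
  have hne : D.Nonempty := ⟨δ, u, h⟩
  obtain ⟨d, ⟨v, hv⟩, hd⟩ := exists_lt_of_lt_csSup hne
    (by linarith : 2 / 3 * sSup D < sSup D)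
  have hd0 : 0 < d := by linarith
  -- change signs so that the negative parts are the smaller ones
  have hsign : ∀ n, ∃ θ : ℝ, |θ| = 1 ∧ weightedL1 w (finsuppPos (-(θ • v n))) ≤ 1 / 2 := by
    intro n
    have h1 := weightedL1_finsuppPos_add w (v n)
    have h2 := hv.le_one n
    rcases le_total (weightedL1 w (finsuppPos (v n))) (weightedL1 w (finsuppPos (-v n)))
      with h3 | h3
    · refine ⟨-1, by simp, ?_⟩
      rw [neg_one_smul, neg_neg]
      linarith
    · refine ⟨1, by simp, ?_⟩
      rw [one_smul]
      linarith
  choose θ hθ hθv using hsign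
  set p : ℕ → ι →₀ ℝ := fun n => finsuppPos (θ n • v n) with hp
  set q : ℕ → ι →₀ ℝ := fun n => finsuppPos (-(θ n • v n)) with hq
  have hp0 : ∀ n k, 0 ≤ p n k := fun n k => le_max_right _ _
  have hpd : DisjointSupports p := hv.disjoint.of_subset fun n k h => by simp [hp, h]
  have hqd : DisjointSupports q := hv.disjoint.of_subset fun n k h => by simp [hq, h]
  have hp1 : ∀ n, weightedL1 w (p n) ≤ 1 := fun n => by
    have h1 := weightedL1_finsuppPos_add w (θ n • v n)
    rw [weightedL1_smul, hθ, one_mul] at h1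
    have h2 := weightedL1_nonneg hw (q n)
    have h3 := hv.le_one n
    linarith
  have hpq : ∀ f, d * weightedL1 (fun _ => 1) f ≤
      ‖V (linearCombination ℝ p f) - V (linearCombination ℝ q f)‖ := by
    intro f
    have hg : linearCombination ℝ p f - linearCombination ℝ q f =
        linearCombination ℝ v (linearCombination ℝ (fun n => Finsupp.single n (θ n)) f) := by
      rw [← linearCombination_linearCombination]
      have : p = fun n => linearCombination ℝ v (Finsupp.single n (θ n)) + q n := by
        funext n
        rw [Finsupp.linearCombination_single, ← sub_eq_iff_eq_add]
        exact finsuppPos_sub _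
      rw [this, linearCombination_add_left, add_sub_cancel_right]
    have hd1 : DisjointSupports fun n => Finsupp.single n (θ n) := fun m n hmn =>
      Finset.disjoint_of_subset_left Finsupp.support_single_subset
        (Finset.disjoint_of_subset_right Finsupp.support_single_subset (by simpa using hmn))
    rw [← map_sub, hg]
    refine le_trans (le_of_eq ?_) (hv.le_norm _)
    rw [weightedL1_linearCombination hd1]
    simp only [weightedL1_single, hθ, one_mul]
  by_cases htail : ∃ m, ∀ f : ℕ →₀ ℝ, (∀ k ∈ f.support, m ≤ k) →
      d / 4 * weightedL1 (fun _ => 1) f ≤ ‖V (linearCombination ℝ p f)‖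
  · obtain ⟨m, hm⟩ := htail
    refine ⟨fun n => p (n + m), d / 4, by positivity, fun n => hp0 _,
      hpd.comp (add_left_injective m), fun n => hp1 _, fun f => ?_⟩
    have h1 := hm (linearCombination ℝ (shiftSeq m) f) fun k => le_of_mem_support_shiftSeq
    rw [weightedL1_linearCombination (disjointSupports_shiftSeq m),
      ← linearCombination_linearCombination] at h1
    simpa [shiftSeq, weightedL1_single] using h1
  · exfalso
    push Not at htail
    obtain ⟨g, hg, hs⟩ := exists_seq_successive (fun a : ℕ →₀ ℝ => a.support)
      (fun _ a => weightedL1 (fun _ => 1) a = 1 ∧ ‖V (linearCombination ℝ p a)‖ ≤ d / 4) (by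
        intro _ M
        obtain ⟨a, haM, ha⟩ := htail M
        have hN : 0 < weightedL1 (fun _ => 1) a := by
          rcases (weightedL1_nonneg (fun _ => zero_le_one) a).eq_or_lt with h1 | h1
          · rw [← h1, mul_zero] at ha
            exact absurd ha (norm_nonneg _).not_gt
          · exact h1
        refine ⟨(weightedL1 (fun _ => 1) a)⁻¹ • a, fun k hk => haM k (Finsupp.support_smul hk),
          ?_, ?_⟩
        · rw [weightedL1_smul, abs_of_pos (inv_pos.2 hN), inv_mul_cancel₀ hN.ne']
        · rw [map_smul, map_smul, norm_smul, norm_inv, Real.norm_of_nonneg hN.le,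
            inv_mul_le_iff₀ hN, mul_comm]
          exact ha.le)
    have hgd : DisjointSupports g := SuccessiveSupports.disjoint hs
    have hbig : 3 / 2 * d ∈ D := by
      refine ⟨fun n => linearCombination ℝ q ((2 : ℝ) • g n), hqd.linearCombination
        (hgd.of_subset fun n k h => by simp [h]), fun n => ?_, fun f => ?_⟩
      · rw [weightedL1_linearCombination hqd]
        refine (weightedL1_mono_weight hθv _).trans ?_
        rw [weightedL1_const, weightedL1_smul, (hg n).1]
        norm_num
      · have h1 : linearCombination ℝ (fun n => (2 : ℝ) • g n) f =
            (2 : ℝ) • linearCombination ℝ g f :=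
          linearCombination_smul_left 2 g f
        have h2 := hpq (linearCombination ℝ g f)
        rw [weightedL1_linearCombination hgd] at h2
        simp only [fun n => (hg n).1] at h2
        have h3 : ‖V (linearCombination ℝ p (linearCombination ℝ g f))‖ ≤
            d / 4 * weightedL1 (fun _ => 1) f := by
          rw [← weightedL1_const]
          refine norm_map_le_weightedL1 (w := fun _ => d / 4)
            (V := V ∘ₗ linearCombination ℝ p ∘ₗ linearCombination ℝ g) (fun n => ?_) f
          rw [LinearMap.comp_apply, LinearMap.comp_apply, Finsupp.linearCombination_single,
            one_smul]
          exact (hg n).2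
        have h4 := norm_sub_le (V (linearCombination ℝ p (linearCombination ℝ g f)))
          (V (linearCombination ℝ q (linearCombination ℝ g f)))
        rw [linearCombination_linearCombination, h1, map_smul, map_smul, norm_smul,
          Real.norm_of_nonneg zero_le_two]
        linarith
    have := le_csSup hbdd hbig
    linarith

end WeightedL1

section NotL1

open Finsupp (linearCombination)

variable {X : Type*} [NormedAddCommGroup X] [NormedSpace ℝ X]
variable {N : Seminorm ℝ (ℕ →₀ ℝ)} {P Q : (ℕ →₀ ℝ) →ₗ[ℝ] X} {C δ : ℝ}

lemma SplitPair.le_weightedL1 (h : SplitPair N P Q C) {φ : StrongDual ℝ X} (R : (ℕ →₀ ℝ) →ₗ[ℝ] X)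
    (hR : ∀ a, ‖R a‖ ≤ C * N a) (a : ℕ →₀ ℝ) :
    weightedL1 (fun k => |φ (R (Finsupp.single k 1))|) a ≤ ‖φ‖ * C * N a := by
  -- choose signs making all the terms `|aₖ| φ (R eₖ)` nonnegative
  have hsign : ∀ r : ℝ, ∃ t : ℝ, |t| = 1 ∧ t * r = |r| := fun r => by
    rcases le_total 0 r with hr | hr
    · exact ⟨1, by simp, by rw [one_mul, abs_of_nonneg hr]⟩
    · exact ⟨-1, by simp, by rw [neg_one_mul, abs_of_nonpos hr]⟩
  choose t ht htr using fun k => hsign (φ (R (Finsupp.single k 1)))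
  have hd : DisjointSupports fun k => Finsupp.single k (t k) := fun m n hmn =>
    Finset.disjoint_of_subset_left Finsupp.support_single_subset
      (Finset.disjoint_of_subset_right Finsupp.support_single_subset (by simpa using hmn))
  set b := linearCombination ℝ (fun k => Finsupp.single k (t k)) (finsuppAbs a) with hb
  have h1 : φ (R b) = weightedL1 (fun k => |φ (R (Finsupp.single k 1))|) a := by
    rw [hb, weightedL1, Finsupp.apply_linearCombination, ← ContinuousLinearMap.coe_coe,
      Finsupp.apply_linearCombination]
    congr 2
    funext k
    have h2 : Finsupp.single k (t k) = t k • Finsupp.single k (1 : ℝ) := by simp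
    rw [Function.comp_apply, Function.comp_apply, h2, map_smul, map_smul, smul_eq_mul]
    exact htr k
  have h2 : N b = N a := h.congr fun k => by
    rw [hb, hd.linearCombination_apply (n := k) (by
      rw [Finsupp.single_eq_same]
      intro h0
      simpa [h0] using ht k), Finsupp.single_eq_same, abs_mul, ht, finsuppAbs_apply, abs_abs,
      mul_one]
  rw [← h1, ← h2]
  calc φ (R b) ≤ ‖φ (R b)‖ := le_abs_self _
    _ ≤ ‖φ‖ * ‖R b‖ := φ.le_opNorm _
    _ ≤ ‖φ‖ * (C * N b) := mul_le_mul_of_nonneg_left (hR b) (norm_nonneg _)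
    _ = ‖φ‖ * C * N b := by ring

/-- If no normalized positive element is almost annihilated by the functionals in `Φ`, the norm `N`
is equivalent to a weighted `ℓ¹` norm. -/
lemma SplitPair.exists_weights (h : SplitPair N P Q C) (Φ : Finset (StrongDual ℝ X))
    {ε : ℝ} (hε : 0 < ε) (hcon : ∀ c : ℕ →₀ ℝ, (∀ k, 0 ≤ c k) → N c = 1 →
      ∃ φ ∈ Φ, |φ (P c)| ≤ ε → ε < |φ (Q c)|) :
    ∃ l : ℕ → ℝ, (∀ k, 0 < l k) ∧ (∃ K : ℝ, 0 < K ∧ ∀ a, weightedL1 l a ≤ K * N a) ∧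
      ∀ a, ε * N a ≤ weightedL1 l a := by
  have hC := h.pos
  set l : ℕ → ℝ := fun k =>
    ∑ φ ∈ Φ, (|φ (P (Finsupp.single k 1))| + |φ (Q (Finsupp.single k 1))|) with hl
  have hl0 : ∀ k, 0 ≤ l k := fun k => Finset.sum_nonneg fun φ _ => by positivity
  have hsum : ∀ a, weightedL1 l a = ∑ φ ∈ Φ,
      (weightedL1 (fun k => |φ (P (Finsupp.single k 1))|) a +
        weightedL1 (fun k => |φ (Q (Finsupp.single k 1))|) a) := by
    intro a
    simp only [weightedL1_eq_sum (a := a) subset_rfl, hl, Finset.mul_sum, mul_add,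
      Finset.sum_add_distrib]
    rw [Finset.sum_comm, Finset.sum_comm (s := a.support) (t := Φ)]
  have hK : ∃ K : ℝ, 0 < K ∧ ∀ a, weightedL1 l a ≤ K * N a := by
    refine ⟨∑ φ ∈ Φ, (‖φ‖ * C + ‖φ‖ * C) + 1,
      add_pos_of_nonneg_of_pos (Finset.sum_nonneg fun φ _ => by positivity) one_pos, fun a => ?_⟩
    rw [hsum, add_mul, Finset.sum_mul]
    refine (Finset.sum_le_sum fun φ _ => ?_).trans (le_add_of_nonneg_right (by simp))
    rw [add_mul]
    exact add_le_add (h.le_weightedL1 P h.left_le a) (h.le_weightedL1 Q h.right_le a)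
  have hlow : ∀ a, ε * N a ≤ weightedL1 l a := by
    have hpos : ∀ a : ℕ →₀ ℝ, (∀ k, 0 ≤ a k) → N a = 1 → ε ≤ weightedL1 l a := by
      intro a ha h1
      obtain ⟨φ, hφ, hφa⟩ := hcon a ha h1
      have hP : |φ (P a)| ≤ weightedL1 (fun k => |φ (P (Finsupp.single k 1))|) a :=
        norm_map_le_weightedL1 (V := φ.toLinearMap ∘ₗ P) (fun k => le_rfl) a
      have hQ : |φ (Q a)| ≤ weightedL1 (fun k => |φ (Q (Finsupp.single k 1))|) a :=
        norm_map_le_weightedL1 (V := φ.toLinearMap ∘ₗ Q) (fun k => le_rfl) a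
      have hsing := Finset.single_le_sum (f := fun φ : StrongDual ℝ X =>
        weightedL1 (fun k => |φ (P (Finsupp.single k 1))|) a +
        weightedL1 (fun k => |φ (Q (Finsupp.single k 1))|) a)
        (fun φ _ => add_nonneg (weightedL1_nonneg (fun k => abs_nonneg _) a)
          (weightedL1_nonneg (fun k => abs_nonneg _) a)) hφ
      rw [hsum]
      refine le_trans ?_ hsing
      by_cases hcase : |φ (P a)| ≤ ε
      · have h3 := hφa hcase
        have := abs_nonneg (φ (P a))
        linarith
      · have := abs_nonneg (φ (Q a))
        linarith
    intro a
    by_cases ha : a = 0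
    · subst ha
      rw [map_zero, mul_zero]
      exact weightedL1_nonneg hl0 _
    · have hN := h.pos_of_ne ha
      have h1 := hpos ((N a)⁻¹ • finsuppAbs a) (fun k => by
        simpa using mul_nonneg (inv_nonneg.2 hN.le) (abs_nonneg _)) (by
        rw [map_smul_eq_mul, norm_inv, Real.norm_of_nonneg hN.le,
          h.congr (a := finsuppAbs a) (b := a) (fun k => by simp), inv_mul_cancel₀ hN.ne'])
      have h2 : weightedL1 l (finsuppAbs a) = weightedL1 l a := by
        rw [weightedL1, weightedL1]
        congr 1
        ext k
        simp
      rw [weightedL1_smul, h2, abs_of_pos (inv_pos.2 hN), le_inv_mul_iff₀ hN] at h1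
      linarith
  refine ⟨l, fun k => ?_, hK, hlow⟩
  · have h1 := hlow (Finsupp.single k 1)
    rw [weightedL1_single, abs_one, one_mul] at h1
    exact (mul_pos hε (h.pos_of_ne (Finsupp.single_ne_zero.2 one_ne_zero))).trans_le h1

/-- A split pair has no positive copy of `ℓ¹`, hence admits normalized positive elements which
are almost annihilated by any finitely many functionals. -/
lemma SplitPair.exists_small_functionals (h : SplitPair N P Q C) (Φ : Finset (StrongDual ℝ X))
    {ε : ℝ} (hε : 0 < ε) : ∃ c : ℕ →₀ ℝ, (∀ k, 0 ≤ c k) ∧ N c = 1 ∧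
      ∀ φ ∈ Φ, |φ (P c)| ≤ ε ∧ |φ (Q c)| ≤ ε := by
  by_contra! hcon
  have hC := h.pos
  obtain ⟨l, hlpos, ⟨K, hK0, hK⟩, hlow⟩ := h.exists_weights Φ hε hcon
  have hl0 : ∀ k, 0 ≤ l k := fun k => (hlpos k).le
  -- both halves together act on two copies of the weighted `ℓ¹` space
  let A : (ℕ ⊕ ℕ →₀ ℝ) →ₗ[ℝ] (ℕ →₀ ℝ) := Finsupp.lcomapDomain Sum.inl Sum.inl_injective
  let B : (ℕ ⊕ ℕ →₀ ℝ) →ₗ[ℝ] (ℕ →₀ ℝ) := Finsupp.lcomapDomain Sum.inr Sum.inr_injective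
  have hA : ∀ a k, A a k = a (Sum.inl k) := fun a k => rfl
  have hB : ∀ a k, B a k = a (Sum.inr k) := fun a k => rfl
  set w : ℕ ⊕ ℕ → ℝ := Sum.elim l l with hw
  have hwAB : ∀ a, weightedL1 w a = weightedL1 l (A a) + weightedL1 l (B a) := by
    intro a
    rw [weightedL1_eq_sum (F := (A a).support.disjSum (B a).support) (fun k hk => ?_),
      Finset.sum_disjSum, weightedL1_eq_sum subset_rfl, weightedL1_eq_sum subset_rfl]
    · rfl
    · rw [Finsupp.mem_support_iff] at hk
      rcases k with k | k
      · rw [Finset.inl_mem_disjSum, Finsupp.mem_support_iff]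
        exact hk
      · rw [Finset.inr_mem_disjSum, Finsupp.mem_support_iff]
        exact hk
  have hw0 : ∀ k, 0 ≤ w k := by rintro (k | k) <;> exact hl0 k
  let V : (ℕ ⊕ ℕ →₀ ℝ) →ₗ[ℝ] X := P ∘ₗ A + Q ∘ₗ B
  have hVdef : ∀ a, V a = P (A a) + Q (B a) := fun a => rfl
  have hV : ∀ a, ‖V a‖ ≤ C / ε * weightedL1 w a := by
    intro a
    have h1 := h.left_le (A a)
    have h2 := h.right_le (B a)
    have h3 := mul_le_mul_of_nonneg_left (hlow (A a)) hC.le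
    have h4 := mul_le_mul_of_nonneg_left (hlow (B a)) hC.le
    rw [hwAB, hVdef, div_mul_eq_mul_div, le_div_iff₀ hε]
    have h5 := mul_le_mul_of_nonneg_right (norm_add_le (P (A a)) (Q (B a))) hε.le
    have h6 := mul_le_mul_of_nonneg_right h1 hε.le
    have h7 := mul_le_mul_of_nonneg_right h2 hε.le
    linarith
  let t : ℕ → ℝ := fun n => (2 * l n)⁻¹
  have ht0 : ∀ n, 0 < t n := fun n => inv_pos.2 (mul_pos two_pos (hlpos n))
  have htl : ∀ n, t n * l n = 1 / 2 := fun n => by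
    have := (hlpos n).ne'
    simp only [t]
    field_simp
  set d : ℕ → ℕ →₀ ℝ := fun n => Finsupp.single n (t n) with hd
  have hdd : DisjointSupports d := fun m n hmn =>
    Finset.disjoint_of_subset_left Finsupp.support_single_subset
      (Finset.disjoint_of_subset_right Finsupp.support_single_subset (by simpa using hmn))
  set u : ℕ → (ℕ ⊕ ℕ →₀ ℝ) := fun n =>
    Finsupp.single (Sum.inl n) (t n) - Finsupp.single (Sum.inr n) (t n) with hu
  have hAu : ∀ n, A (u n) = d n := fun n => by
    ext k
    simp [hA, hu, hd, Finsupp.single_apply]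
  have hBu : ∀ n, B (u n) = (-1 : ℝ) • d n := fun n => by
    ext k
    simp [hB, hu, hd, Finsupp.single_apply]
  have hbase : LowerL1 w V (1 / (2 * (K * C))) u := by
    refine ⟨fun m n hmn => ?_, fun n => ?_, fun f => ?_⟩
    · rw [Finset.disjoint_left]
      rintro (k | k) hm hn
      · have h1 : d m k ≠ 0 := by rw [← hAu, hA]; exact Finsupp.mem_support_iff.1 hm
        have h2 : d n k ≠ 0 := by rw [← hAu, hA]; exact Finsupp.mem_support_iff.1 hn
        exact Finset.disjoint_left.1 (hdd m n hmn) (Finsupp.mem_support_iff.2 h1)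
          (Finsupp.mem_support_iff.2 h2)
      · have h1 : d m k ≠ 0 := fun h0 => Finsupp.mem_support_iff.1 hm (by
          rw [← hB, hBu, Finsupp.smul_apply, h0, smul_zero])
        have h2 : d n k ≠ 0 := fun h0 => Finsupp.mem_support_iff.1 hn (by
          rw [← hB, hBu, Finsupp.smul_apply, h0, smul_zero])
        exact Finset.disjoint_left.1 (hdd m n hmn) (Finsupp.mem_support_iff.2 h1)
          (Finsupp.mem_support_iff.2 h2)
    · rw [hwAB, hAu, hBu, weightedL1_smul, weightedL1_single,
        abs_of_pos (ht0 n), htl]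
      norm_num
    · have h1 : V (linearCombination ℝ u f) =
          P (linearCombination ℝ d f) - Q (linearCombination ℝ d f) := by
        have h2 : A (linearCombination ℝ u f) = linearCombination ℝ d f := by
          rw [Finsupp.apply_linearCombination]
          exact congrArg (fun v => linearCombination ℝ v f) (funext hAu)
        have h3 : B (linearCombination ℝ u f) = (-1 : ℝ) • linearCombination ℝ d f := by
          rw [Finsupp.apply_linearCombination, ← linearCombination_smul_left]
          exact congrArg (fun v => linearCombination ℝ v f) (funext hBu)
        rw [hVdef, h2, h3, map_smul, neg_one_smul, sub_eq_add_neg]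
      have h2 := hK (linearCombination ℝ d f)
      have h3 := mul_le_mul_of_nonneg_left (h.le_sub (linearCombination ℝ d f)) hK0.le
      rw [weightedL1_linearCombination hdd] at h2
      simp only [hd, weightedL1_single, abs_of_pos (ht0 _), htl] at h2
      rw [weightedL1_const] at h2
      rw [h1, one_div_mul_eq_div, div_le_iff₀ (by positivity)]
      linarith
  obtain ⟨u', δ', hδ', hu'0, hu'⟩ := hbase.exists_nonneg hw0 (by positivity)
    (div_nonneg hC.le hε.le) hV
  refine h.not_le (fun n => A (u' n)) (fun n => B (u' n)) (fun n k => hu'0 n _)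
    (fun n k => hu'0 n _) (fun m n hmn => ?_) (fun m n hmn => ?_) (fun n => ?_)
    ⟨ε * δ', by positivity, fun f => ?_⟩
  · rw [Finset.disjoint_left]
    intro k hm hn
    rw [Finsupp.mem_support_iff, hA] at hm hn
    exact Finset.disjoint_left.1 (hu'.disjoint m n hmn) (Finsupp.mem_support_iff.2 hm)
      (Finsupp.mem_support_iff.2 hn)
  · rw [Finset.disjoint_left]
    intro k hm hn
    rw [Finsupp.mem_support_iff, hB] at hm hn
    exact Finset.disjoint_left.1 (hu'.disjoint m n hmn) (Finsupp.mem_support_iff.2 hm)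
      (Finsupp.mem_support_iff.2 hn)
  · by_contra! h0
    have h1 := hu'.le_norm (Finsupp.single n 1)
    rw [Finsupp.linearCombination_single, one_smul, hVdef, h0.1, h0.2, map_zero, map_zero, add_zero,
      norm_zero, weightedL1_single, abs_one, one_mul, mul_one] at h1
    exact absurd h1 hδ'.not_ge
  · have h1 := hu'.le_norm f
    have hA' : A (linearCombination ℝ u' f) = linearCombination ℝ (fun n => A (u' n)) f :=
      Finsupp.apply_linearCombination ℝ A u' f
    have hB' : B (linearCombination ℝ u' f) = linearCombination ℝ (fun n => B (u' n)) f :=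
      Finsupp.apply_linearCombination ℝ B u' f
    have h2 : weightedL1 w (linearCombination ℝ u' f) ≤ weightedL1 (fun _ => 1) f := by
      rw [weightedL1_linearCombination hu'.disjoint]
      exact weightedL1_mono_weight hu'.le_one f
    rw [hVdef, hA', hB'] at h1
    rw [hwAB, hA', hB'] at h2
    have h3 := hlow (linearCombination ℝ (fun n => A (u' n)) f)
    have h4 := hlow (linearCombination ℝ (fun n => B (u' n)) f)
    refine le_trans ?_ h1
    rw [mul_comm ε, mul_assoc]
    refine mul_le_mul_of_nonneg_left ?_ hδ'.le
    linarith

lemma SplitPair.exists_small_functionals_tail (h : SplitPair N P Q C) (Φ : Finset (StrongDual ℝ X))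
    {ε : ℝ} (hε : 0 < ε) (m : ℕ) : ∃ c : ℕ →₀ ℝ, (∀ k, 0 ≤ c k) ∧ (∀ k ∈ c.support, m ≤ k) ∧
      N c = 1 ∧ ∀ φ ∈ Φ, |φ (P c)| ≤ ε ∧ |φ (Q c)| ≤ ε := by
  obtain ⟨c, hc0, hc1, hc⟩ := (h.block (disjointSupports_shiftSeq m) (shiftSeq_nonneg m)
    (shiftSeq_ne_zero m)).exists_small_functionals Φ hε
  exact ⟨linearCombination ℝ (shiftSeq m) c, linearCombination_nonneg (shiftSeq_nonneg m) hc0,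
    fun k => le_of_mem_support_shiftSeq, hc1, hc⟩

end NotL1

/-! ### Selection of a basic sequence -/

section Selection

open Finsupp (linearCombination)

variable {X : Type*} [NormedAddCommGroup X] [NormedSpace ℝ X]

/-- Finitely many functionals norm a finite-dimensional subspace up to a factor of `2`. -/
lemma exists_norming (F : Submodule ℝ X) [FiniteDimensional ℝ F] :
    ∃ Φ : Finset (StrongDual ℝ X), (∀ φ ∈ Φ, ‖φ‖ ≤ 1) ∧
      ∀ y ∈ F, ∃ φ ∈ Φ, ‖y‖ ≤ 2 * |φ y| := by
  classical
  have : ProperSpace F := FiniteDimensional.proper_real F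
  obtain ⟨t, -, htf, ht⟩ := finite_cover_balls_of_compact (isCompact_sphere (0 : F) 1)
    (by norm_num : (0 : ℝ) < 1 / 4)
  choose g hg1 hg using fun v : F => exists_dual_vector'' ℝ (v : X)
  refine ⟨insert 0 (htf.toFinset.image g), fun φ hφ => ?_, fun y hy => ?_⟩
  · rcases Finset.mem_insert.1 hφ with rfl | hφ
    · simp
    · obtain ⟨v, -, rfl⟩ := Finset.mem_image.1 hφ
      exact hg1 v
  · by_cases hy0 : y = 0
    · exact ⟨0, Finset.mem_insert_self _ _, by simp [hy0]⟩
    · have hn : 0 < ‖y‖ := norm_pos_iff.2 hy0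
      let v : F := ⟨‖y‖⁻¹ • y, F.smul_mem _ hy⟩
      have hv : v ∈ Metric.sphere (0 : F) 1 := by
        rw [mem_sphere_zero_iff_norm, Submodule.coe_norm, norm_smul, norm_inv, norm_norm,
          inv_mul_cancel₀ hn.ne']
      obtain ⟨x, hxt, hx⟩ := Set.mem_iUnion₂.1 (ht hv)
      rw [Metric.mem_ball, dist_eq_norm, norm_sub_rev] at hx
      refine ⟨g x, Finset.mem_insert_of_mem
        (Finset.mem_image_of_mem _ (htf.mem_toFinset.2 hxt)), ?_⟩
      have hx' : ‖(x : X) - ‖y‖⁻¹ • y‖ < 1 / 4 := hx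
      have hv1 : ‖‖y‖⁻¹ • y‖ = 1 := by rw [norm_smul, norm_inv, norm_norm, inv_mul_cancel₀ hn.ne']
      have h1 : 3 / 4 ≤ ‖(x : X)‖ := by
        have := norm_sub_norm_le (‖y‖⁻¹ • y) (x : X)
        rw [norm_sub_rev] at this
        linarith
      have h2 : ‖(x : X)‖ - 1 / 4 ≤ g x (‖y‖⁻¹ • y) := by
        have h3 : g x ((x : X) - ‖y‖⁻¹ • y) ≤ 1 / 4 :=
          (le_abs_self _).trans (((g x).le_opNorm _).trans
            ((mul_le_of_le_one_left (norm_nonneg _) (hg1 x)).trans hx'.le))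
        rw [map_sub, hg x] at h3
        simp only [RCLike.ofReal_real_eq_id, id] at h3
        linarith
      rw [map_smul, smul_eq_mul] at h2
      have h3 : 1 / 2 ≤ ‖y‖⁻¹ * g x y := by linarith
      rw [le_inv_mul_iff₀ hn] at h3
      have := le_abs_self (g x y)
      linarith

/-- If vectors `Gⱼ` are almost annihilated by functionals norming the partial sums of the preceding
ones, then the partial sums of `∑ Gⱼ` are dominated by the sum. -/
lemma norm_partial_sum_le (G : ℕ → X) (Φ : ℕ → Set (StrongDual ℝ X))
    (h1 : ∀ m, ∃ φ ∈ Φ m, ‖φ‖ ≤ 1 ∧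
      ‖∑ j ∈ Finset.range m, G j‖ ≤ 2 * |φ (∑ j ∈ Finset.range m, G j)|)
    (h2 : ∀ m j, m ≤ j → ∀ φ ∈ Φ m, |φ (G j)| ≤ 1 / 8 * (1 / 2) ^ (j + 1) * ‖G j‖)
    {m n : ℕ} (hmn : m ≤ n) :
    ‖∑ j ∈ Finset.range m, G j‖ ≤ 4 * ‖∑ j ∈ Finset.range n, G j‖ := by
  set S : ℕ → X := fun m => ∑ j ∈ Finset.range m, G j with hS
  obtain ⟨m₀, hm₀, hmax⟩ := Finset.exists_max_image (Finset.range (n + 1)) (fun m => ‖S m‖)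
    ⟨0, by simp⟩
  have hm₀n : m₀ ≤ n := Nat.lt_succ_iff.1 (Finset.mem_range.1 hm₀)
  refine (hmax m (Finset.mem_range.2 (Nat.lt_succ_of_le hmn))).trans ?_
  set M := ‖S m₀‖ with hM
  have hG : ∀ j < n, ‖G j‖ ≤ 2 * M := by
    intro j hj
    have h3 : G j = S (j + 1) - S j := by simp [hS, Finset.sum_range_succ]
    have h4 := hmax j (Finset.mem_range.2 (by omega))
    have h5 := hmax (j + 1) (Finset.mem_range.2 (by omega))
    rw [h3]
    exact (norm_sub_le _ _).trans (by linarith)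
  obtain ⟨φ, hφ, hφ1, hφS⟩ := h1 m₀
  have hsplit : S n = S m₀ + ∑ j ∈ Finset.Ico m₀ n, G j :=
    (Finset.sum_range_add_sum_Ico G hm₀n).symm
  have htail : |φ (∑ j ∈ Finset.Ico m₀ n, G j)| ≤ M / 4 := by
    rw [map_sum]
    have hgeo : ∑ j ∈ Finset.Ico m₀ n, (1 / 2 : ℝ) ^ (j + 1) ≤ 1 := by
      have h3 : ∀ n : ℕ, ∑ j ∈ Finset.range n, (1 / 2 : ℝ) ^ (j + 1) = 1 - (1 / 2) ^ n := by
        intro n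
        induction n with
        | zero => simp
        | succ n ih => rw [Finset.sum_range_succ, ih]; ring
      calc ∑ j ∈ Finset.Ico m₀ n, (1 / 2 : ℝ) ^ (j + 1)
          ≤ ∑ j ∈ Finset.range n, (1 / 2 : ℝ) ^ (j + 1) :=
            Finset.sum_le_sum_of_subset_of_nonneg
              (fun j hj => Finset.mem_range.2 (Finset.mem_Ico.1 hj).2) fun _ _ _ => by positivity
        _ ≤ 1 := by rw [h3]; linarith [show (0 : ℝ) ≤ (1 / 2) ^ n by positivity]
    calc |∑ j ∈ Finset.Ico m₀ n, φ (G j)| ≤ ∑ j ∈ Finset.Ico m₀ n, |φ (G j)| :=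
          Finset.abs_sum_le_sum_abs _ _
      _ ≤ ∑ j ∈ Finset.Ico m₀ n, M / 4 * (1 / 2) ^ (j + 1) := by
          refine Finset.sum_le_sum fun j hj => ?_
          obtain ⟨hj1, hj2⟩ := Finset.mem_Ico.1 hj
          refine (h2 m₀ j hj1 φ hφ).trans ?_
          have := mul_le_mul_of_nonneg_left (hG j hj2)
            (by positivity : (0 : ℝ) ≤ 1 / 8 * (1 / 2) ^ (j + 1))
          linarith
      _ = M / 4 * ∑ j ∈ Finset.Ico m₀ n, (1 / 2 : ℝ) ^ (j + 1) := by rw [Finset.mul_sum]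
      _ ≤ M / 4 * 1 := mul_le_mul_of_nonneg_left hgeo (by positivity)
      _ = M / 4 := mul_one _
  have h3 : |φ (S m₀)| ≤ |φ (S n)| + M / 4 := by
    have h4 : φ (S m₀) = φ (S n) - φ (∑ j ∈ Finset.Ico m₀ n, G j) := by
      rw [hsplit, map_add, add_sub_cancel_right]
    rw [h4]
    exact (abs_sub _ _).trans (by linarith)
  have h4 : |φ (S n)| ≤ ‖S n‖ :=
    (φ.le_opNorm _).trans (mul_le_of_le_one_left (norm_nonneg _) hφ1)
  linarith

variable {N : Seminorm ℝ (ℕ →₀ ℝ)} {P Q : (ℕ →₀ ℝ) →ₗ[ℝ] X} {C δ : ℝ}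

/-- `P c` is far from the multiples `s • Q c` with `|s| ≤ 1`. Otherwise `P c` would be close to
`(P - Q) d` for a positive multiple `d` of `c`, and `P` would be bounded below on blocks. -/
lemma SplitPair.exists_le_norm_smul_add_of_le (h : SplitPair N P Q C) : ∃ (m : ℕ) (κ : ℝ), 0 < κ ∧
    ∀ c : ℕ →₀ ℝ, (∀ k, 0 ≤ c k) → (∀ k ∈ c.support, m ≤ k) → N c = 1 →
      ∀ s t : ℝ, |s| ≤ |t| → κ * |t| ≤ ‖s • P c + t • Q c‖ := by
  by_contra! hcon
  have hC := h.pos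
  set η : ℝ := 1 / (4 * C) with hη
  have hη0 : 0 < η := by positivity
  obtain ⟨p, hp, hs⟩ := exists_seq_successive (fun p : (ℕ →₀ ℝ) × ℝ => p.1.support)
    (fun m p => (∀ k, 0 ≤ p.1 k) ∧ N p.1 = 1 ∧ 1 / 2 ≤ p.2 ∧
      ‖P p.1 - p.2 • (P p.1 - Q p.1)‖ ≤ η * (1 / 2) ^ (m + 1)) (by
      intro m M
      set κ : ℝ := min (1 / (2 * C)) (η * (1 / 2) ^ (m + 1) / (2 * C ^ 2)) with hκ
      have hκ0 : 0 < κ := by positivity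
      obtain ⟨c, hc0, hcM, hc1, s, t, hst, hlt⟩ := hcon M κ hκ0
      have ht : t ≠ 0 := by
        rintro rfl
        rw [abs_zero, mul_zero] at hlt
        exact absurd hlt (norm_nonneg _).not_gt
      -- `r = -s / t` satisfies `Q c ≈ r • P c`
      set r : ℝ := -(s / t) with hr
      have hr1 : |r| ≤ 1 := by rw [hr, abs_neg, abs_div]; exact div_le_one_of_le₀ hst (abs_nonneg _)
      have hQr : ‖Q c - r • P c‖ < κ := by
        have h1 : s • P c + t • Q c = t • (Q c - r • P c) := by
          rw [smul_sub, smul_smul, hr, mul_neg, mul_div_cancel₀ _ ht, neg_smul, sub_neg_eq_add,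
            add_comm]
        rw [h1, norm_smul, Real.norm_eq_abs, mul_comm] at hlt
        exact lt_of_mul_lt_mul_right hlt (abs_nonneg _)
      have hr2 : 0 ≤ 1 - r := by linarith [le_abs_self r]
      have hPc : ‖P c‖ ≤ C := by simpa [hc1] using h.left_le c
      have hlow : 1 / (2 * C ^ 2) ≤ 1 - r := by
        have h1 := h.le_sub c
        have h2 : P c - Q c = (1 - r) • P c - (Q c - r • P c) := by
          rw [sub_smul, one_smul]; abel
        have h3 : ‖P c - Q c‖ ≤ (1 - r) * C + 1 / (2 * C) := by
          rw [h2]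
          refine (norm_sub_le _ _).trans (add_le_add ?_ (hQr.le.trans (min_le_left _ _)))
          rw [norm_smul, Real.norm_of_nonneg hr2]
          exact mul_le_mul_of_nonneg_left hPc hr2
        rw [hc1] at h1
        have h4 := h1.trans (mul_le_mul_of_nonneg_left h3 hC.le)
        have h5 : C * (1 / (2 * C)) = 1 / 2 := by field_simp
        rw [mul_add, h5] at h4
        rw [div_le_iff₀ (by positivity)]
        linarith
      have hr3 : 0 < 1 - r := lt_of_lt_of_le (by positivity) hlow
      refine ⟨(c, (1 - r)⁻¹), hcM, hc0, hc1, ?_, ?_⟩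
      · rw [one_div]
        exact inv_anti₀ hr3 (by linarith [neg_abs_le r])
      · have h1 : P c - (1 - r)⁻¹ • (P c - Q c) = (1 - r)⁻¹ • (Q c - r • P c) := by
          have h2 : P c = (1 - r)⁻¹ • ((1 - r) • P c) := by
            rw [smul_smul, inv_mul_cancel₀ hr3.ne', one_smul]
          conv_lhs => rw [h2]
          rw [← smul_sub]
          conv_lhs => rw [← h2]
          rw [sub_smul, one_smul]
          congr 1
          abel
        change ‖P c - (1 - r)⁻¹ • (P c - Q c)‖ ≤ _
        rw [h1, norm_smul, norm_inv, Real.norm_of_nonneg hr2, inv_mul_le_iff₀ hr3]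
        have h2 : 0 ≤ η * (1 / 2) ^ (m + 1) := by positivity
        refine hQr.le.trans ((min_le_right _ _).trans ?_)
        rw [div_eq_mul_one_div, mul_comm]
        exact mul_le_mul_of_nonneg_right hlow h2)
  choose hc0 hc1 hr hsmall using hp
  set c : ℕ → ℕ →₀ ℝ := fun n => (p n).1 with hc
  set d : ℕ → ℕ →₀ ℝ := fun n => (p n).2 • (p n).1 with hd
  have hcd : DisjointSupports c := SuccessiveSupports.disjoint hs
  have hdd : DisjointSupports d := hcd.of_subset fun n k h => by
    rw [hd, Finsupp.smul_apply, h, smul_zero]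
  refine h.not_le c (fun _ => 0) hc0 (fun _ _ => le_rfl) hcd (fun _ _ _ => by simp)
    (fun n => Or.inl fun h0 => by have := hc1 n; simp [hc] at h0; simp [h0] at this)
    ⟨η, hη0, fun f => ?_⟩
  have h4 : linearCombination ℝ (fun _ : ℕ => (0 : ℕ →₀ ℝ)) f = 0 := by
    simp [Finsupp.linearCombination_apply]
  rw [h4, map_zero, map_zero, add_zero, add_zero]
  have herr : ‖P (linearCombination ℝ c f) -
      (P (linearCombination ℝ d f) - Q (linearCombination ℝ d f))‖ ≤
      η * N (linearCombination ℝ c f) :=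
    norm_map_le_of_small (L := P ∘ₗ linearCombination ℝ c - (P ∘ₗ linearCombination ℝ d -
      Q ∘ₗ linearCombination ℝ d)) hη0.le (apply_nonneg _ _)
      (fun n => by simpa [hc, hd, smul_sub] using hsmall n)
      fun n => by simpa [hc, hc1 n] using h.abs_mul_le hcd f n
  have h5 := h.le_sub (linearCombination ℝ d f)
  have h6 : N (linearCombination ℝ c f) ≤ 2 * N (linearCombination ℝ d f) := by
    have h7 : (2 : ℝ) * N (linearCombination ℝ d f) = N (linearCombination ℝ d ((2 : ℝ) • f)) := by
      rw [map_smul, map_smul_eq_mul, Real.norm_of_nonneg zero_le_two]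
    have h8 : linearCombination ℝ d ((2 : ℝ) • f) =
        linearCombination ℝ (fun n => (2 : ℝ) • d n) f := by
      rw [linearCombination_smul_left, map_smul]
    rw [h7, h8]
    refine h.solid ((hdd.of_subset fun n k h => by simp [h]).abs_linearCombination_le
      (fun n k => ?_) fun n => le_rfl)
    have h9 : (1 : ℝ) ≤ |2 * (p n).2| := by
      have := le_abs_self (2 * (p n).2)
      have := hr n
      linarith
    have h10 : ((2 : ℝ) • d n) k = 2 * (p n).2 * c n k := by simp [hd, hc, mul_assoc]
    rw [h10, abs_mul]
    exact le_mul_of_one_le_left (abs_nonneg _) h9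
  have h7 := norm_sub_norm_le (P (linearCombination ℝ d f) - Q (linearCombination ℝ d f))
    (P (linearCombination ℝ c f))
  rw [norm_sub_rev _ (P (linearCombination ℝ c f))] at h7
  have h8 : N (linearCombination ℝ c f) / (2 * C) ≤
      ‖P (linearCombination ℝ d f) - Q (linearCombination ℝ d f)‖ := by
    rw [div_le_iff₀ (by positivity)]
    linarith
  have h9 : N (linearCombination ℝ c f) / (2 * C) = 2 * (η * N (linearCombination ℝ c f)) := by
    rw [hη]; field_simp; norm_num
  linarith

lemma SplitPair.exists_le_norm_smul_add (h : SplitPair N P Q C) : ∃ (m : ℕ) (κ : ℝ), 0 < κ ∧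
    ∀ c : ℕ →₀ ℝ, (∀ k, 0 ≤ c k) → (∀ k ∈ c.support, m ≤ k) → N c = 1 →
      ∀ s t : ℝ, κ * max |s| |t| ≤ ‖s • P c + t • Q c‖ := by
  obtain ⟨m₁, κ₁, hκ₁, h₁⟩ := h.exists_le_norm_smul_add_of_le
  obtain ⟨m₂, κ₂, hκ₂, h₂⟩ := h.symm.exists_le_norm_smul_add_of_le
  refine ⟨max m₁ m₂, min κ₁ κ₂, lt_min hκ₁ hκ₂, fun c hc0 hcm hc1 s t => ?_⟩
  rcases le_total |s| |t| with hst | hst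
  · rw [max_eq_right hst]
    exact (mul_le_mul_of_nonneg_right (min_le_left _ _) (abs_nonneg _)).trans
      (h₁ c hc0 (fun k hk => (le_max_left _ _).trans (hcm k hk)) hc1 s t hst)
  · rw [max_eq_left hst, add_comm]
    exact (mul_le_mul_of_nonneg_right (min_le_right _ _) (abs_nonneg _)).trans
      (h₂ c hc0 (fun k hk => (le_max_right _ _).trans (hcm k hk)) hc1 t s hst)

/-- Inductively, one chooses normalized positive blocks almost annihilated by functionals that norm
the span of everything chosen before. -/
lemma SplitPair.exists_isBasicSeq [CompleteSpace X] (h : SplitPair N P Q C) :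
    ∃ c : ℕ → ℕ →₀ ℝ, (∀ n k, 0 ≤ c n k) ∧ SuccessiveSupports c ∧ (∀ n, c n ≠ 0) ∧
      IsBasicSeq (interleave (fun n => P (c n)) fun n => Q (c n)) := by
  classical
  have hC := h.pos
  obtain ⟨m₀, κ, hκ, hκc⟩ := h.exists_le_norm_smul_add
  let F : ℕ → Submodule ℝ X := fun M => Submodule.span ℝ
    ((fun k => P (Finsupp.single k 1)) '' Set.Iio M ∪
      (fun k => Q (Finsupp.single k 1)) '' Set.Iio M)
  have hFfin : ∀ M, FiniteDimensional ℝ (F M) := fun M => FiniteDimensional.span_of_finite ℝ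
    (((Set.finite_Iio M).image _).union ((Set.finite_Iio M).image _))
  have hF : ∀ (R : (ℕ →₀ ℝ) →ₗ[ℝ] X) (M : ℕ), (∀ k < M, R (Finsupp.single k 1) ∈ F M) →
      ∀ a : ℕ →₀ ℝ, (∀ k ∈ a.support, k < M) → R a ∈ F M := by
    intro R M hR a ha
    rw [← Finsupp.sum_single a, Finsupp.sum, map_sum]
    refine Submodule.sum_mem _ fun k hk => ?_
    have h1 : Finsupp.single k (a k) = a k • Finsupp.single k (1 : ℝ) := by simp
    rw [h1, map_smul]
    exact Submodule.smul_mem _ _ (hR k (ha k hk))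
  choose Φ hΦ1 hΦ using fun M => exists_norming (F M)
  let ε : ℕ → ℝ := fun m => κ / 16 * (1 / 2) ^ (m + 1)
  have hε : ∀ m, 0 < ε m := fun m => by positivity
  obtain ⟨c, L, hL, hc, hσ⟩ := exists_seq_of_tails (fun a : ℕ →₀ ℝ => a.support)
    (fun m M a => (∀ k, 0 ≤ a k) ∧ N a = 1 ∧ (∀ k ∈ a.support, m₀ ≤ k) ∧
      ∀ φ ∈ (Finset.range (M + 1)).biUnion Φ, |φ (P a)| ≤ ε m ∧ |φ (Q a)| ≤ ε m) (by
      intro m M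
      obtain ⟨a, ha0, haM, ha1, ha⟩ := h.exists_small_functionals_tail
        ((Finset.range (M + 1)).biUnion Φ) (hε m) (max M m₀)
      exact ⟨a, fun k hk => (le_max_left _ _).trans (haM k hk), ha0, ha1,
        fun k hk => (le_max_right _ _).trans (haM k hk), ha⟩)
  have hκ' : ∀ n s t, κ * max |s| |t| ≤ ‖s • P (c n) + t • Q (c n)‖ := fun n s t =>
    hκc (c n) (hc n).1 (hc n).2.2.1 (hc n).2.1 s t
  refine ⟨c, fun n => (hc n).1, fun m n hmn i hi j hj =>
    (hσ m i hi).2.trans_le ((hL hmn).trans (hσ n j hj).1),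
    fun n h0 => by have := (hc n).2.1; simp [h0] at this, ?_⟩
  refine isBasicSeq_iff.2 ⟨fun n => ?_, 4 + 8 * (C / κ), fun A n => ?_⟩
  · rcases Nat.even_or_odd' n with ⟨m, rfl | rfl⟩
    · rw [interleave_two_mul]
      intro h0
      have := hκ' m 1 0
      simp [h0] at this
      exact absurd this hκ.not_ge
    · rw [interleave_two_mul_add_one]
      intro h0
      have := hκ' m 0 1
      simp [h0] at this
      exact absurd this hκ.not_ge
  · set w := interleave (fun n => P (c n)) fun n => Q (c n) with hw
    let G : ℕ → X := fun j => A (2 * j) • P (c j) + A (2 * j + 1) • Q (c j)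
    have hS : ∀ m, ∑ i ∈ Finset.range (2 * m), A i • w i = ∑ j ∈ Finset.range m, G j := by
      intro m
      induction m with
      | zero => simp
      | succ m ih =>
        rw [Finset.sum_range_succ, ← ih, mul_add, mul_one, Finset.sum_range_succ,
          Finset.sum_range_succ, hw, interleave_two_mul, interleave_two_mul_add_one, add_assoc]
    have hGκ : ∀ j, κ * max |A (2 * j)| |A (2 * j + 1)| ≤ ‖G j‖ := fun j => hκ' j _ _
    have hpart : ∀ m, ‖∑ j ∈ Finset.range m, G j‖ ≤ 4 * ‖comb A w‖ := by
      intro m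
      have h1 : comb A w = ∑ j ∈ Finset.range (max m (A.support.sup id + 1)), G j := by
        rw [← hS, sum_eq_comb]
        intro k hk
        have h2 : k ≤ A.support.sup id := Finset.le_sup (f := id) hk
        have h3 := le_max_right m (A.support.sup id + 1)
        rw [Finset.mem_range]
        omega
      rw [h1]
      refine norm_partial_sum_le G (fun m => (Φ (L m) : Set (StrongDual ℝ X))) (fun m => ?_)
        (fun m j hmj φ hφ => ?_) (le_max_left _ _)
      · obtain ⟨φ, hφ, hφS⟩ := hΦ (L m) (∑ j ∈ Finset.range m, G j) (by
          refine Submodule.sum_mem _ fun j hj => ?_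
          have hsupp : ∀ k ∈ (c j).support, k < L m := fun k hk =>
            (hσ j k hk).2.trans_le (hL (Finset.mem_range.1 hj))
          exact Submodule.add_mem _
            (Submodule.smul_mem _ _ (hF P _ (fun k hk => Submodule.subset_span
              (Or.inl ⟨k, hk, rfl⟩)) _ hsupp))
            (Submodule.smul_mem _ _ (hF Q _ (fun k hk => Submodule.subset_span
              (Or.inr ⟨k, hk, rfl⟩)) _ hsupp)))
        exact ⟨φ, hφ, hΦ1 _ φ hφ, hφS⟩
      · have hφ' : φ ∈ (Finset.range (L j + 1)).biUnion Φ :=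
          Finset.mem_biUnion.2 ⟨L m, Finset.mem_range.2 (Nat.lt_succ_of_le (hL hmj)), hφ⟩
        obtain ⟨hP, hQ⟩ := (hc j).2.2.2 φ hφ'
        have h2 : |φ (G j)| ≤ |A (2 * j)| * ε j + |A (2 * j + 1)| * ε j := by
          rw [map_add, map_smul, map_smul, smul_eq_mul, smul_eq_mul]
          refine (abs_add_le _ _).trans ?_
          rw [abs_mul, abs_mul]
          exact add_le_add (mul_le_mul_of_nonneg_left hP (abs_nonneg _))
            (mul_le_mul_of_nonneg_left hQ (abs_nonneg _))
        have h3 := mul_le_mul_of_nonneg_right (le_max_left |A (2 * j)| |A (2 * j + 1)|) (hε j).le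
        have h4 := mul_le_mul_of_nonneg_right (le_max_right |A (2 * j)| |A (2 * j + 1)|) (hε j).le
        have h5 := mul_le_mul_of_nonneg_right (hGκ j)
          (by positivity : (0 : ℝ) ≤ 1 / 8 * (1 / 2) ^ (j + 1))
        have h6 : κ * max |A (2 * j)| |A (2 * j + 1)| * (1 / 8 * (1 / 2) ^ (j + 1)) =
            2 * (max |A (2 * j)| |A (2 * j + 1)| * ε j) := by
          simp only [ε]; ring
        linarith
    have hnn := norm_nonneg (comb A w)
    have hCκ : 0 ≤ C / κ := by positivity
    rcases Nat.even_or_odd' n with ⟨m, rfl | rfl⟩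
    · rw [hS]
      refine (hpart m).trans ?_
      have := mul_nonneg hCκ hnn
      linarith
    · rw [Finset.sum_range_succ, hS, hw, interleave_two_mul, ← hw]
      have h1 : ‖G m‖ ≤ 8 * ‖comb A w‖ := by
        have h2 : G m = ∑ j ∈ Finset.range (m + 1), G j - ∑ j ∈ Finset.range m, G j := by
          rw [Finset.sum_range_succ, add_sub_cancel_left]
        rw [h2]
        exact (norm_sub_le _ _).trans (by linarith [hpart m, hpart (m + 1)])
      have h2 : |A (2 * m)| ≤ ‖G m‖ / κ := by
        rw [le_div_iff₀ hκ, mul_comm]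
        exact (mul_le_mul_of_nonneg_left (le_max_left _ _) hκ.le).trans (hGκ m)
      have h3 : ‖A (2 * m) • P (c m)‖ ≤ |A (2 * m)| * C := by
        rw [norm_smul, Real.norm_eq_abs]
        exact mul_le_mul_of_nonneg_left (by simpa [(hc m).2.1] using h.left_le (c m)) (abs_nonneg _)
      have h4 : |A (2 * m)| * C ≤ 8 * (C / κ) * ‖comb A w‖ := by
        refine (mul_le_mul_of_nonneg_right h2 hC.le).trans ?_
        have h5 := mul_le_mul_of_nonneg_left h1 hCκ
        calc ‖G m‖ / κ * C = C / κ * ‖G m‖ := by ring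
          _ ≤ _ := by linarith
      refine (norm_add_le _ _).trans ?_
      rw [add_mul]
      exact add_le_add (hpart m) (h3.trans h4)

lemma PositiveSplitPair.exists_isBasicSeq [CompleteSpace X] (h : PositiveSplitPair N P Q C δ) :
    ∃ (N' : Seminorm ℝ (ℕ →₀ ℝ)) (P' Q' : (ℕ →₀ ℝ) →ₗ[ℝ] X), PositiveSplitPair N' P' Q' C δ ∧
      IsBasicSeq
        (interleave (fun n => P' (Finsupp.single n 1)) fun n => Q' (Finsupp.single n 1)) := by
  obtain ⟨c, hc0, hc, hcne, hbasic⟩ := h.toSplitPair.exists_isBasicSeq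
  refine ⟨_, _, _, h.block hc.disjoint hc0 hcne, ?_⟩
  simpa using hbasic

end Selection

/-! ### Basic sequences obtained from split pairs -/

section SplitBasic

open Finsupp (linearCombination)

variable {X : Type*} [NormedAddCommGroup X] [NormedSpace ℝ X]
variable {N : Seminorm ℝ (ℕ →₀ ℝ)} {P Q : (ℕ →₀ ℝ) →ₗ[ℝ] X} {C δ : ℝ}

lemma LeConst.trans {ι : Type*} {f g k : ι → ℝ} (hfg : LeConst f g) (hgk : LeConst g k) :
    LeConst f k := by
  obtain ⟨A, hA, hfg⟩ := hfg
  obtain ⟨B, hB, hgk⟩ := hgk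
  refine ⟨A * B, mul_pos hA hB, fun b => (hfg b).trans ?_⟩
  rw [mul_assoc]
  exact mul_le_mul_of_nonneg_left (hgk b) hA.le

lemma comb_map_single (R : (ℕ →₀ ℝ) →ₗ[ℝ] X) (a : ℕ →₀ ℝ) :
    comb a (fun n => R (Finsupp.single n 1)) = R a := by
  conv_rhs => rw [← Finsupp.sum_single a]
  rw [comb, Finsupp.sum, Finsupp.sum, map_sum]
  refine Finset.sum_congr rfl fun n _ => ?_
  rw [← map_smul, Finsupp.smul_single, smul_eq_mul, mul_one]

lemma comb_interleave_map_single (P Q : (ℕ →₀ ℝ) →ₗ[ℝ] X) (A : ℕ →₀ ℝ) :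
    comb A (interleave (fun n => P (Finsupp.single n 1)) fun n => Q (Finsupp.single n 1)) =
      P (evenPart A) + Q (oddPart A) := by
  rw [comb_interleave, comb_map_single, comb_map_single]

lemma PositiveSplitPair.le_norm_abs (h : PositiveSplitPair N P Q C δ) (A : ℕ →₀ ℝ) :
    δ * (N (evenPart A) + N (oddPart A)) ≤ ‖absComb A
      (interleave (fun n => P (Finsupp.single n 1)) fun n => Q (Finsupp.single n 1))‖ := by
  rw [absComb_eq, comb_interleave_map_single]
  refine le_trans (le_of_eq ?_) (h.lower _ _ (fun k => by simp) fun k => by simp)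
  rw [h.congr (a := evenPart A) (b := evenPart (finsuppAbs A)) (fun k => by simp),
    h.congr (a := oddPart A) (b := oddPart (finsuppAbs A)) (fun k => by simp)]

lemma SplitPair.norm_le (h : SplitPair N P Q C) (A : ℕ →₀ ℝ) :
    ‖comb A (interleave (fun n => P (Finsupp.single n 1)) fun n => Q (Finsupp.single n 1))‖ ≤
      C * (N (evenPart A) + N (oddPart A)) := by
  rw [comb_interleave_map_single, mul_add]
  exact (norm_add_le _ _).trans (add_le_add (h.left_le _) (h.right_le _))

lemma PositiveSplitPair.absDominates (h : PositiveSplitPair N P Q C δ) :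
    AbsDominates
      (interleave (fun n => P (Finsupp.single n 1)) fun n => Q (Finsupp.single n 1)) := by
  have hC := h.pos
  have hδ := h.lower_pos
  refine ⟨C / δ, by positivity, fun A => (h.norm_le A).trans ?_⟩
  have h1 := mul_le_mul_of_nonneg_left (h.le_norm_abs A) (by positivity : 0 ≤ C / δ)
  have h2 : C / δ * (δ * (N (evenPart A) + N (oddPart A))) =
      C * (N (evenPart A) + N (oddPart A)) := by field_simp
  exact h2.ge.trans h1

lemma PositiveSplitPair.noUnconditionalPositiveBlock [CompleteSpace X]
    (h : PositiveSplitPair N P Q C δ) : NoUnconditionalPositiveBlock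
      (interleave (fun n => P (Finsupp.single n 1)) fun n => Q (Finsupp.single n 1)) := by
  intro v hv hun
  obtain ⟨K, hK0, hK⟩ := (h.absDominates.isUnconditionalSeq_iff hv).1 hun
  obtain ⟨c, hc0, hc, hvc, hv0⟩ := isPositiveBlockSubseq_iff.1 hv
  have hδ := h.lower_pos
  have hdisj : ∀ φ : ℕ → ℕ, Function.Injective φ → ∀ d : ℕ → ℕ →₀ ℝ,
      (∀ n k, d n k = c n (φ k)) → DisjointSupports d := by
    intro φ _ d hd m n hmn
    rw [Finset.disjoint_left]
    intro i hi hj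
    rw [Finsupp.mem_support_iff, hd] at hi hj
    exact Finset.disjoint_left.1 (hc.disjoint m n hmn) (Finsupp.mem_support_iff.2 hi)
      (Finsupp.mem_support_iff.2 hj)
  have hda : DisjointSupports fun n => evenPart (c n) :=
    hdisj _ injective_two_mul _ fun n k => rfl
  have hdb : DisjointSupports fun n => oddPart (c n) :=
    hdisj _ injective_two_mul_add_one _ fun n k => rfl
  have hev : ∀ f, evenPart (linearCombination ℝ c f) =
      linearCombination ℝ (fun n => evenPart (c n)) f := fun f => by
    ext k
    simp [linearCombination_finsupp_apply]
  have hod : ∀ f, oddPart (linearCombination ℝ c f) =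
      linearCombination ℝ (fun n => oddPart (c n)) f := fun f => by
    ext k
    simp [linearCombination_finsupp_apply]
  refine h.not_le (fun n => evenPart (c n)) (fun n => oddPart (c n)) (fun n k => hc0 n _)
    (fun n k => hc0 n _) hda hdb (fun n => ?_) ⟨δ / K, by positivity, fun f => ?_⟩
  · by_contra! h0
    refine hv0 n ?_
    rw [hvc, comb_interleave, h0.1, h0.2]
    simp [comb]
  · have hvf : ∀ f, comb f v = comb (linearCombination ℝ c f)
        (interleave (fun n => P (Finsupp.single n 1)) fun n => Q (Finsupp.single n 1)) :=
        fun f => by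
      rw [← comb_comb]
      exact congrArg (comb f) (funext hvc)
    have h1 := hK f
    rw [absComb_eq, hvf, hvf, comb_interleave_map_single _ _ (linearCombination ℝ c f), hev,
      hod, ← hc.disjoint.finsuppAbs_linearCombination hc0, ← absComb_eq] at h1
    have h2 := h.le_norm_abs (linearCombination ℝ c f)
    rw [hev, hod] at h2
    rw [div_mul_eq_mul_div, div_le_iff₀ hK0, mul_comm _ K]
    exact h2.trans h1

/-- The signed blocks are `P eₙ - Q eₙ`, and all the expressions are equivalent to `N`. -/
lemma PositiveSplitPair.exists_signed_block (h : PositiveSplitPair N P Q C δ) :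
    ∃ (s : ℕ → Finset ℕ) (a : ℕ → ℝ) (z : ℕ → X), IsBlockSubseq
      (interleave (fun n => P (Finsupp.single n 1)) fun n => Q (Finsupp.single n 1)) s a z ∧
      ApproxEq (fun b : ℕ →₀ ℝ => ‖comb b z‖)
        (fun b => ‖absComb b (fun n => ∑ k ∈ s n, |a k| •
          interleave (fun n => P (Finsupp.single n 1)) (fun n => Q (Finsupp.single n 1)) k)‖) ∧
      ApproxEq (fun b : ℕ →₀ ℝ => ‖absComb b (fun n => ∑ k ∈ s n, |a k| •
          interleave (fun n => P (Finsupp.single n 1)) (fun n => Q (Finsupp.single n 1)) k)‖)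
        (fun b => max
          ‖comb b (fun n => ∑ k ∈ s n with 0 < a k, a k •
            interleave (fun n => P (Finsupp.single n 1)) (fun n => Q (Finsupp.single n 1)) k)‖
          ‖comb b (fun n => ∑ k ∈ s n with a k < 0, a k •
            interleave (fun n => P (Finsupp.single n 1))
              (fun n => Q (Finsupp.single n 1)) k)‖) := by
  have hC := h.pos
  have hδ := h.lower_pos
  set x : ℕ → X := fun n => P (Finsupp.single n 1) with hx
  set y : ℕ → X := fun n => Q (Finsupp.single n 1) with hy
  set s : ℕ → Finset ℕ := fun n => {2 * n, 2 * n + 1} with hs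
  set a : ℕ → ℝ := fun k => if k % 2 = 0 then 1 else -1 with ha
  have ha0 : ∀ n, a (2 * n) = 1 := fun n => by simp [ha]
  have ha1 : ∀ n, a (2 * n + 1) = -1 := fun n => by
    have : (2 * n + 1) % 2 = 1 := by omega
    simp [ha, this]
  have hne : ∀ n : ℕ, 2 * n ∉ ({2 * n + 1} : Finset ℕ) := fun n => by simp
  have hsum : ∀ n, ∑ k ∈ s n, a k • interleave x y k = x n - y n := fun n => by
    rw [hs, Finset.sum_insert (hne n), Finset.sum_singleton, ha0, ha1, interleave_two_mul,
      interleave_two_mul_add_one, one_smul, neg_one_smul, sub_eq_add_neg]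
  have habs : (fun n => ∑ k ∈ s n, |a k| • interleave x y k) =
      fun n => x n + y n := funext fun n => by
    rw [hs, Finset.sum_insert (hne n), Finset.sum_singleton, ha0, ha1, interleave_two_mul,
      interleave_two_mul_add_one, abs_neg, abs_one, one_smul, one_smul]
  have hpos : (fun n => ∑ k ∈ s n with 0 < a k, a k • interleave x y k) = x := funext fun n => by
    rw [hs, Finset.sum_filter, Finset.sum_insert (hne n), Finset.sum_singleton, ha0, ha1,
      interleave_two_mul, if_pos one_pos, if_neg (by norm_num), one_smul, add_zero]
  have hneg : (fun n => ∑ k ∈ s n with a k < 0, a k • interleave x y k) = fun n => -y n :=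
    funext fun n => by
      rw [hs, Finset.sum_filter, Finset.sum_insert (hne n), Finset.sum_singleton, ha0, ha1,
        interleave_two_mul_add_one, if_neg (by norm_num), if_pos (by norm_num), neg_one_smul,
        zero_add]
  have hz : ∀ b, comb b (fun n => x n - y n) = P b - Q b := fun b => by
    rw [comb_sub_right, hx, hy, comb_map_single, comb_map_single]
  have hzabs : ∀ b, absComb b (fun n => x n + y n) =
      P (finsuppAbs b) + Q (finsuppAbs b) := fun b => by
    rw [absComb_eq, comb]
    simp only [smul_add, Finsupp.sum_add]
    exact congrArg₂ (· + ·) (comb_map_single P _) (comb_map_single Q _)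
  have hzpos : ∀ b, comb b x = P b := comb_map_single P
  have hzneg : ∀ b, comb b (fun n => -y n) = -Q b := fun b => by
    rw [← comb_map_single Q, comb, comb, ← Finsupp.sum_neg]
    simp only [smul_neg, hy]
  have hNabs : ∀ b, N (finsuppAbs b) = N b := fun b => h.congr fun k => by simp
  -- all three expressions are equivalent to `N b`
  have e1 : ∀ b, ‖P b - Q b‖ ≤ 2 * C * N b := fun b =>
    (norm_sub_le _ _).trans (by linarith [h.left_le b, h.right_le b])
  have e2 : ∀ b, N b ≤ C * ‖P b - Q b‖ := h.le_sub
  have e3 : ∀ b, ‖P (finsuppAbs b) + Q (finsuppAbs b)‖ ≤ 2 * C * N b := fun b => by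
    have h1 := h.left_le (finsuppAbs b)
    have h2 := h.right_le (finsuppAbs b)
    rw [hNabs] at h1 h2
    exact (norm_add_le _ _).trans (by linarith)
  have e4 : ∀ b, 2 * δ * N b ≤ ‖P (finsuppAbs b) + Q (finsuppAbs b)‖ := fun b => by
    have h1 := h.lower (finsuppAbs b) (finsuppAbs b) (fun k => by simp) fun k => by simp
    rw [hNabs] at h1
    linarith
  have e5 : ∀ b, max ‖P b‖ ‖Q b‖ ≤ C * N b := fun b => max_le (h.left_le b) (h.right_le b)
  have e6 : ∀ b, N b ≤ 2 * C * max ‖P b‖ ‖Q b‖ := fun b => by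
    refine (e2 b).trans ?_
    have h1 : ‖P b - Q b‖ ≤ 2 * max ‖P b‖ ‖Q b‖ := (norm_sub_le _ _).trans (by
      linarith [le_max_left ‖P b‖ ‖Q b‖, le_max_right ‖P b‖ ‖Q b‖])
    linarith [mul_le_mul_of_nonneg_left h1 hC.le]
  have f4 : LeConst (fun b => N b) fun b => ‖P (finsuppAbs b) + Q (finsuppAbs b)‖ := by
    refine ⟨(2 * δ)⁻¹, by positivity, fun b => ?_⟩
    rw [le_inv_mul_iff₀ (by positivity)]
    exact e4 b
  refine ⟨s, a, fun n => x n - y n, ⟨?_, fun n => (hsum n).symm, fun n h0 => ?_⟩, ?_, ?_⟩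
  · intro m n hmn i hi j hj
    simp only [hs, Finset.mem_insert, Finset.mem_singleton] at hi hj
    omega
  · exact absurd (e2 (Finsupp.single n 1)) (not_le.2 (by
      rw [show P (Finsupp.single n 1) - Q (Finsupp.single n 1) = 0 from h0, norm_zero, mul_zero]
      exact h.pos_of_ne (Finsupp.single_ne_zero.2 one_ne_zero)))
  · simp only [habs, hz, hzabs]
    exact ⟨LeConst.trans ⟨2 * C, by positivity, e1⟩ f4,
      LeConst.trans ⟨2 * C, by positivity, e3⟩ ⟨C, hC, e2⟩⟩
  · simp only [habs, hpos, hneg, hzpos, hzneg, hzabs, norm_neg]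
    exact ⟨LeConst.trans ⟨2 * C, by positivity, e3⟩ ⟨2 * C, by positivity, e6⟩,
      LeConst.trans ⟨C, hC, e5⟩ f4⟩

end SplitBasic

/-! ### The equivalences -/

theorem theorem2p5 (X : Type u) [NormedAddCommGroup X] [NormedSpace ℝ X]
    [CompleteSpace X] :
    [ -- (a)
      ∃ (E : Type v) (_ : NormedAddCommGroup E) (_ : NormedSpace ℝ E) (_ : Lattice E)
        (_ : IsBanachLattice E) (T : E →L[ℝ] X), IsLSS T ∧ ¬ IsDSS T,
      -- (b)
      ∃ x y : ℕ → X, IsBasicSeq x ∧ IsBasicSeq y ∧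
        NoUnconditionalPositiveBlock (interleave x y) ∧
        IsUnconditionalSeq (fun n => x n - y n) ∧
        ApproxEq (fun a : ℕ →₀ ℝ => ‖comb a (fun n => x n - y n)‖)
          (fun a => max ‖comb a x‖ ‖comb a y‖),
      -- (c)
      ∃ x : ℕ → X, IsBasicSeq x ∧
        AbsDominates x ∧
        NoUnconditionalPositiveBlock x ∧
        ∃ (s : ℕ → Finset ℕ) (a : ℕ → ℝ) (z : ℕ → X), IsBlockSubseq x s a z ∧
          ApproxEq (fun b : ℕ →₀ ℝ => ‖comb b z‖)
            (fun b => ‖absComb b (fun n => ∑ k ∈ s n, |a k| • x k)‖) ∧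
          ApproxEq (fun b : ℕ →₀ ℝ => ‖absComb b (fun n => ∑ k ∈ s n, |a k| • x k)‖)
            (fun b => max ‖comb b (fun n => ∑ k ∈ s n with 0 < a k, a k • x k)‖
              ‖comb b (fun n => ∑ k ∈ s n with a k < 0, a k • x k)‖),
      -- (d)
      ∃ (E : Type v) (_ : NormedAddCommGroup E) (_ : NormedSpace ℝ E) (_ : Lattice E)
        (_ : IsBanachLattice E) (T₁ T₂ : E →L[ℝ] X),
        IsLSS T₁ ∧ IsLSS T₂ ∧ ¬ IsLSS (T₁ + T₂) ].TFAE ∧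
    -- the reformulation of the condition on positive blocks in (c)
    ∀ x : ℕ → X, IsBasicSeq x → AbsDominates x →
      (NoUnconditionalPositiveBlock x ↔
        ∀ y : ℕ → X, IsPositiveBlockSubseq x y → ∀ ε : ℝ, 0 < ε →
          ∃ b : ℕ →₀ ℝ, ‖absComb b y‖ = 1 ∧ ‖comb b y‖ < ε) := by
  constructor
  · tfae_have 1 → 3 := by
      rintro ⟨E, _, _, _, _, T, hT, hT'⟩
      obtain ⟨N, P, Q, C, h⟩ := hT.exists_splitPair hT'
      obtain ⟨N', P', Q', δ, h'⟩ := h.exists_positiveSplitPair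
      obtain ⟨N'', P'', Q'', h'', hbasic⟩ := h'.exists_isBasicSeq
      exact ⟨_, hbasic, h''.absDominates, h''.noUnconditionalPositiveBlock, h''.exists_signed_block⟩
    tfae_have 3 → 2 := by
      rintro ⟨x, hx, -, hno, s, a, z, hz, h₁, h₂⟩
      obtain ⟨x', y', hx', hy', h⟩ := exists_isDominatedPair hx hno hz h₁ h₂
      exact ⟨x', y', hx', hy', h.noUncond, h.uncond, h.approx⟩
    tfae_have 2 → 1 := by
      rintro ⟨x, y, hx, hy, h₁, h₂, h₃⟩
      exact IsDominatedPair.exists_isLSS_not_isDSS (isBasicSeq_iff.1 hx).1 (isBasicSeq_iff.1 hy).1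
        ⟨h₁, h₂, h₃⟩
    tfae_have 2 → 4 := by
      rintro ⟨x, y, -, -, h₁, h₂, h₃⟩
      exact IsDominatedPair.exists_isLSS_add_not_isLSS ⟨h₁, h₂, h₃⟩
    tfae_have 4 → 1 := by
      rintro ⟨E, i₁, i₂, i₃, i₄, T₁, T₂, h₁, h₂, h⟩
      exact ⟨E, i₁, i₂, i₃, i₄, T₂, h₂, h₁.not_isDSS_of_add h⟩
    tfae_finish
  · exact fun x _ hx => noUnconditionalPositiveBlock_iff hx
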